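/- Let $X_1,X_2,\dots$ be independent copies of a random variable with absolutely continuous distribution function $F$, and put $l_F=\inf\{x:F(x)>0\}$, $r_F=\sup\{x:F(x)<1\}$ (possibly infinite). The upper record times are $L(1)=1$, $L(n)=\min\{j>L(n-1):X_j>X_{L(n-1)}\}$, and the upper record values are $X(n)=X_{L(n)}$. Let $n,k,r$ be integers with $1\le k\le n-1$ and $r\ge 1$. Let $h$ be a real function that is continuous at the real points of $[l_F,r_F]$ and has a continuous derivative $h^{(k+r-1)}$ on $(l_F,r_F)$. For $u\neq v$ write $$M(u,v)=\frac{h(v)-h(u)}{v-u},\qquad {}_iM_j(u,v)=\frac{\partial^{i+j}}{\partial u^i\partial v^j}M(u,v),\qquad M_j={}_0M_j,$$ let ${}_iM'_j$ be defined in the same way from $M'(u,v)=\dfrac{h'(v)-h'(u)}{v-u}$, and let ${}_iM_j(l_F,v)=\lim_{u\to l_F^+}{}_iM_j(u,v)$ (with $u\to-\infty$ if $l_F=-\infty$). Consider the regression identities $$E\big[h^{(k+r-1)}(X(n))\mid X(n-k)=u,\,X(n+r)=v\big]=\frac{(k+r-1)!}{(k-1)!\,(r-1)!}\;{}_{r-1}M_{k-1}(u,v)\qquad(l_F<u<v<r_F),\tag{1}$$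 and, for $k\ge2$, $$E\big[h^{(k+r-1)}(X(n))\mid X(n-k+1)=u,\,X(n+r)=v\big]=\frac{(k+r-2)!}{(k-2)!\,(r-1)!}\;{}_{r-1}M'_{k-2}(u,v)\qquad(l_F<u<v<r_F),\tag{2}$$ where the left-hand sides are integrals with respect to the conditional distribution of $X(n)$ given the two other record values, and the identities are required for almost all $(u,v)$ with respect to the joint law of the conditioning pair. Finally, consider the condition $$l_F>-\infty,\quad r_F=\infty,\quad\text{and there is } c>0\text{ with } F(x)=1-e^{-c(x-l_F)}\text{ for all } x\ge l_F.\tag{3}$$ A. Let $r=1$, and suppose that for every $v\in(l_F,r_F)$ the value $M_k(l_F,v)$ exists as a finite limit and is nonzero. Then (1) holds if and only if (3) holds. B. Let $r\ge2$ and $2\le k\le n-1$, and suppose that for every $v\in(l_F,r_F)$ the value ${}_rM_{k-1}(l_F,v)$ exists as a finite limit and is nonzero. Then (1) and (2) both hold if and only if (3) holds. -/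

import Mathlib

open MeasureTheory ProbabilityTheory Filter Topology

noncomputable section

/-- Record times of a sequence `x 0, x 1, …`: `recordTime x m` is the position of the
`(m + 1)`-st upper record. The first observation is a record, and the next record is the first
later observation that strictly exceeds the current one. (If there is none, the value is `0`;
for independent observations with a common continuous law this has probability zero.) -/
def recordTime (x : ℕ → ℝ) : ℕ → ℕ
  | 0 => 0
  | m + 1 => sInf {j : ℕ | recordTime x m < j ∧ x (recordTime x m) < x j}

/-- The `n`-th upper record value `X(n)`, `n ≥ 1`, of the sequence `X 0, X 1, …`. -/
def upperRecord {Ω : Type*} (X : ℕ → Ω → ℝ) (n : ℕ) (ω : Ω) : ℝ :=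
  X (recordTime (fun i => X i ω) (n - 1)) ω

/-- The left extremity `l_F = inf {x : F x > 0}`, possibly `-∞`. -/
def leftExtremity (F : ℝ → ℝ) : EReal :=
  sInf ((fun x : ℝ => (x : EReal)) '' {x : ℝ | 0 < F x})

/-- The right extremity `r_F = sup {x : F x < 1}`, possibly `∞`. -/
def rightExtremity (F : ℝ → ℝ) : EReal :=
  sSup ((fun x : ℝ => (x : EReal)) '' {x : ℝ | F x < 1})

/-- The real points of the closed interval `[l_F, r_F]`. -/
def closedRange (F : ℝ → ℝ) : Set ℝ :=
  {x : ℝ | leftExtremity F ≤ (x : EReal) ∧ (x : EReal) ≤ rightExtremity F}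

/-- The open interval `(l_F, r_F)`. -/
def openRange (F : ℝ → ℝ) : Set ℝ :=
  {x : ℝ | leftExtremity F < (x : EReal) ∧ (x : EReal) < rightExtremity F}

/-- The difference quotient `M(u, v) = (h v - h u) / (v - u)`. -/
def diffQuot (h : ℝ → ℝ) (u v : ℝ) : ℝ := (h v - h u) / (v - u)

/-- The mixed partial derivative `∂^{i+j} M / ∂u^i ∂v^j` at `(u, v)`. -/
def diffQuotDeriv (h : ℝ → ℝ) (i j : ℕ) (u v : ℝ) : ℝ :=
  iteratedDeriv i (fun u' : ℝ => iteratedDeriv j (fun v' : ℝ => diffQuot h u' v') v) u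

/-- The filter of real `u` tending to `l` from the right; for `l = -∞` it is `u → -∞`. -/
def rightOf (l : EReal) : Filter ℝ :=
  comap (fun x : ℝ => (x : EReal)) (𝓝[>] l)

/-- The boundary value `∂^{i+j} M / ∂u^i ∂v^j (l, v)`, understood as the limit for `u → l+`,
exists and is not zero. -/
def BoundaryDerivNeZero (h : ℝ → ℝ) (i j : ℕ) (l : EReal) (v : ℝ) : Prop :=
  ∃ a : ℝ, a ≠ 0 ∧ Tendsto (fun u : ℝ => diffQuotDeriv h i j u v) (rightOf l) (𝓝 a)

/-- The regression identity `E[g(Z) | U = u, V = v] = φ u v` for `u < v` in the set `I`: for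
almost every `(u, v)` with respect to the joint law of `(U, V)`, the function `g` is integrable
under the conditional distribution of `Z` given `U = u`, `V = v`, with integral `φ u v`. -/
def RegressionEq {Ω : Type*} [MeasurableSpace Ω] (P : Measure Ω) [IsProbabilityMeasure P]
    (I : Set ℝ) (g : ℝ → ℝ) (Z U V : Ω → ℝ) (φ : ℝ → ℝ → ℝ) : Prop :=
  ∀ᵐ p ∂(P.map (fun ω => (U ω, V ω))), p.1 ∈ I → p.2 ∈ I → p.1 < p.2 →
    Integrable g (condDistrib Z (fun ω => (U ω, V ω)) P p) ∧
      ∫ t, g t ∂(condDistrib Z (fun ω => (U ω, V ω)) P p) = φ p.1 p.2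

/-- `l_F > -∞`, `r_F = ∞` and `F x = 1 - exp (-c (x - l_F))` for `x ≥ l_F`, for some `c > 0`. -/
def IsExponentialType (F : ℝ → ℝ) : Prop :=
  ∃ l c : ℝ, 0 < c ∧ leftExtremity F = (l : EReal) ∧ rightExtremity F = ⊤ ∧
    ∀ x : ℝ, l ≤ x → F x = 1 - Real.exp (-c * (x - l))

end

/-! ### The cumulative hazard and the measure that it transports to Lebesgue measure. -/

section Hazard

open Set

/-! Put R = -log(1 - F) and dν = dF/(1 - F). In the scale R the record values behave like the points
of a unit-rate Poisson process. Hence, given X(n-k) = u and X(n+r) = v, the record X(n) has a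
ν-density on (u, v) proportional to (R(t) - R(u))^(k-1) (R(v) - R(t))^(r-1); this is
`condDistrib_recordValue`. The first regression identity then reads: for almost all u < v, the
ν-integral over (u, v) of h^(k+r-1)(t) (R(t) - R(u))^(k-1) (R(v) - R(t))^(r-1) equals (R(v) -
R(u))^(k+r-1) times the mixed derivative of M. The second is the same equation with k-1 for k and h'
for h.

If F is exponential, R is affine, ν is a multiple of Lebesgue measure, and the equation is the
integral formula `integral_iteratedDeriv_mul_pow` for the derivatives of M.

Both converses lead to one differential equation for an increment B of R: B^N ((N+1) p + (x - e) p')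
dB = d(p B^(N+1)). Expanding the right side and cancelling leaves (x - e) p' dB = p' B dx. As p' has
no zero, B is proportional to x - e. `proportional_of_integral_eq` carries this out although F is
not assumed differentiable or strictly increasing and the equation is known only almost everywhere.

For r = 1 two values of v are compared and u tends to l_F. Then B = R, e = l_F and p = M_{k-1}(l_F,
·), since h^(k) = k p + (x - l_F) p' by Leibniz. The case l_F = -∞ is excluded by dividing by u
(`isExponentialType_of_integral_eq`).

For r ≥ 2 the upper point v is fixed and two values of u are compared: B = R(v) - R and e = v.
Differentiating the left side of the first identity in u produces the left side of the second, and
`mul_diffQuotDeriv_deriv` is the matching relation between M and M'. The boundary condition gives p'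
≠ 0 only near l_F, so R(v) - R(t) is linear in v - t only for t near l_F. Comparing different v
there (`isExponentialType_of_hazard_sub_eq`) yields R(v) = c (v - l_F) for all v. -/

theorem continuous_cdf (μ : Measure ℝ) [IsProbabilityMeasure μ] [NullSingletonClass μ] :
    Continuous (cdf μ) := by
  rw [continuous_iff_continuousAt]
  intro x
  rw [(monotone_cdf μ).continuousAt_iff_leftLim_eq_rightLim, StieltjesFunction.rightLim_eq]
  have h1 : (cdf μ).measure {x} = 0 := by rw [measure_cdf]; exact measure_singleton x
  rw [StieltjesFunction.measure_singleton, ENNReal.ofReal_eq_zero] at h1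
  exact le_antisymm ((monotone_cdf μ).leftLim_le le_rfl) (by linarith)

/-- The sublevel set of the monotone F is a half-line, and by continuity F equals s at its end
point. -/
theorem measure_cdf_le (μ : Measure ℝ) [IsProbabilityMeasure μ] [NullSingletonClass μ] {s : ℝ}
    (h1 : s < 1) : μ {t | cdf μ t ≤ s} = ENNReal.ofReal s := by
  have hc := continuous_cdf μ
  rcases eq_empty_or_nonempty {t | cdf μ t ≤ s} with he | hne
  · rw [he, measure_empty, eq_comm, ENNReal.ofReal_eq_zero]
    by_contra! hs
    obtain ⟨t, ht⟩ := ((tendsto_cdf_atBot μ).eventually (gt_mem_nhds hs)).exists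
    have : t ∈ {t | cdf μ t ≤ s} := le_of_lt ht
    simp [he] at this
  · have hbdd : BddAbove {t | cdf μ t ≤ s} := by
      obtain ⟨b, hb⟩ := ((tendsto_cdf_atTop μ).eventually (lt_mem_nhds h1)).exists
      refine ⟨b, fun t ht => ?_⟩
      by_contra! hbt
      exact absurd (monotone_cdf μ hbt.le) (not_le.2 (lt_of_le_of_lt ht hb))
    have hmem : cdf μ (sSup {t | cdf μ t ≤ s}) ≤ s :=
      (isClosed_le hc continuous_const).csSup_mem hne hbdd
    set t := sSup {t | cdf μ t ≤ s} with ht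
    have hset : {t | cdf μ t ≤ s} = Iic t := by
      ext x
      exact ⟨fun hx => le_csSup hbdd hx, fun hx => (monotone_cdf μ hx).trans hmem⟩
    have heq : cdf μ t = s := by
      refine le_antisymm hmem ?_
      by_contra! hlt
      have hev := (hc.continuousAt (x := t)).eventually (gt_mem_nhds hlt)
      obtain ⟨x, hx, hxt⟩ := ((hev.filter_mono nhdsWithin_le_nhds).and
        (self_mem_nhdsWithin (s := Ioi t))).exists
      exact absurd (le_csSup hbdd (show x ∈ {t | cdf μ t ≤ s} from le_of_lt hx)) (not_le.2 hxt)
    rw [hset, ← ofReal_cdf μ, heq]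

/-- The probability integral transform. -/
theorem map_cdf_eq (μ : Measure ℝ) [IsProbabilityMeasure μ] [NullSingletonClass μ] :
    μ.map (cdf μ) = volume.restrict (Icc 0 1) := by
  have hc := continuous_cdf μ
  have : IsProbabilityMeasure (μ.map (cdf μ)) := Measure.isProbabilityMeasure_map hc.aemeasurable
  refine Measure.ext_of_Iic _ _ fun s => ?_
  rw [Measure.map_apply hc.measurable measurableSet_Iic, Measure.restrict_apply measurableSet_Iic]
  rcases lt_or_ge s 0 with h0 | h0
  · have e1 : cdf μ ⁻¹' Iic s = ∅ := by
      ext t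
      simpa using h0.trans_le (cdf_nonneg μ t)
    have e2 : Iic s ∩ Icc (0 : ℝ) 1 = ∅ := by
      ext t
      simp only [mem_inter_iff, mem_Iic, mem_Icc, mem_empty_iff_false, iff_false]
      rintro ⟨h1, h2, -⟩
      linarith
    simp [e1, e2]
  rcases lt_or_ge s 1 with h1 | h1
  · have e2 : Iic s ∩ Icc (0 : ℝ) 1 = Icc 0 s := by
      ext t
      simp only [mem_inter_iff, mem_Iic, mem_Icc]
      constructor
      · rintro ⟨h1, h2, -⟩
        exact ⟨h2, h1⟩
      · rintro ⟨h2, h3⟩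
        exact ⟨h3, h2, h3.trans h1.le⟩
    rw [e2, Real.volume_Icc, sub_zero]
    exact measure_cdf_le μ h1
  · have e1 : cdf μ ⁻¹' Iic s = univ := by
      ext t
      simpa using (cdf_le_one μ t).trans h1
    have e2 : Iic s ∩ Icc (0 : ℝ) 1 = Icc 0 1 := by
      ext t
      simp only [mem_inter_iff, mem_Iic, mem_Icc, and_iff_right_iff_imp]
      rintro ⟨-, h2⟩
      exact h2.trans h1
    simp [e1, e2]

theorem measure_cdf_eq (μ : Measure ℝ) [IsProbabilityMeasure μ] [NullSingletonClass μ] (s : ℝ) :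
    μ {t | cdf μ t = s} = 0 := by
  have h : μ.map (cdf μ) {s} = volume.restrict (Icc 0 1) {s} := by rw [map_cdf_eq]
  rw [Measure.map_apply (continuous_cdf μ).measurable (measurableSet_singleton s)] at h
  refine h.trans ?_
  exact measure_mono_null (fun _ h => h) (by simp)

theorem ae_cdf_ne (μ : Measure ℝ) [IsProbabilityMeasure μ] [NullSingletonClass μ] (s : ℝ) :
    ∀ᵐ t ∂μ, cdf μ t ≠ s := by
  rw [ae_iff]
  simpa using measure_cdf_eq μ s

theorem ae_cdf_lt_one (μ : Measure ℝ) [IsProbabilityMeasure μ] [NullSingletonClass μ] :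
    ∀ᵐ t ∂μ, cdf μ t < 1 := by
  filter_upwards [ae_cdf_ne μ 1] with t ht using lt_of_le_of_ne (cdf_le_one μ t) ht

theorem ae_cdf_pos (μ : Measure ℝ) [IsProbabilityMeasure μ] [NullSingletonClass μ] :
    ∀ᵐ t ∂μ, 0 < cdf μ t := by
  filter_upwards [ae_cdf_ne μ 0] with t ht using lt_of_le_of_ne (cdf_nonneg μ t) ht.symm

/-- The cumulative hazard function `-log (1 - F)`. -/
noncomputable def hazard (μ : Measure ℝ) (t : ℝ) : ℝ := -Real.log (1 - cdf μ t)

/-- The hazard measure `dF / (1 - F)`. -/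
noncomputable def hazardMeasure (μ : Measure ℝ) : Measure ℝ :=
  μ.withDensity fun t => ENNReal.ofReal (1 - cdf μ t)⁻¹

theorem hazard_le {μ : Measure ℝ} {a b : ℝ} (hab : a ≤ b) (hb : cdf μ b < 1) : hazard μ a ≤ hazard μ b :=
  neg_le_neg (Real.log_le_log (by linarith) (by linarith [monotone_cdf μ hab]))

theorem hazard_lt {μ : Measure ℝ} {a b : ℝ} (hab : cdf μ a < cdf μ b) (hb : cdf μ b < 1) :
    hazard μ a < hazard μ b :=
  neg_lt_neg (Real.log_lt_log (by linarith) (by linarith))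

theorem hazard_nonneg {μ : Measure ℝ} (a : ℝ) : 0 ≤ hazard μ a :=
  neg_nonneg.2 (Real.log_nonpos (by linarith [cdf_le_one μ a]) (by linarith [cdf_nonneg μ a]))

theorem hazard_pos {μ : Measure ℝ} {a : ℝ} (h0 : 0 < cdf μ a) (h1 : cdf μ a < 1) : 0 < hazard μ a :=
  neg_pos.2 (Real.log_neg (by linarith) (by linarith))

theorem hazardMeasure_absolutelyContinuous {μ : Measure ℝ} : hazardMeasure μ ≪ μ :=
  withDensity_absolutelyContinuous _ _

variable {μ : Measure ℝ} [IsProbabilityMeasure μ] [NullSingletonClass μ]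

theorem measurable_hazard : Measurable (hazard μ) :=
  (Real.measurable_log.comp (measurable_const.sub (continuous_cdf μ).measurable)).neg

theorem continuousAt_hazard {t : ℝ} (ht : cdf μ t < 1) : ContinuousAt (hazard μ) t :=
  ((continuousAt_const.sub (continuous_cdf μ).continuousAt).log
    (sub_pos.2 ht).ne').neg

/-- F may be flat, so the two sets can differ, but only at points where F takes the value F(a) or
F(b), and these form a null set. -/
theorem Ioc_ae_eq_preimage_cdf {a b : ℝ} :
    (Ioc a b : Set ℝ) =ᵐ[μ] cdf μ ⁻¹' Ioc (cdf μ a) (cdf μ b) := by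
  filter_upwards [ae_cdf_ne μ (cdf μ a), ae_cdf_ne μ (cdf μ b)] with t h1 h2
  refine propext ⟨fun h => ⟨lt_of_le_of_ne (monotone_cdf μ h.1.le) h1.symm, monotone_cdf μ h.2⟩,
    fun h => ⟨?_, ?_⟩⟩
  · by_contra! hle
    exact absurd (monotone_cdf μ hle) (not_le.2 h.1)
  · by_contra! hle
    exact h2 (le_antisymm h.2 (monotone_cdf μ hle.le))

theorem lintegral_comp_cdf {a b : ℝ} {φ : ℝ → ENNReal} (hφ : Measurable φ) :
    ∫⁻ t in Ioc a b, φ (cdf μ t) ∂μ = ∫⁻ s in Ioc (cdf μ a) (cdf μ b), φ s := by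
  have hF := (continuous_cdf μ).measurable
  rw [setLIntegral_congr Ioc_ae_eq_preimage_cdf,
    ← setLIntegral_map measurableSet_Ioc hφ hF, map_cdf_eq, Measure.restrict_restrict
    measurableSet_Ioc, inter_eq_left.2]
  exact fun x hx => ⟨(cdf_nonneg μ a).trans hx.1.le, hx.2.trans (cdf_le_one μ b)⟩

theorem image_neg_log_one_sub {a b : ℝ} (hab : a ≤ b) (hb : b < 1) :
    (fun s => -Real.log (1 - s)) '' Ioc a b = Ioc (-Real.log (1 - a)) (-Real.log (1 - b)) := by
  ext w
  constructor
  · rintro ⟨s, hs, rfl⟩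
    exact ⟨neg_lt_neg (Real.log_lt_log (by linarith [hs.2]) (by linarith [hs.1])),
      neg_le_neg (Real.log_le_log (by linarith) (by linarith [hs.2]))⟩
  · rintro ⟨h1, h2⟩
    refine ⟨1 - Real.exp (-w), ⟨?_, ?_⟩, by simp⟩
    · have : Real.exp (-w) < 1 - a := by
        rw [← Real.lt_log_iff_exp_lt (by linarith)]; linarith
      linarith
    · have : 1 - b ≤ Real.exp (-w) := by
        rw [← Real.log_le_iff_le_exp (by linarith)]; linarith
      linarith

/-- Two substitutions: s = F(t) by the probability integral transform, then w = -log(1 - s), whose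
Jacobian 1/(1 - s) is the density of the hazard measure. No invertibility of F is needed. -/
theorem lintegral_comp_hazard {a b : ℝ} (hab : a ≤ b) (hb : cdf μ b < 1) {φ : ℝ → ENNReal}
    (hφ : Measurable φ) :
    ∫⁻ t in Ioc a b, φ (hazard μ t) ∂(hazardMeasure μ) =
      ∫⁻ w in Ioc (hazard μ a) (hazard μ b), φ w := by
  have hF := (continuous_cdf μ).measurable
  have hd : Measurable fun s : ℝ => ENNReal.ofReal (1 - s)⁻¹ :=
    (measurable_const.sub measurable_id).inv.ennreal_ofReal
  have hL : Measurable fun s : ℝ => -Real.log (1 - s) :=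
    (Real.measurable_log.comp (measurable_const.sub measurable_id)).neg
  have h0 : ∫⁻ t in Ioc a b, φ (hazard μ t) ∂(hazardMeasure μ) =
      ∫⁻ t in Ioc a b, ENNReal.ofReal (1 - cdf μ t)⁻¹ * φ (hazard μ t) ∂μ :=
    setLIntegral_withDensity_eq_setLIntegral_mul _ (hd.comp hF)
      (hφ.comp measurable_hazard) measurableSet_Ioc
  rw [h0]
  have h1 := lintegral_comp_cdf (μ := μ)
    (a := a) (b := b) (φ := fun s => ENNReal.ofReal (1 - s)⁻¹ * φ (-Real.log (1 - s))) (hd.mul (hφ.comp hL))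
  refine h1.trans ?_
  unfold hazard
  rw [← image_neg_log_one_sub (monotone_cdf μ hab) hb, lintegral_image_eq_lintegral_abs_deriv_mul measurableSet_Ioc
    (f' := fun s => (1 - s)⁻¹)]
  · refine setLIntegral_congr_fun measurableSet_Ioc fun s hs => ?_
    have : 0 < 1 - s := by linarith [hs.2]
    rw [abs_of_pos (inv_pos.2 this)]
  · intro s hs
    have h0 : 1 - s ≠ 0 := by linarith [hs.2]
    have := ((((hasDerivAt_id s).const_sub 1).log h0).neg)
    refine HasDerivAt.hasDerivWithinAt ?_
    convert! this using 1
    simp [neg_div]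
  · intro s hs t ht hst
    have h1 : 0 < 1 - s := by linarith [hs.2]
    have h2 : 0 < 1 - t := by linarith [ht.2]
    have := Real.log_injOn_pos h1 h2 (neg_injective hst)
    linarith

/-- The cumulative hazard function transports the hazard measure to Lebesgue measure. -/
theorem map_hazard_restrict {a b : ℝ} (hab : a ≤ b) (hb : cdf μ b < 1) :
    ((hazardMeasure μ).restrict (Ioc a b)).map (hazard μ) =
      volume.restrict (Ioc (hazard μ a) (hazard μ b)) := by
  refine Measure.ext_of_lintegral _ fun φ hφ => ?_
  rw [lintegral_map hφ measurable_hazard, lintegral_comp_hazard hab hb hφ]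

theorem hazardMeasure_Ioc {a b : ℝ} (hab : a ≤ b) (hb : cdf μ b < 1) :
    hazardMeasure μ (Ioc a b) = ENNReal.ofReal (hazard μ b - hazard μ a) := by
  simpa using lintegral_comp_hazard (μ := μ) hab hb (φ := fun _ => 1) measurable_const

instance : NullSingletonClass (hazardMeasure μ) :=
  ⟨fun x => hazardMeasure_absolutelyContinuous (measure_singleton x)⟩

theorem hazardMeasure_Icc_lt_top {a b : ℝ} (hb : cdf μ b < 1) :
    hazardMeasure μ (Icc a b) < ⊤ := by
  rcases le_or_gt a b with hab | hab
  · rw [← measure_congr (Ioc_ae_eq_Icc (μ := hazardMeasure μ)), hazardMeasure_Ioc hab hb]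
    exact ENNReal.ofReal_lt_top
  · simp [Icc_eq_empty (not_le.2 hab)]

theorem integral_comp_hazard {a b : ℝ} (hab : a ≤ b) (hb : cdf μ b < 1) {φ : ℝ → ℝ}
    (hφ : Continuous φ) :
    ∫ t in Ioc a b, φ (hazard μ t) ∂(hazardMeasure μ) =
      ∫ w in (hazard μ a)..(hazard μ b), φ w := by
  rw [intervalIntegral.integral_of_le (hazard_le hab hb), ← map_hazard_restrict hab hb,
    integral_map measurable_hazard.aemeasurable hφ.aestronglyMeasurable]

end Hazard

/-! ### Beta integrals, which normalize the record laws. -/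

section BetaIntegral

open Set

/-- With the factorials included, integration by parts moves one unit of exponent from j to i
without boundary terms, so induction on j for all i suffices. -/
theorem integral_pow_mul_pow (α β : ℝ) (i j : ℕ) :
    ∫ w in α..β, (w - α) ^ i / i.factorial * ((β - w) ^ j / j.factorial) =
      (β - α) ^ (i + j + 1) / (i + j + 1).factorial := by
  have key : ∀ (m : ℕ) (w : ℝ), HasDerivAt (fun w => (w - α) ^ (m + 1) / (m + 1).factorial)
      ((w - α) ^ m / m.factorial) w := by
    intro m w
    have h := (((hasDerivAt_id w).sub_const α).pow (m + 1)).div_const ((m + 1).factorial : ℝ)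
    convert! h using 1
    have : (m.factorial : ℝ) ≠ 0 := by positivity
    have h2 : (m + 1 : ℝ) ≠ 0 := by positivity
    simp only [Nat.factorial_succ, id]
    push_cast
    field_simp
  induction j generalizing i with
  | zero =>
    simp only [pow_zero, Nat.factorial_zero, Nat.cast_one, div_one, mul_one, add_zero]
    rw [intervalIntegral.integral_eq_sub_of_hasDerivAt (fun w _ => key i w)]
    · simp
    · exact (by fun_prop : Continuous fun w : ℝ => (w - α) ^ i / i.factorial).intervalIntegrable _ _
  | succ j ih =>
    have key2 : ∀ w : ℝ, HasDerivAt (fun w => (β - w) ^ (j + 1) / (j + 1).factorial)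
        (-((β - w) ^ j / j.factorial)) w := by
      intro w
      have h := (((hasDerivAt_id w).const_sub β).pow (j + 1)).div_const ((j + 1).factorial : ℝ)
      convert! h using 1
      have : (j.factorial : ℝ) ≠ 0 := by positivity
      have h2 : (j + 1 : ℝ) ≠ 0 := by positivity
      simp only [Nat.factorial_succ, id]
      push_cast
      field_simp
    have h := intervalIntegral.integral_mul_deriv_eq_deriv_mul (a := α) (b := β)
      (fun w _ => key2 w) (fun w _ => key i w)
      ((by fun_prop : Continuous fun w : ℝ => -((β - w) ^ j / j.factorial)).intervalIntegrable _ _)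
      ((by fun_prop : Continuous fun w : ℝ => (w - α) ^ i / i.factorial).intervalIntegrable _ _)
    simp only [sub_self, ne_eq, Nat.add_eq_zero_iff, one_ne_zero, and_false, not_false_eq_true,
      zero_pow, zero_div, zero_mul, mul_zero, zero_sub, neg_mul, intervalIntegral.integral_neg,
      neg_neg] at h
    have ih' := ih (i + 1)
    rw [show i + (j + 1) + 1 = i + 1 + j + 1 by ring, ← ih']
    refine Eq.trans ?_ (h.trans ?_)
    · exact intervalIntegral.integral_congr fun w _ => mul_comm _ _
    · exact intervalIntegral.integral_congr fun w _ => mul_comm _ _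

variable {μ : Measure ℝ} [IsProbabilityMeasure μ] [NullSingletonClass μ]

theorem lintegral_hazard_pow_mul_pow {a b : ℝ} (hab : a ≤ b) (hb : cdf μ b < 1) (i j : ℕ) :
    ∫⁻ t in Ioo a b, ENNReal.ofReal ((hazard μ t - hazard μ a) ^ i / i.factorial *
      ((hazard μ b - hazard μ t) ^ j / j.factorial)) ∂(hazardMeasure μ) =
      ENNReal.ofReal ((hazard μ b - hazard μ a) ^ (i + j + 1) / (i + j + 1).factorial) := by
  rw [setLIntegral_congr (Ioo_ae_eq_Ioc (μ := hazardMeasure μ)), lintegral_comp_hazard hab hb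
    (φ := fun w => ENNReal.ofReal ((w - hazard μ a) ^ i / i.factorial *
      ((hazard μ b - w) ^ j / j.factorial))) (by fun_prop),
    ← integral_pow_mul_pow, intervalIntegral.integral_of_le (hazard_le hab hb),
    ofReal_integral_eq_lintegral_ofReal]
  · exact (by fun_prop : Continuous fun w : ℝ => (w - hazard μ a) ^ i / i.factorial *
      ((hazard μ b - w) ^ j / j.factorial)).integrableOn_Ioc
  · filter_upwards [ae_restrict_mem measurableSet_Ioc] with w hw
    have h1 : 0 ≤ w - hazard μ a := by linarith [hw.1]
    have h2 : 0 ≤ hazard μ b - w := by linarith [hw.2]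
    simp only [Pi.zero_apply]
    positivity

end BetaIntegral

/-! ### The integrated differential equation that forces proportionality. -/

section Core

open Set

/-- A zero-free maximal interval of a continuous function around a point. -/
theorem exists_zero_free_interval {Q : ℝ → ℝ} {a w x : ℝ} (hQ : ContinuousOn Q (Icc a w))
    (ha : Q a = 0) (hw : Q w = 0) (hx : x ∈ Icc a w) (hne : Q x ≠ 0) :
    ∃ s t, a ≤ s ∧ s < t ∧ t ≤ w ∧ Q s = 0 ∧ Q t = 0 ∧ ∀ y ∈ Ioo s t, Q y ≠ 0 := by
  have hc1 : IsCompact (Icc a x ∩ Q ⁻¹' {0}) :=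
    isCompact_Icc.of_isClosed_subset ((hQ.mono (Icc_subset_Icc_right hx.2)).preimage_isClosed_of_isClosed
      isClosed_Icc isClosed_singleton) inter_subset_left
  have hc2 : IsCompact (Icc x w ∩ Q ⁻¹' {0}) :=
    isCompact_Icc.of_isClosed_subset ((hQ.mono (Icc_subset_Icc_left hx.1)).preimage_isClosed_of_isClosed
      isClosed_Icc isClosed_singleton) inter_subset_left
  obtain ⟨s, ⟨⟨hs1, hs2⟩, hs3⟩, hsmax⟩ := hc1.exists_isGreatest ⟨a, ⟨le_rfl, hx.1⟩, ha⟩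
  obtain ⟨t, ⟨⟨ht1, ht2⟩, ht3⟩, htmin⟩ := hc2.exists_isLeast ⟨w, ⟨hx.2, le_rfl⟩, hw⟩
  have hsx : s < x := lt_of_le_of_ne hs2 (by rintro rfl; exact hne hs3)
  have hxt : x < t := lt_of_le_of_ne ht1 (by rintro rfl; exact hne ht3)
  refine ⟨s, t, hs1, hsx.trans hxt, ht2, hs3, ht3, fun y hy hy0 => ?_⟩
  rcases le_total y x with h | h
  · exact absurd (hsmax ⟨⟨hs1.trans hy.1.le, h⟩, hy0⟩) (not_le.2 hy.1)
  · exact absurd (htmin ⟨⟨h, hy.2.le.trans ht2⟩, hy0⟩) (not_le.2 hy.2)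

theorem integrableOn_Icc_of_continuousOn {ν : Measure ℝ} {a b : ℝ} {g : ℝ → ℝ}
    (hfin : ν (Icc a b) < ⊤) (hg : ContinuousOn g (Icc a b)) : IntegrableOn g (Icc a b) ν := by
  obtain ⟨C, hC⟩ := isCompact_Icc.exists_bound_of_continuousOn hg
  have : IsFiniteMeasure (ν.restrict (Icc a b)) := ⟨by simpa using hfin⟩
  exact Integrable.of_bound (hg.aestronglyMeasurable measurableSet_Icc) C
    ((ae_restrict_iff' measurableSet_Icc).2 (Eventually.of_forall hC))

/-- Mean value theorem for integrals over `(s, t]`. -/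
theorem exists_setIntegral_Ioc_eq {ν : Measure ℝ} {s t : ℝ} (hst : s ≤ t) {g : ℝ → ℝ}
    (hg : ContinuousOn g (Icc s t)) (hfin : ν (Icc s t) < ⊤) :
    ∃ c ∈ Icc s t, ∫ x in Ioc s t, g x ∂ν = g c * ν.real (Ioc s t) := by
  have hint : IntegrableOn g (Icc s t) ν := integrableOn_Icc_of_continuousOn hfin hg
  have hint' := hint.mono_set (Ioc_subset_Icc_self (a := s) (b := t))
  have hfin' : ν (Ioc s t) ≠ ⊤ := ((measure_mono Ioc_subset_Icc_self).trans_lt hfin).ne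
  obtain ⟨p, hp, hpmin⟩ := isCompact_Icc.exists_isMinOn (nonempty_Icc.2 hst) hg
  obtain ⟨q, hq, hqmax⟩ := isCompact_Icc.exists_isMaxOn (nonempty_Icc.2 hst) hg
  have h1 : g p * ν.real (Ioc s t) ≤ ∫ x in Ioc s t, g x ∂ν := by
    have := setIntegral_mono_on (integrableOn_const hfin') hint' measurableSet_Ioc
      (f := fun _ => g p) fun x hx => hpmin (Ioc_subset_Icc_self hx)
    simpa [mul_comm] using this
  have h2 : ∫ x in Ioc s t, g x ∂ν ≤ g q * ν.real (Ioc s t) := by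
    have := setIntegral_mono_on hint' (integrableOn_const hfin') measurableSet_Ioc
      (g := fun _ => g q) fun x hx => hqmax (Ioc_subset_Icc_self hx)
    simpa [mul_comm] using this
  rcases (measureReal_nonneg (μ := ν) (s := Ioc s t)).eq_or_lt with h0 | h0
  · refine ⟨p, hp, ?_⟩
    rw [← h0] at h1 h2 ⊢
    linarith
  · have h3 : (∫ x in Ioc s t, g x ∂ν) / ν.real (Ioc s t) ∈ Icc (g p) (g q) :=
      ⟨(le_div_iff₀ h0).2 h1, (div_le_iff₀ h0).2 h2⟩
    have hsub : uIcc p q ⊆ Icc s t := by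
      intro x hx
      rw [uIcc, mem_Icc] at hx
      exact ⟨(le_inf hp.1 hq.1).trans hx.1, hx.2.trans (sup_le hp.2 hq.2)⟩
    obtain ⟨c, hc, hgc⟩ := intermediate_value_uIcc (hg.mono hsub)
      (Icc_subset_uIcc h3)
    exact ⟨c, hsub hc, by rw [hgc, div_mul_cancel₀ _ (ne_of_gt h0)]⟩

/-- If `B` has increments `σ dν` on `[a, w]` and the integrated differential equation
`σ B ^ N ((N + 1) p + (x - e) p') dν = d (p B ^ (N + 1))` holds between points of a set of full measure
containing the end points, then `B` is proportional to `t - e`. -/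
theorem proportional_of_integral_eq {ν : Measure ℝ} [NullSingletonClass ν] {a w e σ : ℝ}
    (haw : a < w) (he : e ∉ Icc a w) (hfin : ν (Icc a w) < ⊤) {G : Set ℝ} (haG : a ∈ G)
    (hwG : w ∈ G) (hG : ν (Icc a w \ G) = 0) {B p p' : ℝ → ℝ} {N : ℕ}
    (hBc : ContinuousOn B (Icc a w)) (hBpos : ∀ t ∈ Icc a w, 0 < B t)
    (hB : ∀ s t, a ≤ s → s ≤ t → t ≤ w → B t - B s = σ * ν.real (Ioc s t))
    (hp : ∀ t ∈ Icc a w, HasDerivAt p (p' t) t) (hpcont : ContinuousOn p' (Icc a w))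
    (hpne : ∀ t ∈ Icc a w, p' t ≠ 0)
    (hid : ∀ t ∈ G ∩ Icc a w, σ * ∫ x in Ioc a t, B x ^ N * ((N + 1) * p x + (x - e) * p' x) ∂ν =
      p t * B t ^ (N + 1) - p a * B a ^ (N + 1)) :
    ∀ t ∈ Icc a w, B t / (t - e) = B a / (a - e) := by
  have hpc : ContinuousOn p (Icc a w) := fun t ht => (hp t ht).continuousAt.continuousWithinAt
  set g : ℝ → ℝ := fun x => B x ^ N * ((N + 1) * p x + (x - e) * p' x) with hg
  have hgc : ContinuousOn g (Icc a w) := by fun_prop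
  have hgi : IntegrableOn g (Icc a w) ν := integrableOn_Icc_of_continuousOn hfin hgc
  have hadd : ∀ s t, a ≤ s → s ≤ t → t ≤ w →
      ∫ x in Ioc a t, g x ∂ν = (∫ x in Ioc a s, g x ∂ν) + ∫ x in Ioc s t, g x ∂ν := by
    intro s t has hst htw
    rw [← Ioc_union_Ioc_eq_Ioc has hst, setIntegral_union (Ioc_disjoint_Ioc_of_le le_rfl)
      measurableSet_Ioc]
    · exact hgi.mono_set fun x hx => ⟨hx.1.le, hx.2.trans (hst.trans htw)⟩
    · exact hgi.mono_set fun x hx => ⟨has.trans hx.1.le, hx.2.trans htw⟩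
  -- The defect Q is continuous and vanishes on G. If it were nonzero somewhere, a maximal zero-free
  -- interval (s, t) would avoid G and hence be ν-null. Then B and the integral agree at s and t, so
  -- Q(s) = Q(t) = 0 gives p(s) = p(t), and Rolle's theorem contradicts p' ≠ 0.
  have hall : ∀ t ∈ Icc a w, σ * ∫ x in Ioc a t, g x ∂ν =
      p t * B t ^ (N + 1) - p a * B a ^ (N + 1) := by
    set Q : ℝ → ℝ := fun t => σ * (∫ x in Ioc a t, g x ∂ν) -
      (p t * B t ^ (N + 1) - p a * B a ^ (N + 1)) with hQ
    have hQc : ContinuousOn Q (Icc a w) := by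
      have := intervalIntegral.continuousOn_primitive hgi
      fun_prop
    have hQG : ∀ t ∈ G ∩ Icc a w, Q t = 0 := fun t ht => sub_eq_zero.2 (hid t ht)
    by_contra! hcon
    obtain ⟨x, hx, hne⟩ := hcon
    obtain ⟨s, t, has, hst, htw, hs0, ht0, hfree⟩ := exists_zero_free_interval hQc
      (hQG a ⟨haG, le_rfl, haw.le⟩) (hQG w ⟨hwG, haw.le, le_rfl⟩) hx (sub_ne_zero.2 hne)
    have hnull : ν (Ioo s t) = 0 := by
      refine measure_mono_null (fun y hy => ?_) hG
      have hy' : y ∈ Icc a w := ⟨has.trans hy.1.le, hy.2.le.trans htw⟩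
      exact ⟨hy', fun hyG => hfree y hy (hQG y ⟨hyG, hy'⟩)⟩
    have hnull' : ν (Ioc s t) = 0 := by
      rw [← measure_congr (Ioo_ae_eq_Ioc (μ := ν))]; exact hnull
    have hBeq : B t = B s := by
      have := hB s t has hst.le htw
      rw [measureReal_def, hnull'] at this
      simpa [sub_eq_zero] using this
    have hI : ∫ x in Ioc a t, g x ∂ν = ∫ x in Ioc a s, g x ∂ν := by
      rw [hadd s t has hst.le htw, setIntegral_measure_zero _ hnull', add_zero]
    have hpeq : p s = p t := by
      simp only [hQ] at hs0 ht0
      rw [hI, hBeq] at ht0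
      have hpos : 0 < B s ^ (N + 1) := pow_pos (hBpos s ⟨has, hst.le.trans htw⟩) _
      have : (p s - p t) * B s ^ (N + 1) = 0 := by linarith
      rcases mul_eq_zero.1 this with h | h
      · linarith
      · exact absurd h hpos.ne'
    obtain ⟨c, hc, hc0⟩ := exists_hasDerivAt_eq_zero hst
      (hpc.mono (Icc_subset_Icc has htw)) hpeq
      fun y hy => hp y ⟨has.trans hy.1.le, hy.2.le.trans htw⟩
    exact hpne c ⟨has.trans hc.1.le, hc.2.le.trans htw⟩ hc0
  have hne : ∀ t ∈ Icc a w, t - e ≠ 0 := by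
    intro t ht h
    exact he (by rwa [← sub_eq_zero.1 h])
  -- Differentiability of B is a conclusion. The identity over (t, x], the mean value g(c) of the
  -- integrand and the factorization B(x)^(N+1) - B(t)^(N+1) = S(x) (B(x) - B(t)) give (B(x) - B(t))
  -- (g(c) - p(t) S(x)) = (p(x) - p(t)) B(x)^(N+1); dividing by x - t determines the slope.
  have hderiv : ∀ t ∈ Ico a w, HasDerivWithinAt B (B t / (t - e)) (Ici t) t := by
    intro t ht
    have ht' : t ∈ Icc a w := Ico_subset_Icc_self ht
    have hmem : Ioc t w ∈ 𝓝[>] t := Ioc_mem_nhdsGT ht.2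
    rw [← hasDerivWithinAt_Ioi_iff_Ici, hasDerivWithinAt_iff_tendsto_slope' (by simp)]
    have hmv : ∀ x, ∃ c, x ∈ Ioc t w → c ∈ Icc t x ∧
        ∫ y in Ioc t x, g y ∂ν = g c * ν.real (Ioc t x) := by
      intro x
      by_cases hx : x ∈ Ioc t w
      · obtain ⟨c, hc, h⟩ := exists_setIntegral_Ioc_eq (ν := ν) hx.1.le
          (hgc.mono (Icc_subset_Icc ht.1 hx.2))
          ((measure_mono (Icc_subset_Icc ht.1 hx.2)).trans_lt hfin)
        exact ⟨c, fun _ => ⟨hc, h⟩⟩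
      · exact ⟨0, fun h => absurd h hx⟩
    choose c hc using hmv
    have hid1 : Tendsto (fun x : ℝ => x) (𝓝[>] t) (𝓝[Icc a w] t) :=
      tendsto_nhdsWithin_iff.2 ⟨tendsto_id.mono_left nhdsWithin_le_nhds, by
        filter_upwards [hmem] with x hx using ⟨ht.1.trans hx.1.le, hx.2⟩⟩
    have hct : Tendsto c (𝓝[>] t) (𝓝[Icc a w] t) := by
      refine tendsto_nhdsWithin_iff.2 ⟨?_, ?_⟩
      · refine tendsto_of_tendsto_of_tendsto_of_le_of_le' tendsto_const_nhds
          (tendsto_id.mono_left nhdsWithin_le_nhds) ?_ ?_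
        · filter_upwards [hmem] with x hx using (hc x hx).1.1
        · filter_upwards [hmem] with x hx using (hc x hx).1.2
      · filter_upwards [hmem] with x hx using
          ⟨ht.1.trans (hc x hx).1.1, (hc x hx).1.2.trans hx.2⟩
    have hBt : Tendsto B (𝓝[>] t) (𝓝 (B t)) := (hBc t ht').tendsto.comp hid1
    have hgt : Tendsto (fun x => g (c x)) (𝓝[>] t) (𝓝 (g t)) := (hgc t ht').tendsto.comp hct
    set S : ℝ → ℝ := fun x => ∑ i ∈ Finset.range (N + 1), B x ^ i * B t ^ (N + 1 - 1 - i) with hS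
    have hSt : Tendsto S (𝓝[>] t) (𝓝 ((N + 1) * B t ^ N)) := by
      have h1 : Tendsto S (𝓝[>] t)
          (𝓝 (∑ i ∈ Finset.range (N + 1), B t ^ i * B t ^ (N + 1 - 1 - i))) :=
        tendsto_finsetSum _ fun i _ => (hBt.pow i).mul_const _
      convert! h1 using 2
      rw [Finset.sum_congr rfl (g := fun _ => B t ^ N)]
      · simp
      · intro i hi
        rw [← pow_add]
        congr 1
        have := Finset.mem_range.1 hi
        omega
    have hslope : Tendsto (slope p t) (𝓝[>] t) (𝓝 (p' t)) :=
      (hasDerivAt_iff_tendsto_slope.1 (hp t ht')).mono_left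
        (nhdsWithin_mono _ fun x (hx : t < x) => hx.ne')
    -- The terms (N+1) p B^N cancel in the limit; what remains is nonzero because p' ≠ 0 and t ≠ e.
    have hden : Tendsto (fun x => g (c x) - p t * S x) (𝓝[>] t)
        (𝓝 (B t ^ N * ((t - e) * p' t))) := by
      convert! hgt.sub (hSt.const_mul (p t)) using 2
      simp only [hg]
      ring
    have hB0 : B t ≠ 0 := (hBpos t ht').ne'
    have hden0 : B t ^ N * ((t - e) * p' t) ≠ 0 :=
      mul_ne_zero (pow_ne_zero _ hB0) (mul_ne_zero (hne t ht') (hpne t ht'))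
    have hlim : Tendsto (fun x => slope p t x * B x ^ (N + 1) / (g (c x) - p t * S x)) (𝓝[>] t)
        (𝓝 (p' t * B t ^ (N + 1) / (B t ^ N * ((t - e) * p' t)))) :=
      (hslope.mul (hBt.pow _)).div hden hden0
    have hval : p' t * B t ^ (N + 1) / (B t ^ N * ((t - e) * p' t)) = B t / (t - e) := by
      have := hne t ht'
      have := hpne t ht'
      field_simp
      ring
    rw [hval] at hlim
    refine hlim.congr' ?_
    filter_upwards [hmem, hden.eventually_ne hden0] with x hx hx0
    have h1 := hall x ⟨ht.1.trans hx.1.le, hx.2⟩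
    have h2 := hall t ht'
    rw [hadd t x ht.1 hx.1.le hx.2, (hc x hx).2] at h1
    have h3 := hB t x ht.1 hx.1.le hx.2
    have h4 : S x * (B x - B t) = B x ^ (N + 1) - B t ^ (N + 1) := by
      simp only [hS]
      exact Commute.geom_sum₂_mul (Commute.all _ _) (N + 1)
    have h5 : (B x - B t) * (g (c x) - p t * S x) = (p x - p t) * B x ^ (N + 1) := by
      have : g (c x) * (B x - B t) = p x * B x ^ (N + 1) - p t * B t ^ (N + 1) := by
        rw [h3]; linarith
      linear_combination this - p t * h4
    rw [slope_def_field, slope_def_field]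
    have hxt : x - t ≠ 0 := sub_ne_zero.2 hx.1.ne'
    rw [div_eq_iff hx0]
    field_simp
    linear_combination -h5
  have hconst : ∀ t ∈ Icc a w, (fun t => B t / (t - e)) t = (fun t => B t / (t - e)) a := by
    refine constant_of_has_deriv_right_zero ?_ ?_
    · exact hBc.div (by fun_prop) hne
    · intro t ht
      have ht' : t ∈ Icc a w := Ico_subset_Icc_self ht
      have h := (hderiv t ht).div (((hasDerivAt_id t).sub_const e).hasDerivWithinAt (s := Ici t))
        (hne t ht')
      convert! h using 1
      have := hne t ht'
      simp only [id]
      field_simp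
      simp
  exact hconst

end Core

/-! ### Record times, and the Markov property of the record values. -/

section Records

open Set

variable {Ω : Type*}

/-- The value of the `(m + 1)`-st upper record. -/
noncomputable def recordValue (X : ℕ → Ω → ℝ) (m : ℕ) (ω : Ω) : ℝ :=
  X (recordTime (fun i => X i ω) m) ω

/-- The first `m` records are all followed by another one. -/
def ProperRecord (x : ℕ → ℝ) (m : ℕ) : Prop :=
  ∀ i < m, recordTime x i < recordTime x (i + 1)

/-- The event that the `(m + 1)`-st record exists and occurs at time `j`. -/
def recordEvent (X : ℕ → Ω → ℝ) (m j : ℕ) : Set Ω :=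
  {ω | recordTime (fun i => X i ω) m = j ∧ ProperRecord (fun i => X i ω) m}

/-- None of the `i` observations after time `j` exceeds the one at time `j`. -/
def waitEvent (X : ℕ → Ω → ℝ) (j i : ℕ) : Set Ω :=
  {ω | ∀ l, j < l → l ≤ j + i → X l ω ≤ X j ω}

/-- The observation at time `j` is first exceeded at time `j + i + 1`. -/
def nextEvent (X : ℕ → Ω → ℝ) (j i : ℕ) : Set Ω :=
  waitEvent X j i ∩ {ω | X j ω < X (j + i + 1) ω}

theorem recordTime_succ_of_mem {X : ℕ → Ω → ℝ} {m j i : ℕ} {ω : Ω} (h1 : ω ∈ recordEvent X m j)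
    (h2 : ω ∈ nextEvent X j i) : recordTime (fun i => X i ω) (m + 1) = j + i + 1 := by
  have h := h1.1
  rw [recordTime, h]
  refine IsLeast.csInf_eq ⟨⟨by omega, h2.2⟩, fun l hl => ?_⟩
  by_contra! hlt
  exact absurd hl.2 (not_lt.2 (h2.1 l hl.1 (by omega)))

theorem mem_recordEvent_succ {X : ℕ → Ω → ℝ} {m j i : ℕ} {ω : Ω} (h1 : ω ∈ recordEvent X m j)
    (h2 : ω ∈ nextEvent X j i) : ω ∈ recordEvent X (m + 1) (j + i + 1) := by
  have h := recordTime_succ_of_mem h1 h2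
  refine ⟨h, fun l hl => ?_⟩
  rcases Nat.lt_succ_iff_lt_or_eq.1 hl with hl | rfl
  · exact h1.2 l hl
  · rw [h, h1.1]
    omega

theorem exists_of_properRecord_succ {X : ℕ → Ω → ℝ} {m : ℕ} {ω : Ω}
    (h : ProperRecord (fun i => X i ω) (m + 1)) : ∃ j i, ω ∈ recordEvent X m j ∧
      ω ∈ nextEvent X j i ∧ recordTime (fun i => X i ω) (m + 1) = j + i + 1 := by
  have hlt := h m (Nat.lt_succ_self m)
  obtain ⟨i, hi⟩ := Nat.exists_eq_add_of_lt hlt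
  have hmem : ω ∈ recordEvent X m (recordTime (fun i => X i ω) m) :=
    ⟨rfl, fun l hl => h l (hl.trans (Nat.lt_succ_self m))⟩
  refine ⟨_, i, hmem, ?_, hi⟩
  set j := recordTime (fun i => X i ω) m with hj
  have hdef : recordTime (fun i => X i ω) (m + 1) = sInf {l : ℕ | j < l ∧ X j ω < X l ω} := rfl
  -- An empty set has infimum 0, which cannot exceed the current record time.
  have hne : {l : ℕ | j < l ∧ X j ω < X l ω}.Nonempty := by
    by_contra hem
    rw [not_nonempty_iff_eq_empty] at hem
    rw [hdef, hem] at hlt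
    simp at hlt
  have hmin := Nat.sInf_mem hne
  rw [← hdef, hi] at hmin
  refine ⟨fun l hl1 hl2 => ?_, hmin.2⟩
  by_contra! hcon
  have := Nat.sInf_le (s := {l : ℕ | j < l ∧ X j ω < X l ω}) ⟨hl1, hcon⟩
  rw [← hdef, hi] at this
  omega

theorem iUnion_recordEvent (X : ℕ → Ω → ℝ) (m : ℕ) :
    ⋃ j, recordEvent X m j = {ω | ProperRecord (fun i => X i ω) m} := by
  ext ω
  simp [recordEvent]

theorem iUnion_recordEvent_inter_nextEvent (X : ℕ → Ω → ℝ) (m : ℕ) :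
    ⋃ q : ℕ × ℕ, recordEvent X m q.1 ∩ nextEvent X q.1 q.2 =
      {ω | ProperRecord (fun i => X i ω) (m + 1)} := by
  ext ω
  simp only [mem_iUnion, mem_inter_iff, Prod.exists, mem_ofPred_eq]
  constructor
  · rintro ⟨j, i, h1, h2⟩
    exact (mem_recordEvent_succ h1 h2).2
  · intro h
    obtain ⟨j, i, h1, h2, -⟩ := exists_of_properRecord_succ h
    exact ⟨j, i, h1, h2⟩

theorem disjoint_recordEvent (X : ℕ → Ω → ℝ) (m : ℕ) :
    Pairwise (Function.onFun Disjoint (recordEvent X m)) := by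
  intro j j' hne
  rw [Function.onFun, disjoint_left]
  exact fun ω h1 h2 => hne (h1.1.symm.trans h2.1)

theorem disjoint_recordEvent_inter_nextEvent (X : ℕ → Ω → ℝ) (m : ℕ) :
    Pairwise (Function.onFun Disjoint
      fun q : ℕ × ℕ => recordEvent X m q.1 ∩ nextEvent X q.1 q.2) := by
  rintro ⟨j, i⟩ ⟨j', i'⟩ hne
  rw [Function.onFun, disjoint_left]
  rintro ω ⟨h1, h2⟩ ⟨h1', h2'⟩
  have hj : j = j' := h1.1.symm.trans h1'.1
  subst hj
  have := (recordTime_succ_of_mem h1 h2).symm.trans (recordTime_succ_of_mem h1' h2')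
  exact hne (by ext <;> simp; omega)

variable [MeasurableSpace Ω] {P : Measure Ω} {X : ℕ → Ω → ℝ}

/-- The filtration generated by the observations. -/
noncomputable abbrev obsFiltration (hX : ∀ i, Measurable (X i)) : Filtration ℕ ‹MeasurableSpace Ω› :=
  Filtration.natural X fun i => (hX i).stronglyMeasurable

theorem measurable_obs (hX : ∀ i, Measurable (X i)) {i j : ℕ} (hij : i ≤ j) :
    Measurable[obsFiltration hX j] (X i) :=
  ((Filtration.stronglyAdapted_natural fun i => (hX i).stronglyMeasurable) i).measurable.mono
    ((obsFiltration hX).mono hij) le_rfl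

theorem measurableSet_waitEvent (hX : ∀ i, Measurable (X i)) (j i : ℕ) :
    MeasurableSet[obsFiltration hX (j + i)] (waitEvent X j i) := by
  have : waitEvent X j i = ⋂ l, ⋂ (_ : j < l), ⋂ (_ : l ≤ j + i), {ω | X l ω ≤ X j ω} := by
    ext ω
    simp [waitEvent]
  rw [this]
  refine MeasurableSet.iInter fun l => MeasurableSet.iInter fun _ => MeasurableSet.iInter fun h => ?_
  exact @measurableSet_le _ _ _ _ _ (obsFiltration hX (j + i)) _ _ _ _ _ (measurable_obs hX h)
    (measurable_obs hX (Nat.le_add_right j i))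

theorem measurableSet_nextEvent (hX : ∀ i, Measurable (X i)) (j i : ℕ) :
    MeasurableSet[obsFiltration hX (j + i + 1)] (nextEvent X j i) := by
  refine MeasurableSet.inter ((obsFiltration hX).mono (Nat.le_succ _) _
    (measurableSet_waitEvent hX j i)) ?_
  exact @measurableSet_lt _ _ _ _ _ (obsFiltration hX (j + i + 1)) _ _ _ _ _
    (measurable_obs hX (by omega)) (measurable_obs hX le_rfl)

/-- `A` is an event of the `σ`-algebra at the `(m + 1)`-st record time. -/
def StoppedEvent (hX : ∀ i, Measurable (X i)) (m : ℕ) (A : Set Ω) : Prop :=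
  ∀ j, MeasurableSet[obsFiltration hX j] (A ∩ recordEvent X m j)

/-- A later stopping time has a larger σ-algebra: the event that the next record occurs at j' is
split by the previous record time j and the waiting time i. -/
theorem StoppedEvent.succ {hX : ∀ i, Measurable (X i)} {m : ℕ} {A : Set Ω}
    (hA : StoppedEvent hX m A) : StoppedEvent hX (m + 1) A := by
  intro j'
  have : A ∩ recordEvent X (m + 1) j' =
      ⋃ j, ⋃ i, ⋃ (_ : j + i + 1 = j'), (A ∩ recordEvent X m j) ∩ nextEvent X j i := by
    ext ω
    simp only [mem_inter_iff, mem_iUnion, exists_prop]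
    constructor
    · rintro ⟨h1, h2⟩
      obtain ⟨j, i, h3, h4, h5⟩ := exists_of_properRecord_succ h2.2
      exact ⟨j, i, h5.symm.trans h2.1, ⟨h1, h3⟩, h4⟩
    · rintro ⟨j, i, rfl, ⟨h1, h3⟩, h4⟩
      exact ⟨h1, mem_recordEvent_succ h3 h4⟩
  rw [this]
  refine MeasurableSet.iUnion fun j => MeasurableSet.iUnion fun i => MeasurableSet.iUnion fun h => ?_
  subst h
  exact MeasurableSet.inter ((obsFiltration hX).mono (by omega) _ (hA j))
    (measurableSet_nextEvent hX j i)

theorem StoppedEvent.add {hX : ∀ i, Measurable (X i)} {m : ℕ} {A : Set Ω}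
    (hA : StoppedEvent hX m A) (k : ℕ) : StoppedEvent hX (m + k) A := by
  induction k with
  | zero => exact hA
  | succ k ih => exact ih.succ

theorem StoppedEvent.inter {hX : ∀ i, Measurable (X i)} {m : ℕ} {A B : Set Ω}
    (hA : StoppedEvent hX m A) (hB : StoppedEvent hX m B) : StoppedEvent hX m (A ∩ B) := by
  intro j
  rw [inter_inter_distrib_right]
  exact (hA j).inter (hB j)

theorem stoppedEvent_univ (hX : ∀ i, Measurable (X i)) (m : ℕ) : StoppedEvent hX m univ := by
  induction m with
  | zero =>
    intro j
    rcases eq_or_ne j 0 with rfl | hj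
    · have : univ ∩ recordEvent X 0 0 = univ := by
        ext ω
        simp [recordEvent, recordTime, ProperRecord]
      rw [this]
      exact @MeasurableSet.univ _ (obsFiltration hX 0)
    · have : univ ∩ recordEvent X 0 j = ∅ := by
        ext ω
        simp [recordEvent, recordTime, hj.symm]
      rw [this]
      exact @MeasurableSet.empty _ (obsFiltration hX j)
  | succ m ih => exact ih.succ

theorem measurableSet_recordEvent (hX : ∀ i, Measurable (X i)) (m j : ℕ) :
    MeasurableSet[obsFiltration hX j] (recordEvent X m j) := by
  simpa using stoppedEvent_univ hX m j

theorem stoppedEvent_preimage (hX : ∀ i, Measurable (X i)) (m : ℕ) {B : Set ℝ}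
    (hB : MeasurableSet B) : StoppedEvent hX m (recordValue X m ⁻¹' B) := by
  intro j
  have : recordValue X m ⁻¹' B ∩ recordEvent X m j = X j ⁻¹' B ∩ recordEvent X m j := by
    ext ω
    simp only [mem_inter_iff, mem_preimage, and_congr_left_iff]
    intro h
    rw [recordValue, h.1]
  rw [this]
  exact MeasurableSet.inter (measurable_obs hX le_rfl hB) (measurableSet_recordEvent hX m j)

theorem measurable_recordTime (hX : ∀ i, Measurable (X i)) (m : ℕ) :
    Measurable fun ω => recordTime (fun i => X i ω) m := by
  induction m with
  | zero => exact measurable_const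
  | succ m ih =>
    have hval : Measurable fun ω => X (recordTime (fun i => X i ω) m) ω :=
      (measurable_from_prod_countable_right (f := fun q : ℕ × Ω => X q.1 q.2) hX).comp
        (ih.prodMk measurable_id)
    set S : ℕ → Set Ω := fun j => {ω | recordTime (fun i => X i ω) m < j ∧
      X (recordTime (fun i => X i ω) m) ω < X j ω} with hS
    have hSm : ∀ j, MeasurableSet (S j) := fun j =>
      (measurableSet_lt ih measurable_const).inter (measurableSet_lt hval (hX j))
    refine measurable_to_countable' fun j => ?_
    -- The second set accounts for the default value 0 of an empty infimum.
    have : (fun ω => recordTime (fun i => X i ω) (m + 1)) ⁻¹' {j} =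
        (S j ∩ ⋂ l, ⋂ (_ : l < j), (S l)ᶜ) ∪ (⋂ l, (S l)ᶜ) ∩ {_ω | j = 0} := by
      ext ω
      have hdef : recordTime (fun i => X i ω) (m + 1) = sInf {l : ℕ | ω ∈ S l} := rfl
      simp only [mem_preimage, mem_singleton_iff, hdef, mem_union, mem_inter_iff, mem_iInter,
        mem_compl_iff, mem_ofPred_eq]
      constructor
      · intro h
        rcases eq_empty_or_nonempty {l : ℕ | ω ∈ S l} with he | hne
        · right
          rw [he, Nat.sInf_empty] at h
          exact ⟨fun l hl => by
            have : l ∈ {l : ℕ | ω ∈ S l} := hl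
            simp [he] at this, h.symm⟩
        · left
          exact ⟨h ▸ Nat.sInf_mem hne, fun l hl => Nat.notMem_of_lt_sInf (h ▸ hl)⟩
      · rintro (⟨h1, h2⟩ | ⟨h1, h2⟩)
        · refine IsLeast.csInf_eq ⟨h1, fun l hl => ?_⟩
          by_contra! hlt
          exact h2 l hlt hl
        · have : {l : ℕ | ω ∈ S l} = ∅ := by
            ext l
            simpa using h1 l
          rw [this, Nat.sInf_empty, h2]
    rw [this]
    refine ((hSm j).inter (MeasurableSet.iInter fun l => MeasurableSet.iInter fun _ =>
      (hSm l).compl)).union ((MeasurableSet.iInter fun l => (hSm l).compl).inter ?_)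
    exact MeasurableSet.const _

theorem measurable_recordValue (hX : ∀ i, Measurable (X i)) (m : ℕ) :
    Measurable (recordValue X m) :=
  (measurable_from_prod_countable_right (f := fun q : ℕ × Ω => X q.1 q.2) hX).comp
    ((measurable_recordTime hX m).prodMk measurable_id)

theorem setLIntegral_properRecord (hX : ∀ i, Measurable (X i)) {m : ℕ} {A : Set Ω}
    (hA : StoppedEvent hX m A) {φ : ℝ → ENNReal} :
    ∫⁻ ω in A ∩ {ω | ProperRecord (fun i => X i ω) m}, φ (recordValue X m ω) ∂P =
      ∑' j, ∫⁻ ω in A ∩ recordEvent X m j, φ (X j ω) ∂P := by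
  rw [← iUnion_recordEvent, inter_iUnion, lintegral_iUnion
    (fun j => (obsFiltration hX).le j _ (hA j))
    fun j j' hne => (disjoint_recordEvent X m hne).mono inter_subset_right inter_subset_right]
  refine tsum_congr fun j => setLIntegral_congr_fun ((obsFiltration hX).le j _ (hA j)) ?_
  intro ω hω
  simp only [recordValue, hω.2.1]

variable [IsProbabilityMeasure P]

/-- The next observation is independent of the past. -/
theorem setLIntegral_next_obs (hX : ∀ i, Measurable (X i)) (hindep : iIndepFun X P)
    (hident : ∀ i, IdentDistrib (X i) (X 0) P P) {p j : ℕ} (hj : j ≤ p) {D : Set Ω}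
    (hD : MeasurableSet[obsFiltration hX p] D) {G : ℝ × ℝ → ENNReal} (hG : Measurable G) :
    ∫⁻ ω in D, G (X j ω, X (p + 1) ω) ∂P =
      ∫⁻ ω in D, ∫⁻ y, G (X j ω, y) ∂(P.map (X 0)) ∂P := by
  have hD' : MeasurableSet D := (obsFiltration hX).le p D hD
  -- Carrying the indicator of D as a coordinate reduces the claim to the independence of one
  -- past-measurable vector and the next observation, hence to Tonelli for a product law.
  set W : Ω → ENNReal × ℝ := fun ω => (D.indicator (fun _ => 1) ω, X j ω) with hW
  have hWm : Measurable[obsFiltration hX p] W :=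
    Measurable.prodMk (Measurable.indicator measurable_const hD) (measurable_obs hX hj)
  have hWm' : Measurable W := hWm.mono ((obsFiltration hX).le p) le_rfl
  have hind : IndepFun W (X (p + 1)) P := by
    rw [IndepFun_iff_Indep]
    exact (indep_of_indep_of_le_right (iIndepFun.indep_comap_natural_of_lt
      (fun i => (hX i).stronglyMeasurable) hindep (Nat.lt_succ_self p)) hWm.comap_le).symm
  have hmap := (indepFun_iff_map_prod_eq_prod_map_map hWm'.aemeasurable
    (hX (p + 1)).aemeasurable).1 hind
  rw [(hident (p + 1)).map_eq] at hmap
  have hH : Measurable fun q : (ENNReal × ℝ) × ℝ => q.1.1 * G (q.1.2, q.2) := by fun_prop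
  have hprob : IsProbabilityMeasure (P.map (X 0)) :=
    Measure.isProbabilityMeasure_map (hX 0).aemeasurable
  have h1 : ∫⁻ ω in D, G (X j ω, X (p + 1) ω) ∂P =
      ∫⁻ q, q.1.1 * G (q.1.2, q.2) ∂(P.map fun ω => (W ω, X (p + 1) ω)) := by
    rw [lintegral_map hH (hWm'.prodMk (hX (p + 1))), ← lintegral_indicator hD']
    refine lintegral_congr fun ω => ?_
    by_cases h : ω ∈ D <;> simp [hW, h]
  rw [h1, hmap, lintegral_prod _ hH.aemeasurable, lintegral_map hH.lintegral_prod_right' hWm',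
    ← lintegral_indicator hD']
  refine lintegral_congr fun ω => ?_
  by_cases h : ω ∈ D <;> simp [hW, h]

/-- Each further observation that stays below `X j` contributes an independent factor F(X j). -/
theorem setLIntegral_waitEvent (hX : ∀ i, Measurable (X i)) (hindep : iIndepFun X P)
    (hident : ∀ i, IdentDistrib (X i) (X 0) P P) {j : ℕ} {D : Set Ω}
    (hD : MeasurableSet[obsFiltration hX j] D) (i : ℕ) {φ : ℝ → ENNReal} (hφ : Measurable φ) :
    ∫⁻ ω in D ∩ waitEvent X j i, φ (X j ω) ∂P =
      ∫⁻ ω in D, ENNReal.ofReal (cdf (P.map (X 0)) (X j ω)) ^ i * φ (X j ω) ∂P := by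
  have hprob : IsProbabilityMeasure (P.map (X 0)) :=
    Measure.isProbabilityMeasure_map (hX 0).aemeasurable
  have hcdf : Measurable (cdf (P.map (X 0))) := (monotone_cdf _).measurable
  induction i generalizing φ with
  | zero =>
    have : D ∩ waitEvent X j 0 = D := by
      refine inter_eq_left.2 fun ω _ l h1 h2 => ?_
      omega
    simp [this]
  | succ i ih =>
    have hset : D ∩ waitEvent X j (i + 1) =
        (D ∩ waitEvent X j i) ∩ {ω | X (j + i + 1) ω ≤ X j ω} := by
      ext ω
      simp only [mem_inter_iff, waitEvent, mem_ofPred_eq, and_assoc]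
      refine and_congr_right fun _ => ⟨fun h => ⟨fun l h1 h2 => h l h1 (by omega),
        h _ (by omega) (by omega)⟩, fun h l h1 h2 => ?_⟩
      rcases Nat.lt_or_ge (j + i) l with h3 | h3
      · obtain rfl : l = j + i + 1 := by omega
        exact h.2
      · exact h.1 l h1 h3
    have hE : MeasurableSet[obsFiltration hX (j + i)] (D ∩ waitEvent X j i) :=
      MeasurableSet.inter ((obsFiltration hX).mono (Nat.le_add_right j i) _ hD)
        (measurableSet_waitEvent hX j i)
    have hle : MeasurableSet {ω | X (j + i + 1) ω ≤ X j ω} := measurableSet_le (hX _) (hX _)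
    have hGs : MeasurableSet {q : ℝ × ℝ | q.2 ≤ q.1} := measurableSet_le measurable_snd measurable_fst
    have hG : Measurable fun q : ℝ × ℝ => {q : ℝ × ℝ | q.2 ≤ q.1}.indicator (fun q => φ q.1) q :=
      (hφ.comp measurable_fst).indicator hGs
    rw [hset, inter_comm (D ∩ waitEvent X j i), ← Measure.restrict_restrict hle,
      ← lintegral_indicator hle]
    have h1 := setLIntegral_next_obs hX hindep hident (Nat.le_add_right j i) hE hG
    refine Eq.trans (lintegral_congr fun ω => ?_) (h1.trans ?_)
    · simp only [indicator, mem_ofPred_eq]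
    · have h2 : ∀ x : ℝ, ∫⁻ y, {q : ℝ × ℝ | q.2 ≤ q.1}.indicator (fun q => φ q.1) (x, y)
          ∂(P.map (X 0)) = ENNReal.ofReal (cdf (P.map (X 0)) x) * φ x := by
        intro x
        rw [ofReal_cdf, mul_comm, ← setLIntegral_const, ← lintegral_indicator measurableSet_Iic]
        refine lintegral_congr fun y => ?_
        simp only [indicator, mem_ofPred_eq, mem_Iic]
      simp only [h2]
      rw [ih (φ := fun x => ENNReal.ofReal (cdf (P.map (X 0)) x) * φ x)
        (hcdf.ennreal_ofReal.mul hφ)]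
      refine lintegral_congr fun ω => ?_
      rw [pow_succ, mul_assoc]

theorem measurable_setLIntegral_Ioi (μ : Measure ℝ) [SFinite μ] {g : ℝ → ENNReal}
    (hg : Measurable g) : Measurable fun x => ∫⁻ y in Ioi x, g y ∂μ := by
  have hGs : MeasurableSet {q : ℝ × ℝ | q.1 < q.2} := measurableSet_lt measurable_fst measurable_snd
  have hG : Measurable fun q : ℝ × ℝ => {q : ℝ × ℝ | q.1 < q.2}.indicator (fun q => g q.2) q :=
    (hg.comp measurable_snd).indicator hGs
  have := hG.lintegral_prod_right' (ν := μ)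
  convert! this using 2 with x
  rw [← lintegral_indicator measurableSet_Ioi]
  rfl

theorem setLIntegral_nextEvent (hX : ∀ i, Measurable (X i)) (hindep : iIndepFun X P)
    (hident : ∀ i, IdentDistrib (X i) (X 0) P P) {j : ℕ} {D : Set Ω}
    (hD : MeasurableSet[obsFiltration hX j] D) (i : ℕ) {g : ℝ → ENNReal} (hg : Measurable g) :
    ∫⁻ ω in D ∩ nextEvent X j i, g (X (j + i + 1) ω) ∂P =
      ∫⁻ ω in D, ENNReal.ofReal (cdf (P.map (X 0)) (X j ω)) ^ i *
        ∫⁻ y in Ioi (X j ω), g y ∂(P.map (X 0)) ∂P := by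
  have hprob : IsProbabilityMeasure (P.map (X 0)) :=
    Measure.isProbabilityMeasure_map (hX 0).aemeasurable
  have hE : MeasurableSet[obsFiltration hX (j + i)] (D ∩ waitEvent X j i) :=
    MeasurableSet.inter ((obsFiltration hX).mono (Nat.le_add_right j i) _ hD)
      (measurableSet_waitEvent hX j i)
  have hlt : MeasurableSet {ω | X j ω < X (j + i + 1) ω} := measurableSet_lt (hX _) (hX _)
  have hGs : MeasurableSet {q : ℝ × ℝ | q.1 < q.2} := measurableSet_lt measurable_fst measurable_snd
  have hG : Measurable fun q : ℝ × ℝ => {q : ℝ × ℝ | q.1 < q.2}.indicator (fun q => g q.2) q :=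
    (hg.comp measurable_snd).indicator hGs
  rw [nextEvent, ← inter_assoc, inter_comm (D ∩ waitEvent X j i), ← Measure.restrict_restrict hlt,
    ← lintegral_indicator hlt, ← setLIntegral_waitEvent hX hindep hident hD i
    (measurable_setLIntegral_Ioi _ hg)]
  refine Eq.trans (lintegral_congr fun ω => ?_)
    ((setLIntegral_next_obs hX hindep hident (Nat.le_add_right j i) hE hG).trans ?_)
  · simp only [indicator, mem_ofPred_eq]
  · refine lintegral_congr fun ω => ?_
    rw [← lintegral_indicator measurableSet_Ioi]
    rfl

/-- The transition operator of the Markov chain of record values. -/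
noncomputable def recordStep (μ : Measure ℝ) (g : ℝ → ENNReal) (x : ℝ) : ENNReal :=
  ENNReal.ofReal (1 - cdf μ x)⁻¹ * ∫⁻ y in Ioi x, g y ∂μ

theorem measurable_recordStep (μ : Measure ℝ) [SFinite μ] {g : ℝ → ENNReal} (hg : Measurable g) :
    Measurable (recordStep μ g) :=
  (measurable_const.sub (monotone_cdf μ).measurable).inv.ennreal_ofReal.mul
    (measurable_setLIntegral_Ioi μ hg)

theorem measure_Ioi_eq_ofReal (μ : Measure ℝ) [IsProbabilityMeasure μ] (x : ℝ) :
    μ (Ioi x) = ENNReal.ofReal (1 - cdf μ x) := by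
  rw [ENNReal.ofReal_sub _ (cdf_nonneg μ x), ofReal_cdf, ← compl_Iic,
    prob_compl_eq_one_sub measurableSet_Iic, ENNReal.ofReal_one]

/-- Summing over the waiting times gives the geometric series 1/(1 - F(x)). -/
theorem tsum_pow_mul_eq_recordStep (μ : Measure ℝ) [IsProbabilityMeasure μ] (g : ℝ → ENNReal)
    (x : ℝ) : ∑' i : ℕ, ENNReal.ofReal (cdf μ x) ^ i * ∫⁻ y in Ioi x, g y ∂μ =
      recordStep μ g x := by
  rw [ENNReal.tsum_mul_right, ENNReal.tsum_geometric, recordStep]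
  rcases (cdf_le_one μ x).lt_or_eq with h | h
  · rw [ENNReal.ofReal_inv_of_pos (by linarith), ENNReal.ofReal_sub _ (cdf_nonneg μ x),
      ENNReal.ofReal_one]
  -- Where F(x) = 1 the geometric series diverges, but no mass lies above x, so both sides are 0.
  · have : μ (Ioi x) = 0 := by rw [measure_Ioi_eq_ofReal, h]; simp
    rw [setLIntegral_measure_zero _ _ this, mul_zero, mul_zero]

/-- This is the Markov property restricted to proper records, where a default record time cannot
interfere. It is needed before the almost sure existence of records is known, since it serves to
prove that existence. -/
theorem setLIntegral_properRecord_succ (hX : ∀ i, Measurable (X i)) (hindep : iIndepFun X P)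
    (hident : ∀ i, IdentDistrib (X i) (X 0) P P) {m : ℕ} {A : Set Ω}
    (hA : StoppedEvent hX m A) {g : ℝ → ENNReal} (hg : Measurable g) :
    ∫⁻ ω in A ∩ {ω | ProperRecord (fun i => X i ω) (m + 1)}, g (recordValue X (m + 1) ω) ∂P =
      ∫⁻ ω in A ∩ {ω | ProperRecord (fun i => X i ω) m},
        recordStep (P.map (X 0)) g (recordValue X m ω) ∂P := by
  have hprob : IsProbabilityMeasure (P.map (X 0)) :=
    Measure.isProbabilityMeasure_map (hX 0).aemeasurable
  have hcdf : Measurable (cdf (P.map (X 0))) := (monotone_cdf _).measurable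
  have hm : ∀ q : ℕ × ℕ, MeasurableSet (A ∩ (recordEvent X m q.1 ∩ nextEvent X q.1 q.2)) := by
    intro q
    rw [← inter_assoc]
    exact ((obsFiltration hX).le _ _ (hA q.1)).inter
      ((obsFiltration hX).le _ _ (measurableSet_nextEvent hX q.1 q.2))
  rw [setLIntegral_properRecord hX hA, ← iUnion_recordEvent_inter_nextEvent, inter_iUnion,
    lintegral_iUnion hm fun j j' hne => (disjoint_recordEvent_inter_nextEvent X m hne).mono
      inter_subset_right inter_subset_right, ENNReal.tsum_prod']
  refine tsum_congr fun j => ?_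
  simp_rw [← tsum_pow_mul_eq_recordStep]
  have hterm : ∀ i : ℕ, Measurable fun ω => ENNReal.ofReal (cdf (P.map (X 0)) (X j ω)) ^ i *
      ∫⁻ y in Ioi (X j ω), g y ∂(P.map (X 0)) := fun i =>
    ((hcdf.comp (hX j)).ennreal_ofReal.pow_const i).mul
      ((measurable_setLIntegral_Ioi _ hg).comp (hX j))
  rw [lintegral_tsum fun i => (hterm i).aemeasurable]
  refine tsum_congr fun i => ?_
  rw [← setLIntegral_nextEvent hX hindep hident (hA j) i hg, ← inter_assoc]
  refine setLIntegral_congr_fun (by rw [inter_assoc]; exact hm (j, i)) fun ω hω => ?_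
  simp only [recordValue, recordTime_succ_of_mem hω.1.2 hω.2]

theorem ae_cdf_recordValue_lt_one [NullSingletonClass (P.map (X 0))] (hX : ∀ i, Measurable (X i))
    (hident : ∀ i, IdentDistrib (X i) (X 0) P P) (m : ℕ) :
    ∀ᵐ ω ∂P, cdf (P.map (X 0)) (recordValue X m ω) < 1 := by
  have hprob : IsProbabilityMeasure (P.map (X 0)) :=
    Measure.isProbabilityMeasure_map (hX 0).aemeasurable
  have : ∀ᵐ ω ∂P, ∀ j, cdf (P.map (X 0)) (X j ω) < 1 := by
    rw [ae_all_iff]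
    intro j
    have h := ae_cdf_lt_one (P.map (X 0))
    rw [← (hident j).map_eq] at h
    have := ae_of_ae_map (hX j).aemeasurable h
    simpa only [(hident j).map_eq] using this
  filter_upwards [this] with ω hω using hω _

theorem recordStep_one (μ : Measure ℝ) [IsProbabilityMeasure μ] {x : ℝ} (hx : cdf μ x < 1) :
    recordStep μ (fun _ => 1) x = 1 := by
  have : 0 < 1 - cdf μ x := by linarith
  rw [recordStep, setLIntegral_const, one_mul, measure_Ioi_eq_ofReal, ← ENNReal.ofReal_mul
    (by positivity), inv_mul_cancel₀ this.ne', ENNReal.ofReal_one]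

/-- With g = 1 the transition operator returns 1 wherever F < 1, so the probability that one more
record exists stays equal to 1. -/
theorem ae_properRecord [NullSingletonClass (P.map (X 0))] (hX : ∀ i, Measurable (X i))
    (hindep : iIndepFun X P) (hident : ∀ i, IdentDistrib (X i) (X 0) P P) (m : ℕ) :
    ∀ᵐ ω ∂P, ProperRecord (fun i => X i ω) m := by
  have hprob : IsProbabilityMeasure (P.map (X 0)) :=
    Measure.isProbabilityMeasure_map (hX 0).aemeasurable
  have hmeas : ∀ m, MeasurableSet {ω | ProperRecord (fun i => X i ω) m} := by
    intro m
    rw [← iUnion_recordEvent]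
    exact MeasurableSet.iUnion fun j =>
      (obsFiltration hX).le j _ (measurableSet_recordEvent hX m j)
  induction m with
  | zero => exact Eventually.of_forall fun ω i hi => absurd hi (Nat.not_lt_zero i)
  | succ m ih =>
    have h := setLIntegral_properRecord_succ hX hindep hident (stoppedEvent_univ hX m)
      (g := fun _ => 1) measurable_const
    rw [univ_inter, univ_inter, setLIntegral_one] at h
    have h2 : ∫⁻ ω in {ω | ProperRecord (fun i => X i ω) m},
        recordStep (P.map (X 0)) (fun _ => 1) (recordValue X m ω) ∂P = 1 := by
      have hmem : ∀ᵐ ω ∂P, ω ∈ {ω | ProperRecord (fun i => X i ω) m} := ih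
      rw [Measure.restrict_eq_self_of_ae_mem hmem, lintegral_congr_ae (g := fun _ => 1)]
      · simp
      · filter_upwards [ae_cdf_recordValue_lt_one hX hident m] with ω hω using recordStep_one _ hω
    rw [h2] at h
    exact (mem_ae_iff_prob_eq_one (hmeas (m + 1))).2 h

/-- The record values form a Markov chain with transition operator `recordStep`. -/
theorem setLIntegral_recordValue_succ [NullSingletonClass (P.map (X 0))] (hX : ∀ i, Measurable (X i))
    (hindep : iIndepFun X P) (hident : ∀ i, IdentDistrib (X i) (X 0) P P) {m : ℕ} {A : Set Ω}
    (hA : StoppedEvent hX m A) {g : ℝ → ENNReal} (hg : Measurable g) :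
    ∫⁻ ω in A, g (recordValue X (m + 1) ω) ∂P =
      ∫⁻ ω in A, recordStep (P.map (X 0)) g (recordValue X m ω) ∂P := by
  have hae : ∀ m, (A ∩ {ω | ProperRecord (fun i => X i ω) m} : Set Ω) =ᵐ[P] A := by
    intro m
    filter_upwards [ae_properRecord hX hindep hident m] with ω hω
    exact propext ⟨fun h => h.1, fun h => ⟨h, hω⟩⟩
  rw [← setLIntegral_congr (hae (m + 1)), ← setLIntegral_congr (hae m)]
  exact setLIntegral_properRecord_succ hX hindep hident hA hg

end Records

/-! ### Transition densities of the records and the bridge law between two of them. -/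

section RecordKernel

open Set

variable {μ : Measure ℝ} [IsProbabilityMeasure μ] [NullSingletonClass μ]

instance : SFinite (hazardMeasure μ) :=
  inferInstanceAs (SFinite (μ.withDensity fun t => ENNReal.ofReal (1 - cdf μ t)⁻¹))

theorem lintegral_hazardMeasure {g : ℝ → ENNReal} (hg : Measurable g) {s : Set ℝ}
    (hs : MeasurableSet s) : ∫⁻ t in s, g t ∂(hazardMeasure μ) =
      ∫⁻ t in s, ENNReal.ofReal (1 - cdf μ t)⁻¹ * g t ∂μ :=
  setLIntegral_withDensity_eq_setLIntegral_mul _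
    ((measurable_const.sub (continuous_cdf μ).measurable).inv.ennreal_ofReal) hg hs

/-- Tonelli: the factor 1/(1 - F(y)) for leaving the intermediate point y becomes the density of the
hazard measure. This is why bridge laws have densities with respect to that measure. -/
theorem lintegral_hazard_swap {w : ℝ → ℝ → ENNReal} (hw : Measurable (Function.uncurry w)) (x : ℝ) :
    ∫⁻ y in Ioi x, ENNReal.ofReal (1 - cdf μ y)⁻¹ * ∫⁻ z in Ioi y, w y z ∂μ ∂μ =
      ∫⁻ z in Ioi x, ∫⁻ y in Ioo x z, w y z ∂(hazardMeasure μ) ∂μ := by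
  have hGs : MeasurableSet {q : ℝ × ℝ | q.1 < q.2} := measurableSet_lt measurable_fst measurable_snd
  have hind := hw.indicator hGs
  have hm : Measurable fun y => ∫⁻ z in Ioi y, w y z ∂μ := by
    convert! hind.lintegral_prod_right' (ν := μ) using 2 with y
    rw [← lintegral_indicator measurableSet_Ioi]
    rfl
  rw [← lintegral_hazardMeasure hm measurableSet_Ioi]
  have h1 : ∀ y, ∫⁻ z in Ioi y, w y z ∂μ =
      ∫⁻ z, {q : ℝ × ℝ | q.1 < q.2}.indicator (Function.uncurry w) (y, z) ∂μ := by
    intro y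
    rw [← lintegral_indicator measurableSet_Ioi]
    rfl
  simp_rw [h1]
  rw [lintegral_lintegral_swap (f := fun y z =>
    {q : ℝ × ℝ | q.1 < q.2}.indicator (Function.uncurry w) (y, z)) hind.aemeasurable,
    ← lintegral_indicator measurableSet_Ioi]
  refine lintegral_congr fun z => ?_
  have h2 : ∫⁻ y in Ioi x, {q : ℝ × ℝ | q.1 < q.2}.indicator (Function.uncurry w) (y, z)
      ∂(hazardMeasure μ) = ∫⁻ y in Ioo x z, w y z ∂(hazardMeasure μ) := by
    rw [← lintegral_indicator measurableSet_Ioi, ← lintegral_indicator measurableSet_Ioo]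
    refine lintegral_congr fun y => ?_
    by_cases hxy : x < y <;> by_cases hyz : y < z <;> simp [indicator, hxy, hyz]
  rw [h2]
  by_cases hxz : x < z
  · rw [indicator_of_mem (show z ∈ Ioi x from hxz)]
  · rw [indicator_of_notMem (show z ∉ Ioi x from hxz), Ioo_eq_empty hxz]
    simp

/-- The `k + 1`-step transition density of the record values with respect to `μ`. -/
noncomputable def recordDensity (μ : Measure ℝ) (k : ℕ) (x y : ℝ) : ENNReal :=
  ENNReal.ofReal (1 - cdf μ x)⁻¹ * {q : ℝ × ℝ | q.1 < q.2}.indicator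
    (fun q => ENNReal.ofReal ((hazard μ q.2 - hazard μ q.1) ^ k / k.factorial)) (x, y)

theorem measurable_recordDensity (k : ℕ) : Measurable (Function.uncurry (recordDensity μ k)) := by
  have hR := measurable_hazard (μ := μ)
  have hF := (continuous_cdf μ).measurable
  have hGs : MeasurableSet {q : ℝ × ℝ | q.1 < q.2} := measurableSet_lt measurable_fst measurable_snd
  refine Measurable.mul (by fun_prop) (Measurable.indicator ?_ hGs)
  exact ((((hR.comp measurable_snd).sub (hR.comp measurable_fst)).pow_const k).div_const
    _).ennreal_ofReal

/-- The `k + 1`-step transition kernel of the record values. -/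
noncomputable def recordKernel (μ : Measure ℝ) [IsProbabilityMeasure μ] (k : ℕ) : Kernel ℝ ℝ :=
  Kernel.withDensity (Kernel.const ℝ μ) (recordDensity μ k)

instance (k : ℕ) : IsSFiniteKernel (recordKernel μ k) := by
  refine Kernel.IsSFiniteKernel.withDensity _ fun x y => ENNReal.mul_ne_top ENNReal.ofReal_ne_top ?_
  by_cases h : (x, y) ∈ {q : ℝ × ℝ | q.1 < q.2}
  · rw [indicator_of_mem h]
    exact ENNReal.ofReal_ne_top
  · rw [indicator_of_notMem h]
    exact ENNReal.zero_ne_top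

theorem lintegral_recordKernel (k : ℕ) (x : ℝ) {g : ℝ → ENNReal} (hg : Measurable g) :
    ∫⁻ y, g y ∂(recordKernel μ k x) = ENNReal.ofReal (1 - cdf μ x)⁻¹ *
      ∫⁻ y in Ioi x, ENNReal.ofReal ((hazard μ y - hazard μ x) ^ k / k.factorial) * g y ∂μ := by
  have hR := measurable_hazard (μ := μ)
  rw [recordKernel, Kernel.lintegral_withDensity _ (measurable_recordDensity k) _ hg,
    Kernel.const_apply, ← lintegral_indicator measurableSet_Ioi, ← lintegral_const_mul]
  · refine lintegral_congr fun y => ?_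
    by_cases h : x < y <;> simp [recordDensity, indicator, h, mul_assoc]
  · refine Measurable.indicator (Measurable.mul ?_ hg) measurableSet_Ioi
    exact (((hR.sub measurable_const).pow_const k).div_const _).ennreal_ofReal

theorem recordStep_eq (g : ℝ → ENNReal) (hg : Measurable g) (x : ℝ) :
    recordStep μ g x = ∫⁻ y, g y ∂(recordKernel μ 0 x) := by
  rw [lintegral_recordKernel 0 x hg]
  simp [recordStep]

/-- Composition of a weighted transition with another one. -/
theorem lintegral_recordKernel_mul (i j : ℕ) (x : ℝ) {f g : ℝ → ENNReal} (hf : Measurable f)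
    (hg : Measurable g) :
    ∫⁻ y, f y * ∫⁻ z, g z ∂(recordKernel μ j y) ∂(recordKernel μ i x) =
      ENNReal.ofReal (1 - cdf μ x)⁻¹ * ∫⁻ z in Ioi x, (∫⁻ y in Ioo x z,
        ENNReal.ofReal ((hazard μ y - hazard μ x) ^ i / i.factorial *
          ((hazard μ z - hazard μ y) ^ j / j.factorial)) * f y ∂(hazardMeasure μ)) * g z ∂μ := by
  have hR := measurable_hazard (μ := μ)
  have hs : Measurable fun q : ℝ × ℝ =>
      ENNReal.ofReal ((hazard μ q.2 - hazard μ q.1) ^ j / j.factorial) :=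
    ((((hR.comp measurable_snd).sub (hR.comp measurable_fst)).pow_const j).div_const
      _).ennreal_ofReal
  have hs' : Measurable fun y : ℝ => ENNReal.ofReal ((hazard μ y - hazard μ x) ^ i / i.factorial) :=
    (((hR.sub measurable_const).pow_const i).div_const _).ennreal_ofReal
  have hmk : Measurable fun y => ∫⁻ z, g z ∂(recordKernel μ j y) := hg.lintegral_kernel
  refine (lintegral_recordKernel i x (hf.mul hmk)).trans ?_
  congr 1
  have hw : Measurable (Function.uncurry fun y z : ℝ =>
      ENNReal.ofReal ((hazard μ y - hazard μ x) ^ i / i.factorial) * f y *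
      (ENNReal.ofReal ((hazard μ z - hazard μ y) ^ j / j.factorial) * g z)) :=
    ((hs'.mul hf).comp measurable_fst).mul (hs.mul (hg.comp measurable_snd))
  have h := lintegral_hazard_swap (μ := μ) hw x
  refine Eq.trans ?_ (h.trans ?_)
  · refine setLIntegral_congr_fun measurableSet_Ioi fun y hy => ?_
    simp only [Pi.mul_apply]
    rw [lintegral_recordKernel j y hg, lintegral_const_mul]
    · ring
    · exact ((hs.comp (measurable_const.prodMk measurable_id)).mul hg)
  · refine lintegral_congr_ae ?_
    filter_upwards [ae_restrict_of_ae (ae_cdf_lt_one μ)] with z hz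
    rw [← lintegral_mul_const]
    · refine setLIntegral_congr_fun measurableSet_Ioo fun y hy => ?_
      have h1 := hazard_le hy.1.le ((monotone_cdf μ hy.2.le).trans_lt hz)
      have h2 : 0 ≤ (hazard μ y - hazard μ x) ^ i / (i.factorial : ℝ) := by
        have : 0 ≤ hazard μ y - hazard μ x := by linarith
        positivity
      rw [ENNReal.ofReal_mul h2]
      ring
    · refine Measurable.mul ?_ hf
      exact ((((hR.sub measurable_const).pow_const i).div_const _).mul
        (((measurable_const.sub hR).pow_const j).div_const _)).ennreal_ofReal

/-- Chapman-Kolmogorov with a single last step: the beta integral with second exponent 0 raises the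
exponent of R(z) - R(x) by one. -/
theorem recordKernel_comp (i : ℕ) (x : ℝ) {g : ℝ → ENNReal} (hg : Measurable g) :
    ∫⁻ y, recordStep μ g y ∂(recordKernel μ i x) = ∫⁻ z, g z ∂(recordKernel μ (i + 1) x) := by
  have h := lintegral_recordKernel_mul (μ := μ) i 0 x (f := fun _ => 1) measurable_const hg
  simp only [one_mul, ← recordStep_eq g hg] at h
  rw [h, lintegral_recordKernel _ _ hg]
  congr 1
  refine lintegral_congr_ae ?_
  filter_upwards [ae_restrict_of_ae (ae_cdf_lt_one μ), ae_restrict_mem measurableSet_Ioi]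
    with z hz hxz
  simp only [mul_one]
  rw [lintegral_hazard_pow_mul_pow (le_of_lt hxz) hz, add_zero]

/-- The density, with respect to the hazard measure, of the law of an intermediate record value
given two other ones. -/
noncomputable def bridgeDensity (μ : Measure ℝ) (i j : ℕ) (p : ℝ × ℝ) (t : ℝ) : ENNReal :=
  {q : (ℝ × ℝ) × ℝ | q.1.1 < q.2 ∧ q.2 < q.1.2 ∧ cdf μ q.1.2 < 1}.indicator
    (fun q => ENNReal.ofReal (((hazard μ q.2 - hazard μ q.1.1) ^ i / i.factorial *
      ((hazard μ q.1.2 - hazard μ q.2) ^ j / j.factorial)) *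
      ((hazard μ q.1.2 - hazard μ q.1.1) ^ (i + j + 1) / (i + j + 1).factorial)⁻¹)) (p, t)

theorem measurable_bridgeDensity (i j : ℕ) :
    Measurable (Function.uncurry (bridgeDensity μ i j)) := by
  have hR := measurable_hazard (μ := μ)
  have hF := (continuous_cdf μ).measurable
  have hu : Measurable fun q : (ℝ × ℝ) × ℝ => hazard μ q.1.1 :=
    hR.comp (measurable_fst.comp measurable_fst)
  have hv : Measurable fun q : (ℝ × ℝ) × ℝ => hazard μ q.1.2 :=
    hR.comp (measurable_snd.comp measurable_fst)
  have ht : Measurable fun q : (ℝ × ℝ) × ℝ => hazard μ q.2 := hR.comp measurable_snd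
  refine Measurable.indicator ?_ ?_
  · exact (((((ht.sub hu).pow_const i).div_const _).mul (((hv.sub ht).pow_const j).div_const
      _)).mul (((hv.sub hu).pow_const _).div_const _).inv).ennreal_ofReal
  · exact (measurableSet_lt (measurable_fst.comp measurable_fst) measurable_snd).inter
      ((measurableSet_lt measurable_snd (measurable_snd.comp measurable_fst)).inter
      (measurableSet_lt (hF.comp (measurable_snd.comp measurable_fst)) measurable_const))

/-- The conditional law of an intermediate record value given two other ones. -/
noncomputable def bridgeKernel (μ : Measure ℝ) [IsProbabilityMeasure μ] (i j : ℕ) :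
    Kernel (ℝ × ℝ) ℝ :=
  haveI : SFinite (hazardMeasure μ) :=
    inferInstanceAs (SFinite (μ.withDensity fun t => ENNReal.ofReal (1 - cdf μ t)⁻¹))
  Kernel.withDensity (Kernel.const (ℝ × ℝ) (hazardMeasure μ)) (bridgeDensity μ i j)

theorem bridgeKernel_apply (i j : ℕ) {u v : ℝ} (hv : cdf μ v < 1) :
    bridgeKernel μ i j (u, v) = ((hazardMeasure μ).restrict (Ioo u v)).withDensity fun t =>
      ENNReal.ofReal (((hazard μ t - hazard μ u) ^ i / i.factorial *
        ((hazard μ v - hazard μ t) ^ j / j.factorial)) *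
        ((hazard μ v - hazard μ u) ^ (i + j + 1) / (i + j + 1).factorial)⁻¹) := by
  rw [bridgeKernel, Kernel.withDensity_apply _ (measurable_bridgeDensity i j), Kernel.const_apply,
    ← withDensity_indicator measurableSet_Ioo]
  congr 1
  ext t
  by_cases h1 : u < t <;> by_cases h2 : t < v <;> simp [bridgeDensity, indicator, h1, h2, hv]

/-- Equality can fail: if R(u) = R(v) the inverse of the normalizing constant is 0 and so is the
kernel. The clause `cdf μ q.1.2 < 1` in `bridgeDensity` removes the pairs for which `hazard` has the
junk value 0 at v. -/
theorem bridgeKernel_univ_le (i j : ℕ) (p : ℝ × ℝ) : bridgeKernel μ i j p univ ≤ 1 := by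
  obtain ⟨u, v⟩ := p
  rcases (cdf_le_one μ v).lt_or_eq with hv | hv
  · rw [bridgeKernel_apply i j hv, withDensity_apply _ MeasurableSet.univ, Measure.restrict_univ]
    rcases le_or_gt v u with huv | huv
    · simp [Ioo_eq_empty (not_lt.2 huv)]
    · have hR := hazard_le huv.le hv
      have h0 : 0 ≤ ((hazard μ v - hazard μ u) ^ (i + j + 1) / ((i + j + 1).factorial : ℝ))⁻¹ := by
        have : 0 ≤ hazard μ v - hazard μ u := by linarith
        positivity
      simp_rw [ENNReal.ofReal_mul' h0]
      rw [lintegral_mul_const' _ _ ENNReal.ofReal_ne_top, lintegral_hazard_pow_mul_pow huv.le hv,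
        ← ENNReal.ofReal_mul' h0, ← ENNReal.ofReal_one]
      exact ENNReal.ofReal_le_ofReal (mul_inv_le_one)
  · rw [bridgeKernel, Kernel.withDensity_apply _ (measurable_bridgeDensity i j)]
    have : bridgeDensity μ i j (u, v) = 0 := by
      ext t
      simp [bridgeDensity, indicator, hv]
    rw [this]
    simp

instance (i j : ℕ) : IsFiniteKernel (bridgeKernel μ i j) :=
  ⟨⟨1, ENNReal.one_lt_top, bridgeKernel_univ_le i j⟩⟩

/-- The three-point transition law factorizes through the bridge kernel. -/
theorem lintegral_recordKernel_eq_bridge (i j : ℕ) (x : ℝ) {B : Set ℝ} (hB : MeasurableSet B)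
    {g : ℝ → ENNReal} (hg : Measurable g) :
    ∫⁻ y, B.indicator (fun _ => 1) y * ∫⁻ z, g z ∂(recordKernel μ j y) ∂(recordKernel μ i x) =
      ∫⁻ z, g z * bridgeKernel μ i j (x, z) B ∂(recordKernel μ (i + j + 1) x) := by
  have hR := measurable_hazard (μ := μ)
  have hb : Measurable fun z => bridgeKernel μ i j (x, z) B :=
    (Kernel.measurable_coe _ hB).comp (measurable_const.prodMk measurable_id)
  rw [lintegral_recordKernel_mul i j x (measurable_const.indicator hB) hg]
  refine Eq.trans ?_ (lintegral_recordKernel _ _ (hg.mul hb)).symm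
  congr 1
  refine lintegral_congr_ae ?_
  -- For almost every z > x one has F(x) < F(z) < 1, so the normalizing constant of the bridge is
  -- positive and cancels against the transition density.
  filter_upwards [ae_restrict_of_ae (ae_cdf_lt_one μ), ae_restrict_of_ae (ae_cdf_ne μ (cdf μ x)),
    ae_restrict_mem measurableSet_Ioi] with z hz hne hxz
  have hxz' : x < z := hxz
  have hlt : hazard μ x < hazard μ z :=
    hazard_lt (lt_of_le_of_ne (monotone_cdf μ hxz'.le) hne.symm) hz
  have hpos : 0 < (hazard μ z - hazard μ x) ^ (i + j + 1) / ((i + j + 1).factorial : ℝ) := by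
    have : 0 < hazard μ z - hazard μ x := by linarith
    positivity
  have hbk : bridgeKernel μ i j (x, z) B =
      (∫⁻ y in Ioo x z, ENNReal.ofReal ((hazard μ y - hazard μ x) ^ i / i.factorial *
          ((hazard μ z - hazard μ y) ^ j / j.factorial)) * B.indicator (fun _ => 1) y
          ∂(hazardMeasure μ)) *
        ENNReal.ofReal ((hazard μ z - hazard μ x) ^ (i + j + 1) / (i + j + 1).factorial)⁻¹ := by
    rw [bridgeKernel_apply i j hz, withDensity_apply _ hB, ← lintegral_indicator hB,
      ← lintegral_mul_const' _ _ ENNReal.ofReal_ne_top]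
    refine lintegral_congr fun y => ?_
    by_cases hy : y ∈ B
    · rw [indicator_of_mem hy, indicator_of_mem hy, mul_one,
        ENNReal.ofReal_mul' (inv_nonneg.2 hpos.le)]
    · rw [indicator_of_notMem hy, indicator_of_notMem hy, mul_zero, zero_mul]
  simp only [Pi.mul_apply]
  rw [hbk]
  have hinv : ENNReal.ofReal ((hazard μ z - hazard μ x) ^ (i + j + 1) / (i + j + 1).factorial) *
      ENNReal.ofReal ((hazard μ z - hazard μ x) ^ (i + j + 1) / (i + j + 1).factorial)⁻¹ = 1 := by
    rw [← ENNReal.ofReal_mul hpos.le, mul_inv_cancel₀ hpos.ne', ENNReal.ofReal_one]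
  rw [mul_comm _ (g z)]
  calc _ = g z * (∫⁻ y in Ioo x z, ENNReal.ofReal ((hazard μ y - hazard μ x) ^ i / i.factorial *
          ((hazard μ z - hazard μ y) ^ j / j.factorial)) * B.indicator (fun _ => 1) y
          ∂(hazardMeasure μ)) * 1 := by rw [mul_one]
    _ = _ := by rw [← hinv]; ring

end RecordKernel

/-! ### Joint and conditional laws of record values. -/

section RecordLaw

open Set

variable {Ω : Type*} [MeasurableSpace Ω] {P : Measure Ω} [IsProbabilityMeasure P] {X : ℕ → Ω → ℝ}
  {μ : Measure ℝ} [IsProbabilityMeasure μ] [NullSingletonClass μ]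

/-- Multi-step transitions of the record values. -/
theorem setLIntegral_recordValue_add (hμ : μ = P.map (X 0)) (hX : ∀ i, Measurable (X i))
    (hindep : iIndepFun X P) (hident : ∀ i, IdentDistrib (X i) (X 0) P P) {m : ℕ} {A : Set Ω}
    (hA : StoppedEvent hX m A) (k : ℕ) {g : ℝ → ENNReal} (hg : Measurable g) :
    ∫⁻ ω in A, g (recordValue X (m + k + 1) ω) ∂P =
      ∫⁻ ω in A, ∫⁻ y, g y ∂(recordKernel μ k (recordValue X m ω)) ∂P := by
  subst hμ
  induction k generalizing g with
  | zero =>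
    rw [add_zero, setLIntegral_recordValue_succ hX hindep hident hA hg]
    exact lintegral_congr fun ω => recordStep_eq g hg _
  | succ k ih =>
    have h := setLIntegral_recordValue_succ hX hindep hident (hA.add (k + 1)) hg
    rw [← add_assoc] at h ⊢
    rw [h, ih (measurable_recordStep _ hg)]
    exact lintegral_congr fun ω => recordKernel_comp k _ hg

/-- The joint law of two record values. -/
theorem map_recordValue_pair (hμ : μ = P.map (X 0)) (hX : ∀ i, Measurable (X i))
    (hindep : iIndepFun X P) (hident : ∀ i, IdentDistrib (X i) (X 0) P P) (m k : ℕ) :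
    P.map (fun ω => (recordValue X m ω, recordValue X (m + k + 1) ω)) =
      (P.map (recordValue X m)) ⊗ₘ recordKernel μ k := by
  have hm := measurable_recordValue hX m
  have hm' := measurable_recordValue hX (m + k + 1)
  refine Measure.ext_prod fun {s t} hs ht => ?_
  rw [Measure.map_apply (hm.prodMk hm') (hs.prod ht), Measure.compProd_apply_prod hs ht,
    setLIntegral_map hs (Kernel.measurable_coe _ ht) hm]
  have h := setLIntegral_recordValue_add hμ hX hindep hident (stoppedEvent_preimage hX m hs) k
    (g := t.indicator fun _ => 1) (measurable_const.indicator ht)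
  simp only [lintegral_indicator_const ht, one_mul] at h
  rw [← h]
  have h2 : ∀ ω, t.indicator (fun _ => (1 : ENNReal)) (recordValue X (m + k + 1) ω) =
      (recordValue X (m + k + 1) ⁻¹' t).indicator (fun _ => 1) ω := fun ω => rfl
  simp_rw [h2]
  rw [lintegral_indicator_const (hm' ht), one_mul, Measure.restrict_apply (hm' ht), inter_comm]
  rfl

/-- The conditional law of an intermediate record value given two other ones. -/
theorem condDistrib_recordValue (hμ : μ = P.map (X 0)) (hX : ∀ i, Measurable (X i))
    (hindep : iIndepFun X P) (hident : ∀ i, IdentDistrib (X i) (X 0) P P) (m i j : ℕ) :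
    condDistrib (recordValue X (m + i + 1))
      (fun ω => (recordValue X m ω, recordValue X (m + i + 1 + j + 1) ω)) P
      =ᵐ[P.map (fun ω => (recordValue X m ω, recordValue X (m + i + 1 + j + 1) ω))]
      bridgeKernel μ i j := by
  have hm := measurable_recordValue hX m
  have hy := measurable_recordValue hX (m + i + 1)
  have hz := measurable_recordValue hX (m + i + 1 + j + 1)
  refine condDistrib_ae_eq_of_measure_eq_compProd _ hy.aemeasurable ?_
  refine Measure.ext_prod₃' fun {s u t} hs hu ht => ?_
  rw [Measure.map_apply ((hm.prodMk hz).prodMk hy) ((hs.prod hu).prod ht),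
    Measure.compProd_apply_prod (hs.prod hu) ht]
  have hpair := map_recordValue_pair hμ hX hindep hident m (i + j + 1)
  rw [show m + (i + j + 1) + 1 = m + i + 1 + j + 1 by ring] at hpair
  rw [hpair, Measure.setLIntegral_compProd (Kernel.measurable_coe _ ht) hs hu,
    setLIntegral_map hs ?_ hm]
  -- An event known at the first record is also known at the middle one, so the Markov property
  -- applies twice: from the middle record to the last here, and from the first to the middle in
  -- `h2`.
  · have h1 := setLIntegral_recordValue_add hμ hX hindep hident
      (((stoppedEvent_preimage hX m hs).add (i + 1)).inter
        (stoppedEvent_preimage hX (m + (i + 1)) ht)) j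
      (g := u.indicator fun _ => 1) (measurable_const.indicator hu)
    have hmk : Measurable fun y => t.indicator (fun _ => (1 : ENNReal)) y *
        ∫⁻ z, u.indicator (fun _ => 1) z ∂(recordKernel μ j y) :=
      (measurable_const.indicator ht).mul (measurable_const.indicator hu).lintegral_kernel
    have h2 := setLIntegral_recordValue_add hμ hX hindep hident
      (stoppedEvent_preimage hX m hs) i hmk
    have h3 : ∀ x, ∫⁻ y, t.indicator (fun _ => (1 : ENNReal)) y *
        ∫⁻ z, u.indicator (fun _ => 1) z ∂(recordKernel μ j y) ∂(recordKernel μ i x) =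
        ∫⁻ z in u, bridgeKernel μ i j (x, z) t ∂(recordKernel μ (i + j + 1) x) := by
      intro x
      rw [lintegral_recordKernel_eq_bridge i j x ht (measurable_const.indicator hu),
        ← lintegral_indicator hu]
      refine lintegral_congr fun z => ?_
      by_cases hzu : z ∈ u <;> simp [hzu]
    simp only [h3] at h2
    refine Eq.trans ?_ h2
    rw [← add_assoc] at h1
    have h4 : ∫⁻ ω in recordValue X m ⁻¹' s, t.indicator (fun _ => (1 : ENNReal))
        (recordValue X (m + i + 1) ω) * ∫⁻ z, u.indicator (fun _ => 1) z
          ∂(recordKernel μ j (recordValue X (m + i + 1) ω)) ∂P =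
        ∫⁻ ω in recordValue X m ⁻¹' s ∩ recordValue X (m + i + 1) ⁻¹' t,
          ∫⁻ z, u.indicator (fun _ => 1) z ∂(recordKernel μ j (recordValue X (m + i + 1) ω)) ∂P := by
      rw [inter_comm, ← Measure.restrict_restrict (hy ht), ← lintegral_indicator (hy ht)]
      refine lintegral_congr fun ω => ?_
      by_cases hω : recordValue X (m + i + 1) ω ∈ t <;> simp [indicator, hω]
    rw [h4, ← h1]
    have h5 : ∀ ω, u.indicator (fun _ => (1 : ENNReal)) (recordValue X (m + i + 1 + j + 1) ω) =
        (recordValue X (m + i + 1 + j + 1) ⁻¹' u).indicator (fun _ => 1) ω := fun ω => rfl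
    simp_rw [h5]
    rw [lintegral_indicator_const (hz hu), one_mul, Measure.restrict_apply (hz hu)]
    congr 1
    ext ω
    simp only [mem_preimage, mem_prod, mem_inter_iff]
    tauto
  · exact Measurable.lintegral_kernel_prod_right' (κ := (recordKernel μ (i + j + 1)).restrict hu)
      (Kernel.measurable_coe _ ht)

/-- An almost sure property of a pair of record values holds for almost all ordered pairs. -/
theorem ae_prod_of_ae_map_of_absolutelyContinuous (hμ : μ = P.map (X 0)) (hX : ∀ i, Measurable (X i))
    (hindep : iIndepFun X P) (hident : ∀ i, IdentDistrib (X i) (X 0) P P) {m : ℕ} (k : ℕ)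
    (hac : μ ≪ P.map (recordValue X m)) {Φ : ℝ × ℝ → Prop}
    (hΦ : ∀ᵐ p ∂(P.map (fun ω => (recordValue X m ω, recordValue X (m + k + 1) ω))), Φ p) :
    ∀ᵐ p ∂(μ.prod μ), p.1 < p.2 → Φ p := by
  rw [map_recordValue_pair hμ hX hindep hident] at hΦ
  -- Φ need not be measurable; its exceptional set is replaced by a measurable hull of the same
  -- measure.
  set N := toMeasurable ((P.map (recordValue X m)) ⊗ₘ recordKernel μ k) {p | ¬Φ p} with hN
  have hNm : MeasurableSet N := measurableSet_toMeasurable _ _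
  have hN0 : ∀ᵐ p ∂((P.map (recordValue X m)) ⊗ₘ recordKernel μ k), p ∉ N := by
    have h : ((P.map (recordValue X m)) ⊗ₘ recordKernel μ k) N = 0 := by
      rw [hN, measure_toMeasurable]
      exact hΦ
    exact measure_eq_zero_iff_ae_notMem.1 h
  have hlt : MeasurableSet {p : ℝ × ℝ | p.1 < p.2} :=
    measurableSet_lt measurable_fst measurable_snd
  -- The transition density is positive at almost every z > x, so there kernel-null sets are μ-null.
  have hall : ∀ᵐ x ∂μ, ∀ᵐ z ∂μ, x < z → (x, z) ∉ N := by
    filter_upwards [hac.ae_le (Measure.ae_ae_of_ae_compProd hN0), ae_cdf_lt_one μ] with x hx hx1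
    rw [recordKernel, Kernel.withDensity_apply _ (measurable_recordDensity k), Kernel.const_apply,
      ae_withDensity_iff (measurable_recordDensity k).of_uncurry_left] at hx
    filter_upwards [hx, ae_cdf_lt_one μ, ae_cdf_ne μ (cdf μ x)] with z hz hz1 hzx hxz
    refine hz ?_
    have h1 : 0 < hazard μ z - hazard μ x :=
      sub_pos.2 (hazard_lt (lt_of_le_of_ne (monotone_cdf μ hxz.le) hzx.symm) hz1)
    have h2 : 0 < 1 - cdf μ x := by linarith
    rw [recordDensity, indicator_of_mem (show (x, z) ∈ {q : ℝ × ℝ | q.1 < q.2} from hxz)]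
    refine mul_ne_zero ?_ ?_
    · exact (ENNReal.ofReal_pos.2 (by positivity)).ne'
    · exact (ENNReal.ofReal_pos.2 (by positivity)).ne'
  have hall' : ∀ᵐ p ∂(μ.prod μ), p.1 < p.2 → p ∉ N := by
    refine (Measure.ae_prod_iff_ae_ae ?_).2 hall
    have : {p : ℝ × ℝ | p.1 < p.2 → p ∉ N} = {p : ℝ × ℝ | p.1 < p.2}ᶜ ∪ Nᶜ := by
      ext p
      simp [imp_iff_not_or]
    rw [this]
    exact hlt.compl.union hNm.compl
  filter_upwards [hall'] with p hp hlt
  by_contra hcon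
  exact hp hlt (subset_toMeasurable _ _ hcon)

/-- The first observation has law μ. If a later record avoids B almost surely, then z ∉ B for almost
all pairs x < z; since almost every z has μ-mass below it, a suitable x exists and B is μ-null. -/
theorem absolutelyContinuous_map_recordValue (hμ : μ = P.map (X 0)) (hX : ∀ i, Measurable (X i))
    (hindep : iIndepFun X P) (hident : ∀ i, IdentDistrib (X i) (X 0) P P) (m : ℕ) :
    μ ≪ P.map (recordValue X m) := by
  have h0 : P.map (recordValue X 0) = μ := hμ.symm
  rcases m with _ | k
  · rw [h0]
  · refine Measure.AbsolutelyContinuous.mk fun B hB hB0 => ?_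
    have hΦ : ∀ᵐ p ∂(P.map (fun ω => (recordValue X 0 ω, recordValue X (0 + k + 1) ω))),
        p.2 ∉ B := by
      rw [zero_add]
      have hpm := (measurable_recordValue hX 0).prodMk (measurable_recordValue hX (k + 1))
      rw [Measure.map_apply (measurable_recordValue hX (k + 1)) hB] at hB0
      exact (ae_map_iff hpm.aemeasurable (measurable_snd hB).compl).2
        (measure_eq_zero_iff_ae_notMem.1 hB0)
    have h := ae_prod_of_ae_map_of_absolutelyContinuous hμ hX hindep hident k h0.symm.absolutelyContinuous hΦ
    have hlt : MeasurableSet {p : ℝ × ℝ | p.1 < p.2 → p.2 ∉ B} := by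
      have : {p : ℝ × ℝ | p.1 < p.2 → p.2 ∉ B} = {p : ℝ × ℝ | p.1 < p.2}ᶜ ∪ (Prod.snd ⁻¹' B)ᶜ := by
        ext p
        simp [imp_iff_not_or]
      rw [this]
      exact (measurableSet_lt measurable_fst measurable_snd).compl.union (measurable_snd hB).compl
    have h2 := (Measure.ae_ae_comm (p := fun x z => x < z → z ∉ B) hlt).1
      ((Measure.ae_prod_iff_ae_ae hlt).1 h)
    rw [measure_eq_zero_iff_ae_notMem]
    filter_upwards [h2, ae_cdf_pos μ] with z hz hpos
    have hIio : μ (Iio z) ≠ 0 := by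
      rw [measure_congr (Iio_ae_eq_Iic (μ := μ)), ← ofReal_cdf]
      exact (ENNReal.ofReal_pos.2 hpos).ne'
    obtain ⟨x, hx, hxz⟩ := (Filter.Eventually.and_frequently hz
      (frequently_ae_mem_iff.2 hIio)).exists
    exact hx hxz

theorem ae_prod_of_ae_map (hμ : μ = P.map (X 0)) (hX : ∀ i, Measurable (X i))
    (hindep : iIndepFun X P) (hident : ∀ i, IdentDistrib (X i) (X 0) P P) (m k : ℕ)
    {Φ : ℝ × ℝ → Prop}
    (hΦ : ∀ᵐ p ∂(P.map (fun ω => (recordValue X m ω, recordValue X (m + k + 1) ω))), Φ p) :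
    ∀ᵐ p ∂(μ.prod μ), p.1 < p.2 → Φ p :=
  ae_prod_of_ae_map_of_absolutelyContinuous hμ hX hindep hident k
    (absolutelyContinuous_map_recordValue hμ hX hindep hident m) hΦ

end RecordLaw

/-! ### Derivatives of the difference quotient: recurrences and integral formula. -/

section DividedDifferences

open Set

theorem ContDiffOn.continuousOn_iteratedDeriv_of_isOpen {f : ℝ → ℝ} {W : Set ℝ} {K i : ℕ}
    (hf : ContDiffOn ℝ K f W) (hW : IsOpen W) (hi : i ≤ K) : ContinuousOn (iteratedDeriv i f) W :=
  (hf.continuousOn_iteratedDerivWithin (by exact_mod_cast hi) hW.uniqueDiffOn).congr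
    fun _ hx => (iteratedDerivWithin_of_isOpen hW hx).symm

theorem ContDiffOn.hasDerivAt_iteratedDeriv {f : ℝ → ℝ} {W : Set ℝ} {K i : ℕ}
    (hf : ContDiffOn ℝ K f W) (hW : IsOpen W) (hi : i < K) {x : ℝ} (hx : x ∈ W) :
    HasDerivAt (iteratedDeriv i f) (iteratedDeriv (i + 1) f x) x := by
  have h := (hf.differentiableOn_iteratedDerivWithin (m := i) (by exact_mod_cast hi)
    hW.uniqueDiffOn).congr fun _ hx => (iteratedDerivWithin_of_isOpen hW hx).symm
  rw [iteratedDeriv_succ]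
  exact (h.differentiableAt (hW.mem_nhds hx)).hasDerivAt

/-- The Taylor remainder quotient, an explicit form of `∂ ^ j M / ∂ v ^ j`. -/
noncomputable def taylorQuot (h : ℝ → ℝ) (j : ℕ) (u v : ℝ) : ℝ :=
  j.factorial * (h u - ∑ i ∈ Finset.range (j + 1), iteratedDeriv i h v * (u - v) ^ i / i.factorial) /
    (u - v) ^ (j + 1)

theorem taylorQuot_zero (h : ℝ → ℝ) (u v : ℝ) : taylorQuot h 0 u v = diffQuot h u v := by
  simp only [taylorQuot, diffQuot, Nat.factorial_zero, Nat.cast_one, one_mul, zero_add,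
    Finset.range_one, Finset.sum_singleton, pow_zero, mul_one, div_one, iteratedDeriv_zero, pow_one]
  rw [← neg_sub v u, ← neg_sub (h v), neg_div_neg_eq]

/-- Leibniz: this is the (j+1)-st derivative in v of (v - u) M(u, v) = h(v) - h(u). Later it
rewrites h^(j+1) as (j+1) p + (v - u) p' with p the j-th derivative of M in v. -/
theorem taylorQuot_recurrence (h : ℝ → ℝ) (j : ℕ) {u v : ℝ} (huv : u ≠ v) :
    (v - u) * taylorQuot h (j + 1) u v + (j + 1) * taylorQuot h j u v =
      iteratedDeriv (j + 1) h v := by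
  have h0 : u - v ≠ 0 := sub_ne_zero.2 huv
  have hj : (j.factorial : ℝ) ≠ 0 := by positivity
  have hj1 : (j + 1 : ℝ) ≠ 0 := by positivity
  simp only [taylorQuot]
  rw [Finset.sum_range_succ _ (j + 1), Nat.factorial_succ]
  generalize ∑ i ∈ Finset.range (j + 1), iteratedDeriv i h v * (u - v) ^ i / (i.factorial : ℝ) = S
  have h1 : v - u = -(u - v) := by ring
  rw [h1]
  generalize u - v = w at h0
  push_cast
  field_simp
  ring

theorem hasDerivAt_taylorQuot {h : ℝ → ℝ} {I : Set ℝ} {K j : ℕ} (hf : ContDiffOn ℝ K h I)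
    (hI : IsOpen I) (hj : j < K) {u v : ℝ} (hv : v ∈ I) (huv : u ≠ v) :
    HasDerivAt (fun v => taylorQuot h j u v) (taylorQuot h (j + 1) u v) v := by
  have h0 : u - v ≠ 0 := sub_ne_zero.2 huv
  have hsub : HasDerivAt (fun v => u - v) (-1) v := by
    simpa using (hasDerivAt_id v).const_sub u
  -- Differentiating a Taylor polynomial in its centre telescopes to a single term.
  have hsum : ∀ n, n < K → HasDerivAt
      (fun v => ∑ i ∈ Finset.range (n + 1), iteratedDeriv i h v * (u - v) ^ i / i.factorial)
      (iteratedDeriv (n + 1) h v * (u - v) ^ n / n.factorial) v := by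
    intro n
    induction n with
    | zero =>
      intro hn
      simpa using hf.hasDerivAt_iteratedDeriv hI hn hv
    | succ n ih =>
      intro hn
      have h1 := ih (by omega)
      have h2 := ((hf.hasDerivAt_iteratedDeriv hI hn hv).mul (hsub.pow (n + 1))).div_const
        ((n + 1).factorial : ℝ)
      have h3 := h1.add h2
      simp_rw [Finset.sum_range_succ _ (n + 1)]
      convert! h3 using 1
      have hn0 : (n.factorial : ℝ) ≠ 0 := by positivity
      have hn1 : (n + 1 : ℝ) ≠ 0 := by positivity
      rw [Nat.factorial_succ]
      push_cast
      simp only [Pi.pow_apply]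
      field_simp
      ring
  have hd := (((hsum j hj).const_sub (h u)).const_mul (j.factorial : ℝ)).div (hsub.pow (j + 1))
    (pow_ne_zero _ h0)
  convert! hd using 1
  simp only [taylorQuot]
  rw [Finset.sum_range_succ _ (j + 1), Nat.factorial_succ]
  generalize ∑ i ∈ Finset.range (j + 1), iteratedDeriv i h v * (u - v) ^ i / (i.factorial : ℝ) = S
  have hn0 : (j.factorial : ℝ) ≠ 0 := by positivity
  have hn1 : (j + 1 : ℝ) ≠ 0 := by positivity
  simp only [Pi.pow_apply, Nat.add_sub_cancel]
  generalize u - v = w at h0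
  push_cast
  field_simp
  ring

theorem iteratedDeriv_diffQuot {h : ℝ → ℝ} {I : Set ℝ} {K j : ℕ} (hf : ContDiffOn ℝ K h I)
    (hI : IsOpen I) (hj : j ≤ K) {u v : ℝ} (hv : v ∈ I) (huv : u ≠ v) :
    iteratedDeriv j (fun v' => diffQuot h u v') v = taylorQuot h j u v := by
  induction j generalizing v with
  | zero => rw [iteratedDeriv_zero, taylorQuot_zero]
  | succ j ih =>
    rw [iteratedDeriv_succ]
    have hev : iteratedDeriv j (fun v' => diffQuot h u v') =ᶠ[𝓝 v] fun v => taylorQuot h j u v := by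
      filter_upwards [hI.mem_nhds hv, isOpen_ne.mem_nhds huv.symm] with x hx hxu
      exact ih (by omega) hx (Ne.symm hxu)
    rw [hev.deriv_eq]
    exact (hasDerivAt_taylorQuot hf hI (by omega) hv huv).deriv

theorem diffQuotDeriv_eq {h : ℝ → ℝ} {I : Set ℝ} {K i j : ℕ} (hf : ContDiffOn ℝ K h I)
    (hI : IsOpen I) (hj : j ≤ K) {u v : ℝ} (hv : v ∈ I) (huv : u ≠ v) :
    diffQuotDeriv h i j u v = iteratedDeriv i (fun u' => taylorQuot h j u' v) u := by
  refine Filter.EventuallyEq.iteratedDeriv_eq i ?_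
  filter_upwards [isOpen_ne.mem_nhds huv] with x hx
  exact iteratedDeriv_diffQuot hf hI hj hv hx

/-- For fixed v the derivatives of h at v are constants. Hence j derivatives in v cost no smoothness
in u, and mixed derivatives up to order K in each variable separately are available. -/
theorem contDiffOn_taylorQuot {h : ℝ → ℝ} {I : Set ℝ} {K : ℕ} (hf : ContDiffOn ℝ K h I)
    (j : ℕ) (v : ℝ) : ContDiffOn ℝ K (fun u => taylorQuot h j u v) (I \ {v}) := by
  have hs : ContDiff ℝ K fun u : ℝ => u - v := contDiff_id.sub contDiff_const
  refine ContDiffOn.div (contDiffOn_const.mul ((hf.mono sdiff_subset).sub ?_)) ?_ ?_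
  · exact (ContDiff.sum fun i _ => (contDiff_const.mul (hs.pow i)).div_const _).contDiffOn
  · exact (hs.pow _).contDiffOn
  · exact fun u hu => pow_ne_zero _ (sub_ne_zero.2 hu.2)

theorem isOpen_diff_singleton {I : Set ℝ} (hI : IsOpen I) (v : ℝ) : IsOpen (I \ {v}) :=
  hI.sdiff isClosed_singleton

section Recurrences

variable {h : ℝ → ℝ} {I : Set ℝ} {K : ℕ}

theorem hasDerivAt_iteratedDeriv_taylorQuot (hf : ContDiffOn ℝ K h I) (hI : IsOpen I) {i j : ℕ}
    (hi : i < K) {u v : ℝ} (hu : u ∈ I) (huv : u ≠ v) :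
    HasDerivAt (iteratedDeriv i fun u' => taylorQuot h j u' v)
      (iteratedDeriv (i + 1) (fun u' => taylorQuot h j u' v) u) u :=
  (contDiffOn_taylorQuot hf j v).hasDerivAt_iteratedDeriv (isOpen_diff_singleton hI v) hi
    ⟨hu, huv⟩

/-- Differentiate `taylorQuot_recurrence` i+1 times in u; its right side does not depend on u. -/
theorem iteratedDeriv_taylorQuot_succ_recurrence (hf : ContDiffOn ℝ K h I) (hI : IsOpen I)
    {i j : ℕ} (hi : i < K) {u v : ℝ} (hu : u ∈ I) (huv : u ≠ v) :
    (v - u) * iteratedDeriv (i + 1) (fun u' => taylorQuot h (j + 1) u' v) u =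
      (i + 1) * iteratedDeriv i (fun u' => taylorQuot h (j + 1) u' v) u -
        (j + 1) * iteratedDeriv (i + 1) (fun u' => taylorQuot h j u' v) u := by
  have hsub : ∀ u : ℝ, HasDerivAt (fun u => v - u) (-1) u := fun u => by
    simpa using (hasDerivAt_id u).const_sub v
  have hd : ∀ i j, i < K → ∀ u ∈ I, u ≠ v →
      HasDerivAt (iteratedDeriv i fun u' => taylorQuot h j u' v)
        (iteratedDeriv (i + 1) (fun u' => taylorQuot h j u' v) u) u :=
    fun i j hi u hu huv => hasDerivAt_iteratedDeriv_taylorQuot hf hI hi hu huv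
  have hW : ∀ u ∈ I, u ≠ v → ∀ᶠ x in 𝓝 u, x ∈ I ∧ x ≠ v := fun u hu huv =>
    (hI.eventually_mem hu).and (isOpen_ne.eventually_mem huv)
  induction i generalizing u with
  | zero =>
    have hev : (fun x => (v - x) * iteratedDeriv 0 (fun u' => taylorQuot h (j + 1) u' v) x +
        (j + 1) * iteratedDeriv 0 (fun u' => taylorQuot h j u' v) x) =ᶠ[𝓝 u]
        fun _ => iteratedDeriv (j + 1) h v := by
      filter_upwards [hW u hu huv] with x hx
      simp only [iteratedDeriv_zero]
      exact taylorQuot_recurrence h j hx.2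
    have h1 := ((hsub u).mul (hd 0 (j + 1) hi u hu huv)).add
      ((hd 0 j hi u hu huv).const_mul (j + 1 : ℝ))
    have h2 := h1.unique ((hasDerivAt_const u _).congr_of_eventuallyEq hev)
    simp only [Nat.cast_zero]
    linarith
  | succ i ih =>
    have hev : (fun x => (v - x) * iteratedDeriv (i + 1) (fun u' => taylorQuot h (j + 1) u' v) x) =ᶠ[𝓝 u]
        fun x => (i + 1) * iteratedDeriv i (fun u' => taylorQuot h (j + 1) u' v) x -
        (j + 1) * iteratedDeriv (i + 1) (fun u' => taylorQuot h j u' v) x := by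
      filter_upwards [hW u hu huv] with x hx
      exact ih (by omega) hx.1 hx.2
    have h1 := (hsub u).mul (hd (i + 1) (j + 1) hi u hu huv)
    have h2 := ((hd i (j + 1) (by omega) u hu huv).const_mul (i + 1 : ℝ)).sub
      ((hd (i + 1) j hi u hu huv).const_mul (j + 1 : ℝ))
    have h3 := h1.unique (h2.congr_of_eventuallyEq hev)
    push_cast
    linarith

/-- The same for (v - u) M = h(v) - h(u), where the right side does depend on u. -/
theorem iteratedDeriv_taylorQuot_zero_recurrence (hf : ContDiffOn ℝ K h I) (hI : IsOpen I)
    {i : ℕ} (hi : i < K) {u v : ℝ} (hu : u ∈ I) (huv : u ≠ v) :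
    (v - u) * iteratedDeriv (i + 1) (fun u' => taylorQuot h 0 u' v) u =
      (i + 1) * iteratedDeriv i (fun u' => taylorQuot h 0 u' v) u - iteratedDeriv (i + 1) h u := by
  have hsub : ∀ u : ℝ, HasDerivAt (fun u => v - u) (-1) u := fun u => by
    simpa using (hasDerivAt_id u).const_sub v
  have hd : ∀ i j, i < K → ∀ u ∈ I, u ≠ v →
      HasDerivAt (iteratedDeriv i fun u' => taylorQuot h j u' v)
        (iteratedDeriv (i + 1) (fun u' => taylorQuot h j u' v) u) u :=
    fun i j hi u hu huv => hasDerivAt_iteratedDeriv_taylorQuot hf hI hi hu huv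
  have hW : ∀ u ∈ I, u ≠ v → ∀ᶠ x in 𝓝 u, x ∈ I ∧ x ≠ v := fun u hu huv =>
    (hI.eventually_mem hu).and (isOpen_ne.eventually_mem huv)
  induction i generalizing u with
  | zero =>
    have hev : (fun x => (v - x) * iteratedDeriv 0 (fun u' => taylorQuot h 0 u' v) x) =ᶠ[𝓝 u]
        fun x => h v - iteratedDeriv 0 h x := by
      filter_upwards [hW u hu huv] with x hx
      simp only [iteratedDeriv_zero, taylorQuot_zero, diffQuot]
      rw [mul_div_cancel₀ _ (sub_ne_zero.2 hx.2.symm)]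
    have h1 := (hsub u).mul (hd 0 0 hi u hu huv)
    have h2 := h1.unique (((hf.hasDerivAt_iteratedDeriv hI hi hu).const_sub
      (h v)).congr_of_eventuallyEq hev)
    simp only [Nat.cast_zero]
    linarith
  | succ i ih =>
    have hev : (fun x => (v - x) * iteratedDeriv (i + 1) (fun u' => taylorQuot h 0 u' v) x) =ᶠ[𝓝 u]
        fun x => (i + 1) * iteratedDeriv i (fun u' => taylorQuot h 0 u' v) x -
        iteratedDeriv (i + 1) h x := by
      filter_upwards [hW u hu huv] with x hx
      exact ih (by omega) hx.1 hx.2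
    have h1 := (hsub u).mul (hd (i + 1) 0 hi u hu huv)
    have h2 := ((hd i 0 (by omega) u hu huv).const_mul (i + 1 : ℝ)).sub
      (hf.hasDerivAt_iteratedDeriv hI hi hu)
    have h3 := h1.unique (h2.congr_of_eventuallyEq hev)
    push_cast
    linarith

/-- Translating u and v together turns M into the quotient of the translated h, so M' = ∂M/∂u +
∂M/∂v; then differentiate j times in v. -/
theorem taylorQuot_deriv (hf : ContDiffOn ℝ K h I) (hI : IsOpen I) {j : ℕ} (hK : 0 < K)
    {u v : ℝ} (hu : u ∈ I) (huv : u ≠ v) :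
    taylorQuot (deriv h) j u v =
      deriv (fun u' => taylorQuot h j u' v) u + taylorQuot h (j + 1) u v := by
  have h0 : u - v ≠ 0 := sub_ne_zero.2 huv
  have hsub : HasDerivAt (fun u => u - v) 1 u := by
    simpa using (hasDerivAt_id u).sub_const v
  have hdh : HasDerivAt h (deriv h u) u := by
    simpa using hf.hasDerivAt_iteratedDeriv hI hK hu
  have hsum : ∀ n, HasDerivAt
      (fun u => ∑ i ∈ Finset.range (n + 1), iteratedDeriv i h v * (u - v) ^ i / i.factorial)
      (∑ i ∈ Finset.range n, iteratedDeriv i (deriv h) v * (u - v) ^ i / i.factorial) u := by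
    intro n
    induction n with
    | zero => simpa using hasDerivAt_const u (iteratedDeriv 0 h v)
    | succ n ih =>
      have h2 := ((hsub.pow (n + 1)).const_mul (iteratedDeriv (n + 1) h v)).div_const
        ((n + 1).factorial : ℝ)
      have h3 := ih.add h2
      simp_rw [Finset.sum_range_succ _ (n + 1)]
      convert! h3 using 1
      rw [Finset.sum_range_succ, iteratedDeriv_succ', Nat.factorial_succ]
      have hn0 : (n.factorial : ℝ) ≠ 0 := by positivity
      have hn1 : (n + 1 : ℝ) ≠ 0 := by positivity
      push_cast
      field_simp
  have hd := (((hdh.sub (hsum j)).const_mul (j.factorial : ℝ))).div (hsub.pow (j + 1))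
    (pow_ne_zero _ h0)
  have hd' : deriv (fun u' => taylorQuot h j u' v) u = _ := hd.deriv
  rw [hd']
  simp only [taylorQuot]
  rw [Finset.sum_range_succ _ j, Finset.sum_range_succ _ (j + 1), Nat.factorial_succ,
    ← iteratedDeriv_succ']
  simp only [Pi.sub_apply, Pi.pow_apply, Nat.add_sub_cancel]
  generalize ∑ i ∈ Finset.range (j + 1), iteratedDeriv i h v * (u - v) ^ i / (i.factorial : ℝ) = S
  generalize ∑ i ∈ Finset.range j, iteratedDeriv i (deriv h) v * (u - v) ^ i / (i.factorial : ℝ) = T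
  have hn0 : (j.factorial : ℝ) ≠ 0 := by positivity
  have hn1 : (j + 1 : ℝ) ≠ 0 := by positivity
  generalize u - v = w at h0
  push_cast
  field_simp
  ring

theorem contDiffOn_deriv_of_isOpen (hf : ContDiffOn ℝ (K + 1 : ℕ) h I) (hI : IsOpen I) :
    ContDiffOn ℝ K (deriv h) I :=
  ((contDiffOn_succ_iff_deriv_of_isOpen (n := K) hI).1 (by exact_mod_cast hf)).2.2

theorem diffQuotDeriv_deriv (hf : ContDiffOn ℝ (K + 1 : ℕ) h I) (hI : IsOpen I) {i j : ℕ}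
    (hi : i ≤ K) (hj : j ≤ K) {u v : ℝ} (hu : u ∈ I) (hv : v ∈ I) (huv : u ≠ v) :
    diffQuotDeriv (deriv h) i j u v =
      diffQuotDeriv h (i + 1) j u v + diffQuotDeriv h i (j + 1) u v := by
  have hWo := isOpen_diff_singleton hI v
  have huW : u ∈ I \ {v} := ⟨hu, huv⟩
  rw [diffQuotDeriv_eq (contDiffOn_deriv_of_isOpen hf hI) hI hj hv huv,
    diffQuotDeriv_eq hf hI (by omega) hv huv, diffQuotDeriv_eq hf hI (by omega) hv huv,
    iteratedDeriv_succ']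
  have h1 := contDiffOn_deriv_of_isOpen (contDiffOn_taylorQuot hf j v) hWo
  have h2 := (contDiffOn_taylorQuot hf (j + 1) v)
  have hK : ((i : ℕ) : WithTop ℕ∞) ≤ (K : ℕ) := by exact_mod_cast hi
  have hK' : ((i : ℕ) : WithTop ℕ∞) ≤ (K + 1 : ℕ) := by exact_mod_cast hi.trans (Nat.le_succ K)
  rw [← iteratedDeriv_add ((h1.contDiffAt (hWo.mem_nhds huW)).of_le hK)
    ((h2.contDiffAt (hWo.mem_nhds huW)).of_le hK')]
  refine Filter.EventuallyEq.iteratedDeriv_eq i ?_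
  filter_upwards [hWo.mem_nhds huW] with x hx
  exact taylorQuot_deriv hf hI (Nat.succ_pos K) hx.1 hx.2

/-- The relation between the regression functions for two adjacent conditioning records. -/
theorem mul_diffQuotDeriv_deriv (hf : ContDiffOn ℝ (K + 1 : ℕ) h I) (hI : IsOpen I) {i j : ℕ}
    (hi : i ≤ K) (hj : j ≤ K) {u v : ℝ} (hu : u ∈ I) (hv : v ∈ I) (huv : u ≠ v) :
    (j + 1) * diffQuotDeriv (deriv h) i j u v =
      (i + j + 2) * diffQuotDeriv h i (j + 1) u v -
        (v - u) * diffQuotDeriv h (i + 1) (j + 1) u v := by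
  rw [diffQuotDeriv_deriv hf hI hi hj hu hv huv]
  have h1 := iteratedDeriv_taylorQuot_succ_recurrence hf hI (i := i) (j := j) (by omega) hu huv
  rw [← diffQuotDeriv_eq hf hI (by omega) hv huv, ← diffQuotDeriv_eq hf hI (by omega) hv huv,
    ← diffQuotDeriv_eq hf hI (by omega) hv huv] at h1
  linarith

/-- The integral form of the derivatives of the difference quotient. -/
theorem integral_iteratedDeriv_mul_pow (hf : ContDiffOn ℝ K h I) (hI : IsOpen I)
    {u v : ℝ} (huv : u < v) (hsub : Icc u v ⊆ I) {i j : ℕ} (hij : i + j + 1 ≤ K) :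
    ∫ t in u..v, iteratedDeriv (i + j + 1) h t * ((t - u) ^ j * (v - t) ^ i) =
      (v - u) ^ (i + j + 1) * diffQuotDeriv h i j u v := by
  have hu : u ∈ I := hsub ⟨le_rfl, huv.le⟩
  have hv : v ∈ I := hsub ⟨huv.le, le_rfl⟩
  have huI : uIcc u v ⊆ I := by rwa [uIcc_of_le huv.le]
  have hint : ∀ {m : ℕ} {φ : ℝ → ℝ}, m ≤ K → Continuous φ →
      IntervalIntegrable (fun t => iteratedDeriv m h t * φ t) volume u v := fun hm hφ =>
    (((hf.continuousOn_iteratedDeriv_of_isOpen hI hm).mono huI).mul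
      hφ.continuousOn).intervalIntegrable
  have hparts : ∀ {m : ℕ} {φ φ' : ℝ → ℝ}, m < K → (∀ t, HasDerivAt φ (φ' t) t) → Continuous φ' →
      ∫ t in u..v, iteratedDeriv (m + 1) h t * φ t =
        iteratedDeriv m h v * φ v - iteratedDeriv m h u * φ u -
          ∫ t in u..v, iteratedDeriv m h t * φ' t := by
    intro m φ φ' hm hφ hφ'
    have h1 := intervalIntegral.integral_mul_deriv_eq_deriv_mul (a := u) (b := v)
      (u := φ) (v := iteratedDeriv m h) (u' := φ') (v' := iteratedDeriv (m + 1) h)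
      (fun t _ => hφ t) (fun t ht => hf.hasDerivAt_iteratedDeriv hI hm (huI ht))
      (hφ'.intervalIntegrable _ _)
      ((hf.continuousOn_iteratedDeriv_of_isOpen hI hm).mono huI).intervalIntegrable
    simp only [mul_comm (iteratedDeriv _ _ _)]
    exact h1
  have hd1 : ∀ (n : ℕ) (t : ℝ), HasDerivAt (fun t => (t - u) ^ (n + 1)) ((n + 1) * (t - u) ^ n) t := by
    intro n t
    have := ((hasDerivAt_id t).sub_const u).pow (n + 1)
    convert! this using 1
    simp
  have hd2 : ∀ (n : ℕ) (t : ℝ),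
      HasDerivAt (fun t => (v - t) ^ (n + 1)) (-((n + 1) * (v - t) ^ n)) t := by
    intro n t
    have := ((hasDerivAt_id t).const_sub v).pow (n + 1)
    convert! this using 1
    simp
  have hne := huv.ne
  -- Integration by parts gives the left side the recurrence that Leibniz gives the right side. The
  -- boundary term at v survives only for i = 0 and the one at u only for j = 0, hence the four
  -- cases.
  induction hn : i + j generalizing i j with
  | zero =>
    obtain ⟨rfl, rfl⟩ : i = 0 ∧ j = 0 := by omega
    simp only [pow_zero, mul_one, zero_add, pow_one]
    have h1 := intervalIntegral.integral_eq_sub_of_hasDerivAt (a := u) (b := v)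
      (f := iteratedDeriv 0 h) (f' := iteratedDeriv 1 h)
      (fun t ht => hf.hasDerivAt_iteratedDeriv hI (by omega) (huI ht))
      ((hf.continuousOn_iteratedDeriv_of_isOpen hI (by omega)).mono huI).intervalIntegrable
    rw [h1]
    simp only [iteratedDeriv_zero, diffQuotDeriv, diffQuot]
    rw [mul_div_cancel₀ _ (sub_ne_zero.2 hne.symm)]
  | succ n ih =>
    rcases i with _ | i <;> rcases j with _ | j
    · omega
    · obtain rfl : n = j := by omega
      have h1 := ih (i := 0) (j := n) (by omega) (by omega)
      rw [diffQuotDeriv_eq hf hI (by omega) hv hne] at h1 ⊢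
      have h2 := taylorQuot_recurrence h n hne
      simp only [pow_zero, mul_one, iteratedDeriv_zero] at h1 ⊢
      rw [hparts (by omega) (hd1 n) (by fun_prop)]
      have h3 : ∫ t in u..v, iteratedDeriv (n + 1) h t * ((n + 1) * (t - u) ^ n) =
          (n + 1) * ∫ t in u..v, iteratedDeriv (n + 1) h t * (t - u) ^ n := by
        rw [← intervalIntegral.integral_const_mul]
        exact intervalIntegral.integral_congr fun t _ => by ring
      rw [h3, h1, ← h2]
      simp
      ring
    · obtain rfl : n = i := by omega
      have h1 := ih (i := n) (j := 0) (by omega) (by omega)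
      rw [diffQuotDeriv_eq hf hI (by omega) hv hne] at h1 ⊢
      have h2 := iteratedDeriv_taylorQuot_zero_recurrence hf hI (i := n) (by omega) hu hne
      simp only [pow_zero, one_mul] at h1 ⊢
      rw [hparts (by omega) (hd2 n) (by fun_prop)]
      have h3 : ∫ t in u..v, iteratedDeriv (n + 1) h t * (-((n + 1) * (v - t) ^ n)) =
          -((n + 1) * ∫ t in u..v, iteratedDeriv (n + 1) h t * (v - t) ^ n) := by
        rw [← intervalIntegral.integral_const_mul, ← intervalIntegral.integral_neg]
        exact intervalIntegral.integral_congr fun t _ => by ring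
      rw [h3, h1]
      simp only [sub_self, ne_eq, Nat.add_eq_zero_iff, one_ne_zero, and_false, not_false_eq_true,
        zero_pow, mul_zero]
      linear_combination -(v - u) ^ (n + 1) * h2
    · have h1 := ih (i := i) (j := j + 1) (by omega) (by omega)
      have h1' := ih (i := i + 1) (j := j) (by omega) (by omega)
      rw [diffQuotDeriv_eq hf hI (by omega) hv hne] at h1 h1' ⊢
      have h2 := iteratedDeriv_taylorQuot_succ_recurrence hf hI (i := i) (j := j) (by omega) hu hne
      have hφ : ∀ t, HasDerivAt (fun t => (t - u) ^ (j + 1) * (v - t) ^ (i + 1))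
          ((j + 1) * (t - u) ^ j * (v - t) ^ (i + 1) +
            (t - u) ^ (j + 1) * (-((i + 1) * (v - t) ^ i))) t := fun t =>
        (hd1 j t).mul (hd2 i t)
      obtain rfl : n = i + j + 1 := by omega
      rw [hparts (by omega) hφ (by fun_prop)]
      have h3 : ∫ t in u..v, iteratedDeriv (i + j + 1 + 1) h t *
          ((j + 1) * (t - u) ^ j * (v - t) ^ (i + 1) +
            (t - u) ^ (j + 1) * (-((i + 1) * (v - t) ^ i))) =
          (j + 1) * (∫ t in u..v, iteratedDeriv (i + j + 1 + 1) h t *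
            ((t - u) ^ j * (v - t) ^ (i + 1))) -
          (i + 1) * ∫ t in u..v, iteratedDeriv (i + j + 1 + 1) h t *
            ((t - u) ^ (j + 1) * (v - t) ^ i) := by
        rw [← intervalIntegral.integral_const_mul, ← intervalIntegral.integral_const_mul,
          ← intervalIntegral.integral_sub]
        · exact intervalIntegral.integral_congr fun t _ => by ring
        · exact (hint (by omega) (by fun_prop)).const_mul _
        · exact (hint (by omega) (by fun_prop)).const_mul _
      rw [h3, h1, h1']
      simp only [sub_self, ne_eq, Nat.add_eq_zero_iff, one_ne_zero, and_false, not_false_eq_true,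
        zero_pow, mul_zero, zero_mul]
      linear_combination -(v - u) ^ (i + j + 1 + 1) * h2

end Recurrences

end DividedDifferences

/-! ### Regression identities as integral equations for the hazard measure. -/

section Regression

open Set

variable {μ : Measure ℝ} [IsProbabilityMeasure μ] [NullSingletonClass μ]

theorem continuousOn_hazard {a b : ℝ} (hb : cdf μ b < 1) : ContinuousOn (hazard μ) (Icc a b) :=
  fun _ ht => (continuousAt_hazard ((monotone_cdf μ ht.2).trans_lt hb)).continuousWithinAt

theorem hazardMeasure_real_Ioc {a b : ℝ} (hab : a ≤ b) (hb : cdf μ b < 1) :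
    (hazardMeasure μ).real (Ioc a b) = hazard μ b - hazard μ a := by
  rw [measureReal_def, hazardMeasure_Ioc hab hb, ENNReal.toReal_ofReal]
  linarith [hazard_le hab hb]

/-- No strict inequality R(u) < R(v) is required: when they are equal, both sides are 0 by the
conventions for division. -/
theorem integral_bridgeKernel (i j : ℕ) {u v : ℝ} (hv : cdf μ v < 1) (g : ℝ → ℝ) :
    ∫ t, g t ∂(bridgeKernel μ i j (u, v)) = ((i + j + 1).factorial / (i.factorial * j.factorial)) *
      ((∫ t in Ioo u v, g t * ((hazard μ t - hazard μ u) ^ i * (hazard μ v - hazard μ t) ^ j)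
        ∂(hazardMeasure μ)) / (hazard μ v - hazard μ u) ^ (i + j + 1)) := by
  have hR := measurable_hazard (μ := μ)
  rw [bridgeKernel_apply i j hv, integral_withDensity_eq_integral_toReal_smul]
  · rw [← integral_div, ← integral_const_mul]
    refine setIntegral_congr_fun measurableSet_Ioo fun t ht => ?_
    have h1 := hazard_le ht.2.le hv
    have h2 := hazard_le ht.1.le ((monotone_cdf μ ht.2.le).trans_lt hv)
    have h3 : 0 ≤ hazard μ t - hazard μ u := by linarith
    have h4 : 0 ≤ hazard μ v - hazard μ t := by linarith
    have h5 : 0 ≤ hazard μ v - hazard μ u := by linarith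
    simp only [smul_eq_mul]
    rw [ENNReal.toReal_ofReal (by positivity), inv_div]
    simp only [div_eq_mul_inv, mul_inv]
    ring
  · exact ((((hR.sub measurable_const).pow_const i).div_const _).mul
      (((measurable_const.sub hR).pow_const j).div_const _)).mul_const _ |>.ennreal_ofReal
  · exact Eventually.of_forall fun t => ENNReal.ofReal_lt_top

theorem integrable_bridgeKernel (i j : ℕ) {u v : ℝ} (hv : cdf μ v < 1) {g : ℝ → ℝ}
    (hg : ContinuousOn g (Icc u v)) : Integrable g (bridgeKernel μ i j (u, v)) := by
  have hR := measurable_hazard (μ := μ)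
  have hRc := continuousOn_hazard (μ := μ) (a := u) hv
  rw [bridgeKernel_apply i j hv, integrable_withDensity_iff_integrable_smul']
  · have hc : ContinuousOn (fun t => (((hazard μ t - hazard μ u) ^ i / i.factorial *
        ((hazard μ v - hazard μ t) ^ j / j.factorial)) *
        ((hazard μ v - hazard μ u) ^ (i + j + 1) / (i + j + 1).factorial)⁻¹) * g t) (Icc u v) := by
      fun_prop
    have hi := (integrableOn_Icc_of_continuousOn (hazardMeasure_Icc_lt_top (μ := μ) hv) hc).mono_set
      (Ioo_subset_Icc_self)
    refine hi.congr_fun (fun t ht => ?_) measurableSet_Ioo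
    have h1 := hazard_le ht.2.le hv
    have h2 := hazard_le ht.1.le ((monotone_cdf μ ht.2.le).trans_lt hv)
    have h3 : 0 ≤ hazard μ t - hazard μ u := by linarith
    have h4 : 0 ≤ hazard μ v - hazard μ t := by linarith
    have h5 : 0 ≤ hazard μ v - hazard μ u := by linarith
    simp only [smul_eq_mul]
    rw [ENNReal.toReal_ofReal (by positivity)]
  · exact ((((hR.sub measurable_const).pow_const i).div_const _).mul
      (((measurable_const.sub hR).pow_const j).div_const _)).mul_const _ |>.ennreal_ofReal
  · exact Eventually.of_forall fun t => ENNReal.ofReal_lt_top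

variable {Ω : Type*} [MeasurableSpace Ω] {P : Measure Ω} [IsProbabilityMeasure P] {X : ℕ → Ω → ℝ}

/-- The regression identity for records as an integral equation with respect to the hazard
measure. -/
theorem ae_of_regressionEq (hμ : μ = P.map (X 0)) (hX : ∀ i, Measurable (X i))
    (hindep : iIndepFun X P) (hident : ∀ i, IdentDistrib (X i) (X 0) P P) (m i j : ℕ) {I : Set ℝ}
    (hI : ∀ v ∈ I, cdf μ v < 1) {g : ℝ → ℝ} {φ : ℝ → ℝ → ℝ}
    (h : RegressionEq P I g (recordValue X (m + i + 1)) (recordValue X m)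
      (recordValue X (m + i + 1 + j + 1))
      fun u v => ((i + j + 1).factorial / (i.factorial * j.factorial)) * φ u v) :
    ∀ᵐ p ∂(μ.prod μ), p.1 < p.2 → p.1 ∈ I → p.2 ∈ I →
      ∫ t in Ioo p.1 p.2, g t * ((hazard μ t - hazard μ p.1) ^ i * (hazard μ p.2 - hazard μ t) ^ j)
        ∂(hazardMeasure μ) = (hazard μ p.2 - hazard μ p.1) ^ (i + j + 1) * φ p.1 p.2 := by
  have hcd := condDistrib_recordValue hμ hX hindep hident m i j
  have h' : ∀ᵐ p ∂(P.map (fun ω => (recordValue X m ω, recordValue X (m + i + 1 + j + 1) ω))),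
      p.1 < p.2 → p.1 ∈ I → p.2 ∈ I → ∫ t, g t ∂(bridgeKernel μ i j p) =
        ((i + j + 1).factorial / (i.factorial * j.factorial)) * φ p.1 p.2 := by
    filter_upwards [h, hcd] with p hp hc h1 h2 h3
    rw [← hc]
    exact (hp h2 h3 h1).2
  rw [show m + i + 1 + j + 1 = m + (i + j + 1) + 1 by ring] at h'
  filter_upwards [ae_prod_of_ae_map hμ hX hindep hident m (i + j + 1) h'] with p hp h1 h2 h3
  have hv := hI _ h3
  have hp' := hp h1 h1 h2 h3
  rw [integral_bridgeKernel i j hv] at hp'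
  have hC : ((i + j + 1).factorial / (i.factorial * j.factorial) : ℝ) ≠ 0 := by positivity
  have hp'' := mul_left_cancel₀ hC hp'
  rcases (hazard_le h1.le hv).lt_or_eq with hlt | heq
  · have : (hazard μ p.2 - hazard μ p.1) ^ (i + j + 1) ≠ 0 :=
      pow_ne_zero _ (sub_ne_zero.2 hlt.ne')
    rw [div_eq_iff this] at hp''
    rw [hp'', mul_comm]
  -- If F is flat on [u, v], both sides vanish and the equation says nothing about φ.
  · have hnull : hazardMeasure μ (Ioo p.1 p.2) = 0 := by
      refine measure_mono_null Ioo_subset_Ioc_self ?_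
      rw [hazardMeasure_Ioc h1.le hv, heq, sub_self, ENNReal.ofReal_zero]
    rw [setIntegral_measure_zero _ hnull, heq, sub_self, zero_pow (by omega), zero_mul]

theorem regressionEq_of_forall (hμ : μ = P.map (X 0)) (hX : ∀ i, Measurable (X i))
    (hindep : iIndepFun X P) (hident : ∀ i, IdentDistrib (X i) (X 0) P P) (m i j : ℕ) {I : Set ℝ}
    (hI : ∀ v ∈ I, cdf μ v < 1) {g : ℝ → ℝ} {φ : ℝ → ℝ → ℝ}
    (h : ∀ u ∈ I, ∀ v ∈ I, u < v → hazard μ u < hazard μ v ∧ ContinuousOn g (Icc u v) ∧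
      ∫ t in Ioo u v, g t * ((hazard μ t - hazard μ u) ^ i * (hazard μ v - hazard μ t) ^ j)
        ∂(hazardMeasure μ) = (hazard μ v - hazard μ u) ^ (i + j + 1) * φ u v) :
    RegressionEq P I g (recordValue X (m + i + 1)) (recordValue X m)
      (recordValue X (m + i + 1 + j + 1))
      fun u v => ((i + j + 1).factorial / (i.factorial * j.factorial)) * φ u v := by
  filter_upwards [condDistrib_recordValue hμ hX hindep hident m i j] with p hp h1 h2 h3
  obtain ⟨hlt, hc, heq⟩ := h _ h1 _ h2 h3
  rw [hp]
  refine ⟨integrable_bridgeKernel i j (hI _ h2) hc, ?_⟩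
  have := integral_bridgeKernel (μ := μ) i j (u := p.1) (hI _ h2) g
  refine this.trans ?_
  have hne : (hazard μ p.2 - hazard μ p.1) ^ (i + j + 1) ≠ 0 :=
    pow_ne_zero _ (sub_ne_zero.2 hlt.ne')
  rw [heq, mul_div_cancel_left₀ _ hne]

end Regression

/-! ### The range of F, the filter at its left end, and the exponential case. -/

section Range

open Set

theorem tendsto_id_rightOf (l : ℝ) : Tendsto (fun u : ℝ => u) (rightOf l) (𝓝 l) := by
  rw [rightOf, EReal.isEmbedding_coe.nhds_eq_comap]
  exact comap_mono nhdsWithin_le_nhds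

theorem hazard_of_isExponentialType {μ : Measure ℝ} (h : IsExponentialType (cdf μ)) :
    ∃ l c : ℝ, 0 < c ∧ ∀ t ∈ openRange (cdf μ), hazard μ t = c * (t - l) := by
  obtain ⟨l, c, hc, hl, -, hF⟩ := h
  refine ⟨l, c, hc, fun t ht => ?_⟩
  have hlt : l < t := EReal.coe_lt_coe_iff.1 (hl ▸ ht.1)
  rw [hazard, hF t hlt.le, sub_sub_cancel, Real.log_exp]
  ring

variable {μ : Measure ℝ} [IsProbabilityMeasure μ] [NullSingletonClass μ]

theorem leftExtremity_lt_iff {x : ℝ} : leftExtremity (cdf μ) < x ↔ 0 < cdf μ x := by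
  constructor
  · intro h
    obtain ⟨y, ⟨z, hz, rfl⟩, hy⟩ := sInf_lt_iff.1 h
    exact lt_of_lt_of_le hz (monotone_cdf μ (EReal.coe_lt_coe_iff.1 hy).le)
  · intro h
    obtain ⟨y, hy, hyx⟩ := ((((continuous_cdf μ).continuousAt (x := x)).eventually
      (lt_mem_nhds h)).filter_mono nhdsWithin_le_nhds |>.and
      (self_mem_nhdsWithin (s := Iio x))).exists
    exact (sInf_le (mem_image_of_mem (fun x : ℝ => (x : EReal))
      (show y ∈ {x | 0 < cdf μ x} from hy))).trans_lt (EReal.coe_lt_coe_iff.2 hyx)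

theorem lt_rightExtremity_iff {x : ℝ} : (x : EReal) < rightExtremity (cdf μ) ↔ cdf μ x < 1 := by
  constructor
  · intro h
    obtain ⟨y, ⟨z, hz, rfl⟩, hy⟩ := lt_sSup_iff.1 h
    exact lt_of_le_of_lt (monotone_cdf μ (EReal.coe_lt_coe_iff.1 hy).le) hz
  · intro h
    obtain ⟨y, hy, hyx⟩ := ((((continuous_cdf μ).continuousAt (x := x)).eventually
      (gt_mem_nhds h)).filter_mono nhdsWithin_le_nhds |>.and
      (self_mem_nhdsWithin (s := Ioi x))).exists
    exact (EReal.coe_lt_coe_iff.2 hyx).trans_le (le_sSup (mem_image_of_mem (fun x : ℝ => (x : EReal))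
      (show y ∈ {x | cdf μ x < 1} from hy)))

theorem mem_openRange_iff {x : ℝ} : x ∈ openRange (cdf μ) ↔ 0 < cdf μ x ∧ cdf μ x < 1 :=
  and_congr leftExtremity_lt_iff lt_rightExtremity_iff

theorem isOpen_openRange : IsOpen (openRange (cdf μ)) := by
  have : openRange (cdf μ) = cdf μ ⁻¹' Ioo 0 1 := by
    ext x
    exact mem_openRange_iff
  rw [this]
  exact isOpen_Ioo.preimage (continuous_cdf μ)

theorem Icc_subset_openRange {u v : ℝ} (hu : u ∈ openRange (cdf μ)) (hv : v ∈ openRange (cdf μ)) :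
    Icc u v ⊆ openRange (cdf μ) := by
  intro x hx
  rw [mem_openRange_iff] at hu hv ⊢
  exact ⟨hu.1.trans_le (monotone_cdf μ hx.1), (monotone_cdf μ hx.2).trans_lt hv.2⟩

theorem ae_mem_openRange : ∀ᵐ x ∂μ, x ∈ openRange (cdf μ) := by
  filter_upwards [ae_cdf_pos μ, ae_cdf_lt_one μ] with x h1 h2 using mem_openRange_iff.2 ⟨h1, h2⟩

theorem exists_cdf_eq {s : ℝ} (h0 : 0 < s) (h1 : s < 1) : ∃ x, cdf μ x = s := by
  obtain ⟨a, ha⟩ := ((tendsto_cdf_atBot μ).eventually (gt_mem_nhds h0)).exists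
  obtain ⟨b, hb⟩ := ((tendsto_cdf_atTop μ).eventually (lt_mem_nhds h1)).exists
  exact mem_range_of_exists_le_of_exists_ge (continuous_cdf μ) ⟨a, ha.le⟩ ⟨b, hb.le⟩

/-- Full-measure sets need not be dense, since F may be flat; but (-∞, x) has mass F(x) > 0 and must
meet them. -/
theorem exists_lt_mem_of_ae {S : Set ℝ} (hS : ∀ᵐ x ∂μ, x ∈ S) {x : ℝ} (hx : 0 < cdf μ x) :
    ∃ u < x, u ∈ openRange (cdf μ) ∧ u ∈ S := by
  have hIio : μ (Iio x) ≠ 0 := by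
    rw [measure_congr (Iio_ae_eq_Iic (μ := μ)), ← ofReal_cdf]
    exact (ENNReal.ofReal_pos.2 hx).ne'
  obtain ⟨u, ⟨h1, h2⟩, h3⟩ := ((ae_mem_openRange.and hS).and_frequently
    (frequently_ae_mem_iff.2 hIio)).exists
  exact ⟨u, h3, h1, h2⟩

theorem exists_gt_mem_of_ae {S : Set ℝ} (hS : ∀ᵐ x ∂μ, x ∈ S) {x : ℝ} (hx : cdf μ x < 1) :
    ∃ u, x < u ∧ u ∈ openRange (cdf μ) ∧ u ∈ S := by
  have hIoi : μ (Ioi x) ≠ 0 := by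
    rw [measure_Ioi_eq_ofReal]
    exact (ENNReal.ofReal_pos.2 (by linarith)).ne'
  obtain ⟨u, ⟨h1, h2⟩, h3⟩ := ((ae_mem_openRange.and hS).and_frequently
    (frequently_ae_mem_iff.2 hIoi)).exists
  exact ⟨u, h3, h1, h2⟩

/-- A description by F alone treats finite and infinite left extremities at once. -/
theorem eventually_rightOf_iff {p : ℝ → Prop} :
    (∀ᶠ u in rightOf (leftExtremity (cdf μ)), p u) ↔
      ∃ x ∈ openRange (cdf μ), ∀ u, 0 < cdf μ u → u < x → p u := by
  obtain ⟨x0, hx0⟩ := exists_cdf_eq (μ := μ) (s := 1 / 2) (by norm_num) (by norm_num)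
  have hl : leftExtremity (cdf μ) < (x0 : EReal) := leftExtremity_lt_iff.2 (by rw [hx0]; norm_num)
  rw [rightOf, (nhdsGT_basis_of_exists_gt ⟨_, hl⟩).comap _ |>.eventually_iff]
  constructor
  · rintro ⟨b, hb, h⟩
    obtain ⟨x, hx1, hx2⟩ := EReal.lt_iff_exists_real_btwn.1 (lt_min hb hl)
    refine ⟨x, mem_openRange_iff.2 ⟨leftExtremity_lt_iff.1 hx1, ?_⟩, fun u hu hux => ?_⟩
    · have := EReal.coe_lt_coe_iff.1 (hx2.trans_le (min_le_right _ _))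
      exact (monotone_cdf μ this.le).trans_lt (by rw [hx0]; norm_num)
    · exact h ⟨leftExtremity_lt_iff.2 hu,
        (EReal.coe_lt_coe_iff.2 hux).trans (hx2.trans_le (min_le_left _ _))⟩
  · rintro ⟨x, hx, h⟩
    exact ⟨x, leftExtremity_lt_iff.2 (mem_openRange_iff.1 hx).1,
      fun u hu => h u (leftExtremity_lt_iff.1 hu.1) (EReal.coe_lt_coe_iff.1 hu.2)⟩

instance : (rightOf (leftExtremity (cdf μ))).NeBot := by
  rw [neBot_iff]
  intro h
  have : ∀ᶠ _ in rightOf (leftExtremity (cdf μ)), False := by simp [h]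
  obtain ⟨x, hx, hu⟩ := eventually_rightOf_iff.1 this
  obtain ⟨u, hux, huI, -⟩ := exists_lt_mem_of_ae (μ := μ) (S := univ) (by simp)
    (mem_openRange_iff.1 hx).1
  exact hu u (mem_openRange_iff.1 huI).1 hux

theorem frequently_rightOf {S : Set ℝ} (hS : ∀ᵐ x ∂μ, x ∈ S) :
    ∃ᶠ u in rightOf (leftExtremity (cdf μ)), u ∈ S := by
  intro h
  obtain ⟨x, hx, hu⟩ := eventually_rightOf_iff.1 h
  obtain ⟨u, hux, huI, huS⟩ := exists_lt_mem_of_ae hS (mem_openRange_iff.1 hx).1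
  exact hu u (mem_openRange_iff.1 huI).1 hux huS

theorem eventually_rightOf_lt {v : ℝ} (hv : v ∈ openRange (cdf μ)) :
    ∀ᶠ u in rightOf (leftExtremity (cdf μ)), u < v ∧ u ∈ openRange (cdf μ) :=
  eventually_rightOf_iff.2 ⟨v, hv, fun _ hu huv => ⟨huv, mem_openRange_iff.2
    ⟨hu, (monotone_cdf μ huv.le).trans_lt (mem_openRange_iff.1 hv).2⟩⟩⟩

theorem tendsto_cdf_rightOf : Tendsto (cdf μ) (rightOf (leftExtremity (cdf μ))) (𝓝 0) := by
  rw [tendsto_order]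
  refine ⟨fun a ha => Eventually.of_forall fun u => ha.trans_le (cdf_nonneg μ u), fun a ha => ?_⟩
  obtain ⟨x, hx⟩ := exists_cdf_eq (μ := μ) (s := min a 1 / 2) (by positivity)
    (by linarith [min_le_right a 1])
  have hx1 : x ∈ openRange (cdf μ) := mem_openRange_iff.2 ⟨by rw [hx]; positivity,
    by rw [hx]; linarith [min_le_right a 1]⟩
  refine eventually_rightOf_iff.2 ⟨x, hx1, fun u _ hux => ?_⟩
  refine (monotone_cdf μ hux.le).trans_lt ?_
  rw [hx]
  have : 0 < min a 1 := lt_min ha one_pos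
  linarith [min_le_left a 1]

theorem tendsto_hazard_rightOf : Tendsto (hazard μ) (rightOf (leftExtremity (cdf μ))) (𝓝 0) := by
  have h : ContinuousAt (fun s : ℝ => -Real.log (1 - s)) 0 :=
    ((continuousAt_const.sub continuousAt_id).log (by norm_num)).neg
  have h2 := h.tendsto.comp (tendsto_cdf_rightOf (μ := μ))
  simp only [sub_zero, Real.log_one, neg_zero] at h2
  exact h2

theorem tendsto_id_rightOf_bot (hl : leftExtremity (cdf μ) = ⊥) :
    Tendsto (fun u : ℝ => u) (rightOf (leftExtremity (cdf μ))) atBot := by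
  rw [tendsto_atBot]
  intro b
  have hb : 0 < cdf μ b := leftExtremity_lt_iff.1 (by rw [hl]; exact EReal.bot_lt_coe b)
  obtain ⟨u, hub, huI, -⟩ := exists_lt_mem_of_ae (μ := μ) (S := univ) (by simp) hb
  filter_upwards [eventually_rightOf_lt huI] with x hx using (hx.1.trans hub).le

theorem leftExtremity_ne_top : leftExtremity (cdf μ) ≠ ⊤ := by
  obtain ⟨x0, hx0⟩ := exists_cdf_eq (μ := μ) (s := 1 / 2) (by norm_num) (by norm_num)
  have hl : leftExtremity (cdf μ) < (x0 : EReal) := leftExtremity_lt_iff.2 (by rw [hx0]; norm_num)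
  exact (hl.trans_le le_top).ne

theorem isExponentialType_of_hazard {l c : ℝ} (hl : leftExtremity (cdf μ) = l) (hc : 0 < c)
    (h : ∀ t ∈ openRange (cdf μ), hazard μ t = c * (t - l)) : IsExponentialType (cdf μ) := by
  have hcdf : ∀ t ∈ openRange (cdf μ), cdf μ t = 1 - Real.exp (-c * (t - l)) := by
    intro t ht
    have h1 := (mem_openRange_iff.1 ht).2
    have h2 : Real.log (1 - cdf μ t) = -c * (t - l) := by
      have := h t ht
      rw [hazard] at this
      linarith
    rw [← h2, Real.exp_log (by linarith)]
    ring
  -- If F(x) = 1, continuity gives t < x in the open range with 1 - F(t) half of exp(-c(x - l)),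
  -- while the exponential formula at t makes 1 - F(t) at least exp(-c(x - l)).
  have hlt : ∀ x, cdf μ x < 1 := by
    by_contra! hcon
    obtain ⟨x, hx⟩ := hcon
    have hxl : l < x := EReal.coe_lt_coe_iff.1 (hl ▸ leftExtremity_lt_iff.2 (by linarith))
    have hq : 0 < Real.exp (-c * (x - l)) := Real.exp_pos _
    have hq1 : Real.exp (-c * (x - l)) < 1 := Real.exp_lt_one_iff.2 (by nlinarith)
    obtain ⟨t, ht⟩ := exists_cdf_eq (μ := μ) (s := 1 - Real.exp (-c * (x - l)) / 2) (by linarith)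
      (by linarith)
    have htI : t ∈ openRange (cdf μ) :=
      mem_openRange_iff.2 ⟨by rw [ht]; linarith, by rw [ht]; linarith⟩
    have htx : t < x := by
      by_contra! hxt
      have := monotone_cdf μ hxt
      rw [ht] at this
      linarith
    have h1 := hcdf t htI
    have h2 : Real.exp (-c * (x - l)) ≤ Real.exp (-c * (t - l)) :=
      Real.exp_le_exp.2 (by nlinarith)
    linarith
  refine ⟨l, c, hc, hl, ?_, fun x hx => ?_⟩
  · rw [EReal.eq_top_iff_forall_lt]
    exact fun y => lt_rightExtremity_iff.2 (hlt y)
  · rcases hx.lt_or_eq with hx | rfl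
    · exact hcdf x (mem_openRange_iff.2 ⟨leftExtremity_lt_iff.1
        (by rw [hl]; exact EReal.coe_lt_coe_iff.2 hx), hlt x⟩)
    · have : ¬ 0 < cdf μ l := fun h0 => absurd (leftExtremity_lt_iff.2 h0) (by rw [hl]; exact lt_irrefl _)
      simp only [sub_self, mul_zero, Real.exp_zero]
      linarith [cdf_nonneg μ l]

/-- If the cumulative hazard is affine, the hazard measure is a multiple of Lebesgue measure. -/
theorem setIntegral_hazardMeasure_of_affine {l c u v : ℝ} (hc : 0 < c) (huv : u < v)
    (hv : cdf μ v < 1) (hR : ∀ t ∈ Icc u v, hazard μ t = c * (t - l)) {G : ℝ → ℝ}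
    (hG : ContinuousOn G (Icc u v)) :
    ∫ t in Ioo u v, G t ∂(hazardMeasure μ) = c * ∫ t in u..v, G t := by
  have hRu := hR u ⟨le_rfl, huv.le⟩
  have hRv := hR v ⟨huv.le, le_rfl⟩
  have hmaps : MapsTo (fun w => w / c + l) (Ioc (hazard μ u) (hazard μ v)) (Icc u v) := by
    intro w hw
    rw [hRu, hRv] at hw
    have h1 : u - l ≤ w / c := (le_div_iff₀ hc).2 (by linarith [hw.1])
    have h2 : w / c ≤ v - l := (div_le_iff₀ hc).2 (by linarith [hw.2])
    exact ⟨by linarith, by linarith⟩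
  have h1 : ∫ t in Ioc u v, G (hazard μ t / c + l) ∂(hazardMeasure μ) =
      ∫ w in (hazard μ u)..(hazard μ v), G (w / c + l) := by
    rw [intervalIntegral.integral_of_le (hazard_le huv.le hv), ← map_hazard_restrict huv.le hv,
      integral_map measurable_hazard.aemeasurable]
    rw [map_hazard_restrict huv.le hv]
    exact (hG.comp (by fun_prop) hmaps).aestronglyMeasurable measurableSet_Ioc
  have h2 : ∫ t in Ioo u v, G t ∂(hazardMeasure μ) =
      ∫ t in Ioc u v, G (hazard μ t / c + l) ∂(hazardMeasure μ) := by
    rw [integral_Ioc_eq_integral_Ioo]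
    refine setIntegral_congr_fun measurableSet_Ioo fun t ht => ?_
    rw [hR t (Ioo_subset_Icc_self ht), mul_div_cancel_left₀ _ hc.ne', sub_add_cancel]
  rw [h2, h1, intervalIntegral.integral_comp_div_add _ hc.ne', hRu, hRv,
    mul_div_cancel_left₀ _ hc.ne', mul_div_cancel_left₀ _ hc.ne', sub_add_cancel, sub_add_cancel,
    smul_eq_mul]

/-- The integral equation holds when the cumulative hazard is affine. -/
theorem integral_eq_of_affine_hazard {l c : ℝ} (hc : 0 < c)
    (hR : ∀ t ∈ openRange (cdf μ), hazard μ t = c * (t - l)) {h : ℝ → ℝ} {K : ℕ}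
    (hf : ContDiffOn ℝ K h (openRange (cdf μ))) {i j : ℕ} (hij : j + i + 1 ≤ K) {u v : ℝ}
    (hu : u ∈ openRange (cdf μ)) (hv : v ∈ openRange (cdf μ)) (huv : u < v) :
    hazard μ u < hazard μ v ∧ ContinuousOn (iteratedDeriv (j + i + 1) h) (Icc u v) ∧
      ∫ t in Ioo u v, iteratedDeriv (j + i + 1) h t *
          ((hazard μ t - hazard μ u) ^ i * (hazard μ v - hazard μ t) ^ j) ∂(hazardMeasure μ) =
        (hazard μ v - hazard μ u) ^ (i + j + 1) * diffQuotDeriv h j i u v := by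
  have hsub := Icc_subset_openRange hu hv
  have hgc := (hf.continuousOn_iteratedDeriv_of_isOpen isOpen_openRange hij).mono hsub
  refine ⟨?_, hgc, ?_⟩
  · rw [hR u hu, hR v hv]
    exact mul_lt_mul_of_pos_left (by linarith) hc
  · have h1 : ∫ t in Ioo u v, iteratedDeriv (j + i + 1) h t *
          ((hazard μ t - hazard μ u) ^ i * (hazard μ v - hazard μ t) ^ j) ∂(hazardMeasure μ) =
        ∫ t in Ioo u v, c ^ (i + j) * (iteratedDeriv (j + i + 1) h t *
          ((t - u) ^ i * (v - t) ^ j)) ∂(hazardMeasure μ) := by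
      refine setIntegral_congr_fun measurableSet_Ioo fun t ht => ?_
      rw [hR u hu, hR v hv, hR t (hsub (Ioo_subset_Icc_self ht)), ← mul_sub, ← mul_sub, mul_pow,
        mul_pow]
      ring
    rw [h1, setIntegral_hazardMeasure_of_affine hc huv (mem_openRange_iff.1 hv).2
      (fun t ht => hR t (hsub ht)) (by fun_prop), intervalIntegral.integral_const_mul,
      integral_iteratedDeriv_mul_pow hf isOpen_openRange huv hsub hij, hR u hu, hR v hv, ← mul_sub,
      mul_pow]
    ring

end Range

/-! ### The case r = 1: letting the lower record tend to the left extremity. -/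

section OneSided

open Set

variable {μ : Measure ℝ} [IsProbabilityMeasure μ] [NullSingletonClass μ]

/-- Conditions that hold for almost all pairs hold along a sequence tending to the left extremity
and almost all second components. -/
theorem exists_seq_rightOf {Φ : ℝ × ℝ → Prop} (hΦ : ∀ᵐ p ∂(μ.prod μ), Φ p) :
    ∃ u : ℕ → ℝ, Tendsto u atTop (rightOf (leftExtremity (cdf μ))) ∧
      (∀ n, u n ∈ openRange (cdf μ)) ∧
      ∀ᵐ v ∂μ, v ∈ {v | v ∈ openRange (cdf μ) ∧ ∀ n, Φ (u n, v)} := by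
  have h1 := Measure.ae_ae_of_ae_prod hΦ
  have h2 : ∀ᵐ u ∂μ, u ∈ {u | u ∈ openRange (cdf μ) ∧ ∀ᵐ v ∂μ, Φ (u, v)} := by
    filter_upwards [h1, ae_mem_openRange] with u hu hI using ⟨hI, hu⟩
  have : (rightOf (leftExtremity (cdf μ))).IsCountablyGenerated := by
    unfold rightOf
    infer_instance
  -- Each u has its own null set of bad v; a sequence keeps their union null.
  obtain ⟨u, hu, hmem⟩ := exists_seq_forall_of_frequently (frequently_rightOf h2)
  refine ⟨u, hu, fun n => (hmem n).1, ?_⟩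
  filter_upwards [ae_mem_openRange, ae_all_iff.2 fun n => (hmem n).2] with v h1 h2 using ⟨h1, h2⟩

theorem tendsto_setIntegral_hazard_pow {u : ℕ → ℝ}
    (hu : Tendsto u atTop (rightOf (leftExtremity (cdf μ)))) {a w : ℝ}
    (ha : a ∈ openRange (cdf μ)) (hw : w ∈ openRange (cdf μ)) {g : ℝ → ℝ}
    (hg : ContinuousOn g (Icc a w)) (κ : ℕ) :
    Tendsto (fun n => ∫ t in Ioc a w, g t * (hazard μ t - hazard μ (u n)) ^ κ ∂(hazardMeasure μ))
      atTop (𝓝 (∫ t in Ioc a w, g t * hazard μ t ^ κ ∂(hazardMeasure μ))) := by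
  have hw1 := (mem_openRange_iff.1 hw).2
  have hRc := continuousOn_hazard (μ := μ) (a := a) hw1
  obtain ⟨C, hC⟩ := isCompact_Icc.exists_bound_of_continuousOn hg
  have hfin : hazardMeasure μ (Ioc a w) < ⊤ :=
    (measure_mono Ioc_subset_Icc_self).trans_lt (hazardMeasure_Icc_lt_top hw1)
  have hu0 := (tendsto_hazard_rightOf (μ := μ)).comp hu
  refine tendsto_integral_filter_of_dominated_convergence (fun _ => C * hazard μ w ^ κ) ?_ ?_ ?_ ?_
  · refine Eventually.of_forall fun n => ?_
    exact ((by fun_prop : ContinuousOn (fun t => g t * (hazard μ t - hazard μ (u n)) ^ κ)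
      (Icc a w)).mono Ioc_subset_Icc_self).aestronglyMeasurable measurableSet_Ioc
  · filter_upwards [hu.eventually (eventually_rightOf_lt ha)] with n hn
    filter_upwards [ae_restrict_mem measurableSet_Ioc] with t ht
    have h1 := hazard_le ht.2 hw1
    have h2 := hazard_le (hn.1.le.trans ht.1.le) ((monotone_cdf μ ht.2).trans_lt hw1)
    have h3 := hazard_nonneg (μ := μ) (u n)
    rw [norm_mul, norm_pow, Real.norm_of_nonneg (sub_nonneg.2 h2)]
    have hCt := hC t (Ioc_subset_Icc_self ht)
    exact mul_le_mul hCt (pow_le_pow_left₀ (by linarith) (by linarith) κ) (pow_nonneg (by linarith) κ)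
      ((norm_nonneg _).trans hCt)
  · have : IsFiniteMeasure ((hazardMeasure μ).restrict (Ioc a w)) := ⟨by simpa using hfin⟩
    exact integrable_const _
  · refine Eventually.of_forall fun t => ?_
    have := ((hu0.const_sub (hazard μ t)).pow κ).const_mul (g t)
    simpa using this

theorem setIntegral_Ioo_sub {u a w : ℝ} (hua : u < a) (haw : a ≤ w)
    (hw1 : cdf μ w < 1) {f : ℝ → ℝ} (hf : ContinuousOn f (Icc u w)) :
    (∫ t in Ioo u w, f t ∂(hazardMeasure μ)) - ∫ t in Ioo u a, f t ∂(hazardMeasure μ) =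
      ∫ t in Ioc a w, f t ∂(hazardMeasure μ) := by
  have hi := integrableOn_Icc_of_continuousOn (hazardMeasure_Icc_lt_top (μ := μ) hw1) hf
  rw [← integral_Ioc_eq_integral_Ioo, ← integral_Ioc_eq_integral_Ioo,
    ← Ioc_union_Ioc_eq_Ioc hua.le haw, setIntegral_union (Ioc_disjoint_Ioc_of_le le_rfl)
      measurableSet_Ioc]
  · ring
  · exact hi.mono_set fun x hx => ⟨hx.1.le, hx.2.trans haw⟩
  · exact hi.mono_set fun x hx => ⟨hua.le.trans hx.1.le, hx.2⟩

theorem continuousOn_taylorQuot_right {h : ℝ → ℝ} {I : Set ℝ} {K j : ℕ}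
    (hf : ContDiffOn ℝ K h I) (hI : IsOpen I) (hj : j ≤ K) (u : ℝ) :
    ContinuousOn (fun v => taylorQuot h j u v) (I \ {u}) := by
  refine ContinuousOn.div (continuousOn_const.mul (continuousOn_const.sub
    (continuousOn_finsetSum _ fun i hi => ?_))) (by fun_prop) ?_
  · have := (hf.continuousOn_iteratedDeriv_of_isOpen hI (i := i)
      (by have := Finset.mem_range.1 hi; omega)).mono (sdiff_subset (t := {u}))
    fun_prop
  · intro v hv
    exact pow_ne_zero _ (sub_ne_zero.2 (Ne.symm hv.2))

/-- Only h(u) and powers of u - v depend on u, so continuity of h at l handles every order j. -/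
theorem tendsto_taylorQuot_left {h : ℝ → ℝ} {ℱ : Filter ℝ} {l v : ℝ} (hlv : l ≠ v)
    (hid : Tendsto (fun u : ℝ => u) ℱ (𝓝 l)) (hh : Tendsto h ℱ (𝓝 (h l))) (j : ℕ) :
    Tendsto (fun u => taylorQuot h j u v) ℱ (𝓝 (taylorQuot h j l v)) := by
  have hs : Tendsto (fun u : ℝ => u - v) ℱ (𝓝 (l - v)) := hid.sub_const v
  refine Tendsto.div ((hh.sub (tendsto_finsetSum _ fun i _ => ?_)).const_mul _) (hs.pow _)
    (pow_ne_zero _ (sub_ne_zero.2 hlv))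
  exact ((hs.pow i).const_mul _).div_const _

/-- The limit of `∂ ^ j M / ∂ v ^ j (u, v)` as `u → -∞` does not depend on `v`. -/
theorem taylorQuot_limit_unique {h : ℝ → ℝ} {ℱ : Filter ℝ} [ℱ.NeBot]
    (hid : Tendsto (fun u : ℝ => u) ℱ atBot) {j : ℕ} {v w a b : ℝ}
    (ha : Tendsto (fun u => taylorQuot h j u v) ℱ (𝓝 a))
    (hb : Tendsto (fun u => taylorQuot h j u w) ℱ (𝓝 b)) : a = b := by
  have hinv : Tendsto (fun u : ℝ => u⁻¹) ℱ (𝓝 0) := tendsto_inv_atBot_zero.comp hid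
  have hratio : ∀ v : ℝ, Tendsto (fun u : ℝ => (u - v) * u⁻¹) ℱ (𝓝 1) := by
    intro v
    have h1 : Tendsto (fun u : ℝ => 1 - v * u⁻¹) ℱ (𝓝 (1 - v * 0)) :=
      (hinv.const_mul v).const_sub 1
    rw [mul_zero, sub_zero] at h1
    refine h1.congr' ?_
    filter_upwards [hid.eventually (eventually_lt_atBot 0)] with u hu
    rw [sub_mul, mul_inv_cancel₀ hu.ne]
  have hpoly : ∀ v : ℝ, Tendsto (fun u : ℝ => (∑ i ∈ Finset.range (j + 1),
      iteratedDeriv i h v * (u - v) ^ i / i.factorial) * u⁻¹ ^ (j + 1)) ℱ (𝓝 0) := by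
    intro v
    have h1 : Tendsto (fun u : ℝ => ∑ i ∈ Finset.range (j + 1),
        iteratedDeriv i h v / i.factorial * (((u - v) * u⁻¹) ^ i * u⁻¹ ^ (j + 1 - i))) ℱ
        (𝓝 (∑ i ∈ Finset.range (j + 1),
          iteratedDeriv i h v / i.factorial * (1 ^ i * 0 ^ (j + 1 - i)))) :=
      tendsto_finsetSum _ fun i _ =>
        (((hratio v).pow i).mul (hinv.pow (j + 1 - i))).const_mul _
    have h2 : ∑ i ∈ Finset.range (j + 1),
        iteratedDeriv i h v / i.factorial * ((1 : ℝ) ^ i * 0 ^ (j + 1 - i)) = 0 := by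
      refine Finset.sum_eq_zero fun i hi => ?_
      rw [zero_pow (by have := Finset.mem_range.1 hi; omega), mul_zero, mul_zero]
    rw [h2] at h1
    refine h1.congr fun u => ?_
    rw [Finset.sum_mul]
    refine Finset.sum_congr rfl fun i hi => ?_
    have : u⁻¹ ^ (j + 1) = u⁻¹ ^ i * u⁻¹ ^ (j + 1 - i) := by
      rw [← pow_add]
      congr 1
      have := Finset.mem_range.1 hi
      omega
    rw [this, mul_pow]
    ring
  -- After division by u^(j+1) the Taylor polynomial, of degree at most j in u, disappears, leaving
  -- j! h(u) / u^(j+1), which does not involve v.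
  have hkey : ∀ {v a : ℝ}, Tendsto (fun u => taylorQuot h j u v) ℱ (𝓝 a) →
      Tendsto (fun u => j.factorial * (h u * u⁻¹ ^ (j + 1))) ℱ (𝓝 a) := by
    intro v a ha
    have h1 := (ha.mul ((hratio v).pow (j + 1))).add ((hpoly v).const_mul (j.factorial : ℝ))
    rw [one_pow, mul_one, mul_zero, add_zero] at h1
    refine h1.congr' ?_
    filter_upwards [hid.eventually (eventually_lt_atBot v)] with u hu
    have : (u - v) ^ (j + 1) ≠ 0 := pow_ne_zero _ (sub_ne_zero.2 hu.ne)
    rw [mul_pow, taylorQuot, ← mul_assoc, div_mul_cancel₀ _ this]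
    ring
  exact tendsto_nhds_unique (hkey ha) (hkey hb)

/-- The regression identity with one record beyond the middle one forces an exponential law. -/
theorem isExponentialType_of_integral_eq {h : ℝ → ℝ} {κ : ℕ}
    (hcont : ContinuousOn h (closedRange (cdf μ)))
    (hf : ContDiffOn ℝ (κ + 1 : ℕ) h (openRange (cdf μ)))
    (hB : ∀ v ∈ openRange (cdf μ), BoundaryDerivNeZero h 0 (κ + 1) (leftExtremity (cdf μ)) v)
    (hE : ∀ᵐ p ∂(μ.prod μ), p.1 < p.2 → p.1 ∈ openRange (cdf μ) → p.2 ∈ openRange (cdf μ) →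
      ∫ t in Ioo p.1 p.2, iteratedDeriv (κ + 1) h t * (hazard μ t - hazard μ p.1) ^ κ
        ∂(hazardMeasure μ) =
      (hazard μ p.2 - hazard μ p.1) ^ (κ + 1) * diffQuotDeriv h 0 κ p.1 p.2) :
    IsExponentialType (cdf μ) := by
  have hIo := isOpen_openRange (μ := μ)
  obtain ⟨u, hu, huI, hG⟩ := exists_seq_rightOf hE
  set G := {v | v ∈ openRange (cdf μ) ∧ ∀ n, u n < v → u n ∈ openRange (cdf μ) →
    v ∈ openRange (cdf μ) → ∫ t in Ioo (u n) v, iteratedDeriv (κ + 1) h t *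
      (hazard μ t - hazard μ (u n)) ^ κ ∂(hazardMeasure μ) =
      (hazard μ v - hazard μ (u n)) ^ (κ + 1) * diffQuotDeriv h 0 κ (u n) v} with hGdef
  have hgc : ContinuousOn (iteratedDeriv (κ + 1) h) (openRange (cdf μ)) :=
    hf.continuousOn_iteratedDeriv_of_isOpen hIo le_rfl
  have hu0 := (tendsto_hazard_rightOf (μ := μ)).comp hu
  -- For r = 1 the weight (R(t) - R(u))^κ does not involve the upper point, so subtracting the
  -- identities at w and a leaves an integral over (a, w].
  have hlim : ∀ a ∈ G, ∀ w ∈ G, a < w → Tendsto (fun n =>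
      (hazard μ w - hazard μ (u n)) ^ (κ + 1) * taylorQuot h κ (u n) w -
        (hazard μ a - hazard μ (u n)) ^ (κ + 1) * taylorQuot h κ (u n) a) atTop
      (𝓝 (∫ t in Ioc a w, iteratedDeriv (κ + 1) h t * hazard μ t ^ κ ∂(hazardMeasure μ))) := by
    intro a ha w hw haw
    refine (tendsto_setIntegral_hazard_pow hu ha.1 hw.1
      (hgc.mono (Icc_subset_openRange ha.1 hw.1)) κ).congr' ?_
    filter_upwards [hu.eventually (eventually_rightOf_lt ha.1)] with n hn
    have hw1 := (mem_openRange_iff.1 hw.1).2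
    have hg' := hgc.mono (Icc_subset_openRange (huI n) hw.1)
    have hRc := continuousOn_hazard (μ := μ) (a := u n) hw1
    rw [← setIntegral_Ioo_sub hn.1 haw.le hw1 (by fun_prop),
      hw.2 n (hn.1.trans haw) (huI n) hw.1, ha.2 n hn.1 (huI n) ha.1,
      diffQuotDeriv_eq hf hIo (Nat.le_succ κ) hw.1 (hn.1.trans haw).ne,
      diffQuotDeriv_eq hf hIo (Nat.le_succ κ) ha.1 hn.1.ne, iteratedDeriv_zero,
      iteratedDeriv_zero]
  have hbd : ∀ v ∈ openRange (cdf μ), ∃ b ≠ 0, Tendsto (fun u => taylorQuot h (κ + 1) u v)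
      (rightOf (leftExtremity (cdf μ))) (𝓝 b) := by
    intro v hv
    obtain ⟨b, hb0, hb⟩ := hB v hv
    refine ⟨b, hb0, hb.congr' ?_⟩
    filter_upwards [eventually_rightOf_lt hv] with x hx
    rw [diffQuotDeriv_eq hf hIo le_rfl hv hx.1.ne, iteratedDeriv_zero]
  obtain ⟨x0, hx0⟩ := exists_cdf_eq (μ := μ) (s := 1 / 2) (by norm_num) (by norm_num)
  have hx0I : x0 ∈ openRange (cdf μ) := mem_openRange_iff.2 ⟨by rw [hx0]; norm_num,
    by rw [hx0]; norm_num⟩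
  induction hl : leftExtremity (cdf μ) with
  | top => exact absurd hl leftExtremity_ne_top
  | bot =>
    exfalso
    have hid := tendsto_id_rightOf_bot (μ := μ) hl
    obtain ⟨a, -, haI, haG⟩ := exists_lt_mem_of_ae hG (mem_openRange_iff.1 hx0I).1
    -- Requiring F(w) ≠ F(a) ensures R(a) < R(w), which produces the contradiction below.
    have hG' : ∀ᵐ v ∂μ, v ∈ {v | v ∈ G ∧ cdf μ v ≠ cdf μ a} := by
      filter_upwards [hG, ae_cdf_ne μ (cdf μ a)] with v h1 h2 using ⟨h1, h2⟩
    obtain ⟨w, haw, hwI, hwG, hne⟩ := exists_gt_mem_of_ae hG' (mem_openRange_iff.1 haI).2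
    obtain ⟨b, hb0, hbw⟩ := hbd w hwI
    obtain ⟨b', -, hba⟩ := hbd a haI
    obtain rfl := taylorQuot_limit_unique hid hbw hba
    have hinv : Tendsto (fun n => (u n)⁻¹) atTop (𝓝 0) :=
      tendsto_inv_atBot_zero.comp (hid.comp hu)
    -- By the recurrence, (κ+1) M_κ(u, v) / u tends to the common boundary value b. Dividing `hlim`
    -- by u therefore gives (R(w)^(κ+1) - R(a)^(κ+1)) b = 0.
    have hT : ∀ v ∈ openRange (cdf μ), Tendsto (fun u => taylorQuot h (κ + 1) u v)
        (rightOf (leftExtremity (cdf μ))) (𝓝 b) →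
        Tendsto (fun n => (hazard μ v - hazard μ (u n)) ^ (κ + 1) *
          ((κ + 1) * taylorQuot h κ (u n) v * (u n)⁻¹)) atTop (𝓝 (hazard μ v ^ (κ + 1) * b)) := by
      intro v hv hb
      have h1 : Tendsto (fun n => iteratedDeriv (κ + 1) h v * (u n)⁻¹ -
          (v * (u n)⁻¹ - 1) * taylorQuot h (κ + 1) (u n) v) atTop
          (𝓝 (iteratedDeriv (κ + 1) h v * 0 - (v * 0 - 1) * b)) :=
        (hinv.const_mul _).sub (((hinv.const_mul v).sub_const 1).mul (hb.comp hu))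
      have h2 := ((hu0.const_sub (hazard μ v)).pow (κ + 1)).mul h1
      have e : (hazard μ v - 0) ^ (κ + 1) * (iteratedDeriv (κ + 1) h v * 0 - (v * 0 - 1) * b) =
          hazard μ v ^ (κ + 1) * b := by ring
      rw [e] at h2
      refine h2.congr' ?_
      filter_upwards [hu.eventually (eventually_rightOf_lt hv),
        hu.eventually (hid.eventually (eventually_lt_atBot 0))] with n hn hn0
      have h3 := taylorQuot_recurrence h κ hn.1.ne
      simp only [Function.comp_apply]
      rw [← h3]
      have : u n ≠ 0 := hn0.ne
      field_simp
      ring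
    have h1 := (hT w hwI hbw).sub (hT a haI hba)
    have h2 := ((hlim a haG w hwG haw).mul hinv).const_mul (κ + 1 : ℝ)
    rw [mul_zero, mul_zero] at h2
    have h3 := tendsto_nhds_unique h1 (h2.congr fun n => by ring)
    have hlt : hazard μ a < hazard μ w :=
      hazard_lt (lt_of_le_of_ne (monotone_cdf μ haw.le) hne.symm) (mem_openRange_iff.1 hwI).2
    have hlt' := pow_lt_pow_left₀ hlt (hazard_nonneg a) (Nat.succ_ne_zero κ)
    rw [← sub_mul] at h3
    rcases mul_eq_zero.1 h3 with h4 | h4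
    · exact absurd (sub_eq_zero.1 h4) hlt'.ne'
    · exact hb0 h4
  | coe l =>
    have hlI : ∀ v ∈ openRange (cdf μ), l < v := fun v hv =>
      EReal.coe_lt_coe_iff.1 (hl ▸ hv.1)
    have hid : Tendsto (fun u : ℝ => u) (rightOf (leftExtremity (cdf μ))) (𝓝 l) := by
      rw [hl]
      exact tendsto_id_rightOf l
    have hh : Tendsto h (rightOf (leftExtremity (cdf μ))) (𝓝 (h l)) := by
      have hlc : l ∈ closedRange (cdf μ) :=
        ⟨hl.le, hl ▸ (hx0I.1.trans hx0I.2).le⟩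
      refine (hcont l hlc).tendsto.comp (tendsto_nhdsWithin_iff.2 ⟨hid, ?_⟩)
      filter_upwards [eventually_rightOf_lt hx0I] with x hx using ⟨hx.2.1.le, hx.2.2.le⟩
    have hTl : ∀ v ∈ openRange (cdf μ), ∀ j, Tendsto (fun u => taylorQuot h j u v)
        (rightOf (leftExtremity (cdf μ))) (𝓝 (taylorQuot h j l v)) := fun v hv j =>
      tendsto_taylorQuot_left (hlI v hv).ne hid hh j
    have hid' : ∀ a ∈ G, ∀ w ∈ G, a < w →
        ∫ t in Ioc a w, iteratedDeriv (κ + 1) h t * hazard μ t ^ κ ∂(hazardMeasure μ) =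
          taylorQuot h κ l w * hazard μ w ^ (κ + 1) - taylorQuot h κ l a * hazard μ a ^ (κ + 1) := by
      intro a ha w hw haw
      have h1 : ∀ v ∈ G, Tendsto (fun n => (hazard μ v - hazard μ (u n)) ^ (κ + 1) *
          taylorQuot h κ (u n) v) atTop (𝓝 (taylorQuot h κ l v * hazard μ v ^ (κ + 1))) := by
        intro v hv
        have := ((hu0.const_sub (hazard μ v)).pow (κ + 1)).mul ((hTl v hv.1 κ).comp hu)
        rwa [sub_zero, mul_comm (hazard μ v ^ (κ + 1))] at this
      exact tendsto_nhds_unique (hlim a ha w hw haw) ((h1 w hw).sub (h1 a ha))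
    have hprop : ∀ a ∈ G, ∀ w ∈ G, a < w → ∀ t ∈ Icc a w,
        hazard μ t / (t - l) = hazard μ a / (a - l) := by
      intro a ha w hw haw
      have hsub := Icc_subset_openRange ha.1 hw.1
      have hw1 := (mem_openRange_iff.1 hw.1).2
      have hsub' : Icc a w ⊆ openRange (cdf μ) \ {l} := fun t ht =>
        ⟨hsub ht, (hlI t (hsub ht)).ne'⟩
      refine proportional_of_integral_eq (ν := hazardMeasure μ) (σ := 1) (G := G)
        (p := fun v => taylorQuot h κ l v) (p' := fun v => taylorQuot h (κ + 1) l v) (N := κ)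
        haw (fun h => absurd h.1 (not_le.2 (hlI a ha.1))) (hazardMeasure_Icc_lt_top hw1) ha hw ?_
        (continuousOn_hazard hw1) ?_ ?_ ?_ ?_ ?_ ?_
      · refine hazardMeasure_absolutelyContinuous ?_
        refine measure_mono_null (fun t ht => ht.2) (ae_iff.1 hG)
      · intro t ht
        have := mem_openRange_iff.1 (hsub ht)
        exact hazard_pos this.1 this.2
      · intro s t _ hst htw
        rw [one_mul, hazardMeasure_real_Ioc hst ((monotone_cdf μ htw).trans_lt hw1)]
      · exact fun t ht => hasDerivAt_taylorQuot hf hIo (Nat.lt_succ_self κ) (hsub ht)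
          (hlI t (hsub ht)).ne
      · exact (continuousOn_taylorQuot_right hf hIo le_rfl l).mono hsub'
      · intro t ht
        obtain ⟨b, hb0, hb⟩ := hbd t (hsub ht)
        rw [tendsto_nhds_unique (hTl t (hsub ht) (κ + 1)) hb]
        exact hb0
      · rintro t ⟨htG, ht⟩
        rw [one_mul]
        rcases ht.1.lt_or_eq with hat | rfl
        · rw [← hid' a ha t htG hat]
          refine setIntegral_congr_fun measurableSet_Ioc fun x hx => ?_
          have hxI := hsub ⟨hx.1.le, hx.2.trans ht.2⟩
          rw [← taylorQuot_recurrence h κ (hlI x hxI).ne]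
          ring
        · simp
    -- Good end points a < w enclose both t and x0, so the ratio at t is compared with that at x0.
    have hconst : ∀ t ∈ openRange (cdf μ), hazard μ t / (t - l) = hazard μ x0 / (x0 - l) := by
      intro t ht
      obtain ⟨a, hat, haI, haG⟩ := exists_lt_mem_of_ae (x := min t x0) hG
        (by rcases min_choice t x0 with h | h <;> rw [h]
            exacts [(mem_openRange_iff.1 ht).1, (mem_openRange_iff.1 hx0I).1])
      obtain ⟨w, htw, hwI, hwG⟩ := exists_gt_mem_of_ae (x := max t x0) hG
        (by rcases max_choice t x0 with h | h <;> rw [h]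
            exacts [(mem_openRange_iff.1 ht).2, (mem_openRange_iff.1 hx0I).2])
      have h1 := lt_min_iff.1 hat
      have h2 := max_lt_iff.1 htw
      rw [hprop a haG w hwG (h1.1.trans h2.1) t ⟨h1.1.le, h2.1.le⟩,
        hprop a haG w hwG (h1.1.trans h2.1) x0 ⟨h1.2.le, h2.2.le⟩]
    have hx0l := sub_pos.2 (hlI x0 hx0I)
    have hx0' := mem_openRange_iff.1 hx0I
    refine isExponentialType_of_hazard (c := hazard μ x0 / (x0 - l)) hl
      (div_pos (hazard_pos hx0'.1 hx0'.2) hx0l) fun t ht => ?_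
    have htl := sub_pos.2 (hlI t ht)
    rw [← hconst t ht, div_mul_cancel₀ _ htl.ne']

end OneSided

/-! ### The case r ≥ 2: fixing the upper record and varying the lower one. -/

section TwoSided

open Set

theorem ae_ae_swap_of_ae_prod {α β : Type*} [MeasurableSpace α] [MeasurableSpace β]
    {μ : Measure α} {ν : Measure β} [SFinite μ] [SFinite ν] {Φ : α × β → Prop}
    (hΦ : ∀ᵐ p ∂(μ.prod ν), Φ p) : ∀ᵐ v ∂ν, ∀ᵐ u ∂μ, Φ (u, v) :=
  Measure.ae_ae_of_ae_prod (Measure.measurePreserving_swap.quasiMeasurePreserving.ae hΦ)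

variable {μ : Measure ℝ} [IsProbabilityMeasure μ] [NullSingletonClass μ]

/-- The substitution x = R(u) integrates the power exactly. The indicators cover both positions of t
relative to w, as the Fubini argument for `setIntegral_hazard_pow_sub` requires. -/
theorem setIntegral_Ioc_min_hazard_pow (i : ℕ) {a w t : ℝ} (hat : a < t) (haw : a ≤ w)
    (ht : cdf μ t < 1) :
    (i + 1) * ∫ u in Ioc a w, (Iio t).indicator (fun u => (hazard μ t - hazard μ u) ^ i) u
      ∂(hazardMeasure μ) =
      (hazard μ t - hazard μ a) ^ (i + 1) -
        (Ioi w).indicator (fun t => (hazard μ t - hazard μ w) ^ (i + 1)) t := by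
  have key : ∀ b, a ≤ b → b ≤ t →
      (i + 1) * ∫ u in Ioc a b, (hazard μ t - hazard μ u) ^ i ∂(hazardMeasure μ) =
      (hazard μ t - hazard μ a) ^ (i + 1) - (hazard μ t - hazard μ b) ^ (i + 1) := by
    intro b hab hbt
    have h1 := integral_comp_hazard (μ := μ) hab ((monotone_cdf μ hbt).trans_lt ht)
      (φ := fun x => (hazard μ t - x) ^ i) (by fun_prop)
    rw [h1, intervalIntegral.integral_comp_sub_left (fun x => x ^ i), integral_pow]
    field_simp
  rw [setIntegral_indicator measurableSet_Iio]
  rcases lt_or_ge w t with hwt | htw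
  · rw [indicator_of_mem (show t ∈ Ioi w from hwt), ← key w haw hwt.le]
    have : Ioc a w ∩ Iio t = Ioc a w := inter_eq_left.2 fun x hx => hx.2.trans_lt hwt
    rw [this]
  · rw [indicator_of_notMem (show t ∉ Ioi w from not_lt.2 htw)]
    have : Ioc a w ∩ Iio t = Ioo a t := by
      ext x
      exact ⟨fun hx => ⟨hx.1.1, hx.2⟩, fun hx => ⟨⟨hx.1, hx.2.le.trans htw⟩, hx.2⟩⟩
    have h2 := key t hat.le le_rfl
    rw [sub_self, zero_pow (Nat.succ_ne_zero i)] at h2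
    rw [this, ← integral_Ioc_eq_integral_Ioo, h2]

/-- The increment of a truncated hazard moment as an iterated integral. -/
theorem setIntegral_hazard_pow_sub (i : ℕ) {a w v : ℝ} (haw : a ≤ w) (hwv : w < v)
    (hv : cdf μ v < 1) {γ : ℝ → ℝ} (hγ : ContinuousOn γ (Icc a v)) :
    (∫ t in Ioo a v, γ t * (hazard μ t - hazard μ a) ^ (i + 1) ∂(hazardMeasure μ)) -
      ∫ t in Ioo w v, γ t * (hazard μ t - hazard μ w) ^ (i + 1) ∂(hazardMeasure μ) =
    (i + 1) * ∫ u in Ioc a w, (∫ t in Ioo u v, γ t * (hazard μ t - hazard μ u) ^ i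
      ∂(hazardMeasure μ)) ∂(hazardMeasure μ) := by
  set ν := hazardMeasure μ
  have hfin : ν (Icc a v) < ⊤ := hazardMeasure_Icc_lt_top hv
  have hR := measurable_hazard (μ := μ)
  have hRc := continuousOn_hazard (μ := μ) (a := a) hv
  have : IsFiniteMeasure (ν.restrict (Ioo a v)) :=
    ⟨by simpa using (measure_mono Ioo_subset_Icc_self).trans_lt hfin⟩
  have : IsFiniteMeasure (ν.restrict (Ioc a w)) :=
    ⟨by simpa using (measure_mono (show Ioc a w ⊆ Icc a v from
      fun x hx => ⟨hx.1.le, hx.2.trans hwv.le⟩)).trans_lt hfin⟩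
  have hw1 : (Ioo w v : Set ℝ) = Ioo a v ∩ Ioi w := by
    ext x
    exact ⟨fun hx => ⟨⟨haw.trans_lt hx.1, hx.2⟩, hx.1⟩, fun hx => ⟨hx.2, hx.1.2⟩⟩
  have hint : Integrable (fun p : ℝ × ℝ => γ p.1 * (Iio p.1).indicator
      (fun u => (hazard μ p.1 - hazard μ u) ^ i) p.2) ((ν.restrict (Ioo a v)).prod
        (ν.restrict (Ioc a w))) := by
    have hγi : Integrable γ (ν.restrict (Ioo a v)) :=
      (integrableOn_Icc_of_continuousOn hfin hγ).mono_set Ioo_subset_Icc_self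
    have hm : Measurable fun p : ℝ × ℝ => (Iio p.1).indicator
        (fun u => (hazard μ p.1 - hazard μ u) ^ i) p.2 := by
      have : (fun p : ℝ × ℝ => (Iio p.1).indicator
          (fun u => (hazard μ p.1 - hazard μ u) ^ i) p.2) =
          {p : ℝ × ℝ | p.2 < p.1}.indicator fun p => (hazard μ p.1 - hazard μ p.2) ^ i := by
        ext p
        simp [indicator_apply]
      rw [this]
      exact (((hR.comp measurable_fst).sub (hR.comp measurable_snd)).pow_const i).indicator
        (measurableSet_lt measurable_snd measurable_fst)
    refine (hγi.comp_fst (ν.restrict (Ioc a w))).mul_bdd (c := hazard μ v ^ i)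
      hm.aestronglyMeasurable ?_
    rw [Measure.prod_restrict]
    filter_upwards [ae_restrict_mem (measurableSet_Ioo.prod measurableSet_Ioc)] with p hp
    by_cases h : p.2 < p.1
    · rw [indicator_of_mem (show p.2 ∈ Iio p.1 from h)]
      have h1 := hazard_le hp.1.2.le hv
      have h2 := hazard_le h.le ((monotone_cdf μ hp.1.2.le).trans_lt hv)
      have h3 := hazard_nonneg (μ := μ) p.2
      rw [norm_pow, Real.norm_of_nonneg (sub_nonneg.2 h2)]
      exact pow_le_pow_left₀ (by linarith) (by linarith) i
    · rw [indicator_of_notMem (show p.2 ∉ Iio p.1 from h), norm_zero]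
      exact pow_nonneg (hazard_nonneg v) i
  have hswap := integral_integral_swap (f := fun t u => γ t * (Iio t).indicator
      (fun u => (hazard μ t - hazard μ u) ^ i) u) hint
  have hr : ∫ u in Ioc a w, (∫ t in Ioo a v, γ t * (Iio t).indicator
      (fun u => (hazard μ t - hazard μ u) ^ i) u ∂ν) ∂ν =
      ∫ u in Ioc a w, (∫ t in Ioo u v, γ t * (hazard μ t - hazard μ u) ^ i ∂ν) ∂ν := by
    refine setIntegral_congr_fun measurableSet_Ioc fun u hu => ?_
    have e1 : (Ioo u v : Set ℝ) = Ioo a v ∩ Ioi u := by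
      ext x
      exact ⟨fun hx => ⟨⟨hu.1.trans hx.1, hx.2⟩, hx.1⟩, fun hx => ⟨hx.2, hx.1.2⟩⟩
    rw [e1, ← setIntegral_indicator measurableSet_Ioi]
    congr 1
    ext t
    by_cases h : u < t <;> simp [h]
  rw [← hr, ← hswap, hw1, ← setIntegral_indicator measurableSet_Ioi, ← integral_sub,
    ← integral_const_mul]
  · refine setIntegral_congr_fun measurableSet_Ioo fun t ht => ?_
    have h1 := setIntegral_Ioc_min_hazard_pow i ht.1 haw ((monotone_cdf μ ht.2.le).trans_lt hv)
    rw [integral_const_mul, mul_left_comm, h1, mul_sub]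
    by_cases h : w < t <;> simp [h]
  · exact (integrableOn_Icc_of_continuousOn hfin (by fun_prop)).mono_set Ioo_subset_Icc_self
  · refine Integrable.indicator ?_ measurableSet_Ioi
    exact (integrableOn_Icc_of_continuousOn hfin (by fun_prop)).mono_set Ioo_subset_Icc_self

/-- If both regression identities hold for a fixed upper record value `v` and almost every lower
record value, then the hazard is affine near the left extremity. -/
theorem exists_hazard_sub_eq {h : ℝ → ℝ} {i j : ℕ}
    (hf : ContDiffOn ℝ (i + j + 1 + 1 : ℕ) h (openRange (cdf μ))) {v : ℝ}
    (hv : v ∈ openRange (cdf μ))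
    (hB : BoundaryDerivNeZero h (j + 1) (i + 1) (leftExtremity (cdf μ)) v) {g : ℝ → ℝ}
    (hg : ContinuousOn g (openRange (cdf μ)))
    (h1 : ∀ᵐ u ∂μ, u < v → u ∈ openRange (cdf μ) →
      ∫ t in Ioo u v, g t * ((hazard μ t - hazard μ u) ^ (i + 1) * (hazard μ v - hazard μ t) ^ j)
        ∂(hazardMeasure μ) =
      (hazard μ v - hazard μ u) ^ (i + j + 2) * diffQuotDeriv h j (i + 1) u v)
    (h2 : ∀ᵐ u ∂μ, u < v → u ∈ openRange (cdf μ) →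
      ∫ t in Ioo u v, g t * ((hazard μ t - hazard μ u) ^ i * (hazard μ v - hazard μ t) ^ j)
        ∂(hazardMeasure μ) =
      (hazard μ v - hazard μ u) ^ (i + j + 1) * diffQuotDeriv (deriv h) j i u v) :
    ∃ c : ℝ, ∀ᶠ t in rightOf (leftExtremity (cdf μ)), hazard μ v - hazard μ t = c * (v - t) := by
  have hIo := isOpen_openRange (μ := μ)
  have hv1 := (mem_openRange_iff.1 hv).2
  set ν := hazardMeasure μ
  set q : ℝ → ℝ := fun u => taylorQuot h (i + 1) u v
  obtain ⟨b, hb0, hb⟩ := hB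
  -- The boundary value is a nonzero limit, so p' ≠ 0 is known only near the left extremity; this
  -- confines the conclusion to t near it.
  have hev : ∀ᶠ u in rightOf (leftExtremity (cdf μ)),
      diffQuotDeriv h (j + 1) (i + 1) u v ≠ 0 ∧ cdf μ u < cdf μ v ∧ u < v :=
    (hb.eventually_ne hb0).and ((tendsto_cdf_rightOf.eventually
      (gt_mem_nhds (mem_openRange_iff.1 hv).1)).and ((eventually_rightOf_lt hv).mono fun _ h => h.1))
  obtain ⟨y, hyI, hy⟩ := eventually_rightOf_iff.1 hev
  set G : Set ℝ := {u | u < v → u ∈ openRange (cdf μ) →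
    ∫ t in Ioo u v, g t * ((hazard μ t - hazard μ u) ^ (i + 1) * (hazard μ v - hazard μ t) ^ j) ∂ν =
      (hazard μ v - hazard μ u) ^ (i + j + 2) * diffQuotDeriv h j (i + 1) u v} with hGdef
  obtain ⟨w, hwy, hwI, hwG⟩ := exists_lt_mem_of_ae (S := G) h1 (mem_openRange_iff.1 hyI).1
  refine ⟨(hazard μ v - hazard μ w) / (v - w), eventually_rightOf_iff.2 ⟨w, hwI, fun t ht htw => ?_⟩⟩
  obtain ⟨a, hat, haI, haG⟩ := exists_lt_mem_of_ae (S := G) h1 ht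
  have hall : ∀ x ∈ Icc a w, x ∈ openRange (cdf μ) ∧ iteratedDeriv (j + 1) q x ≠ 0 ∧
      cdf μ x < cdf μ v ∧ x < v := by
    intro x hx
    have hxI := Icc_subset_openRange haI hwI hx
    obtain ⟨h3, h4, h5⟩ := hy x (mem_openRange_iff.1 hxI).1 (hx.2.trans_lt hwy)
    rw [diffQuotDeriv_eq hf hIo (by omega) hv h5.ne] at h3
    exact ⟨hxI, h3, h4, h5⟩
  have haw := hat.trans htw
  have hwv : w < v := (hall w ⟨haw.le, le_rfl⟩).2.2.2
  have hw1 := (mem_openRange_iff.1 hwI).2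
  have hRc := continuousOn_hazard (μ := μ) (a := a) hv1
  have hgc : ContinuousOn g (Icc a v) := hg.mono (Icc_subset_openRange haI hv)
  -- B = R(v) - R decreases, hence σ = -1; p is the derivative of M of order j in u and i+1 in v.
  have hprop := proportional_of_integral_eq (ν := ν) (a := a) (w := w) (e := v) (σ := -1) (G := G)
    (B := fun u => hazard μ v - hazard μ u) (p := iteratedDeriv j q)
    (p' := iteratedDeriv (j + 1) q) (N := i + j + 1) haw
    (fun h => absurd h.2 (not_le.2 hwv)) (hazardMeasure_Icc_lt_top hw1) haG hwG
    (hazardMeasure_absolutelyContinuous (measure_mono_null (fun t ht => ht.2) (ae_iff.1 h1)))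
    (by have := hRc.mono (Icc_subset_Icc_right hwv.le); fun_prop)
    (fun x hx => sub_pos.2 (hazard_lt (hall x hx).2.2.1 hv1))
    (fun s x _ hsx hxw => by
      rw [hazardMeasure_real_Ioc hsx ((monotone_cdf μ hxw).trans_lt hw1)]
      ring)
    (fun x hx => hasDerivAt_iteratedDeriv_taylorQuot hf hIo (by omega) (hall x hx).1
      (hall x hx).2.2.2.ne)
    (((contDiffOn_taylorQuot hf (i + 1) v).continuousOn_iteratedDeriv_of_isOpen
      (isOpen_diff_singleton hIo v) (by omega)).mono fun x hx =>
        ⟨(hall x hx).1, (hall x hx).2.2.2.ne⟩)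
    (fun x hx => (hall x hx).2.1) ?_
  · have h3 := hprop t ⟨hat.le, htw.le⟩
    have h4 := hprop w ⟨haw.le, le_rfl⟩
    rw [← h4, ← neg_sub v t, ← neg_sub v w, div_neg, div_neg, neg_inj] at h3
    rw [← h3, div_mul_cancel₀ _ (sub_ne_zero.2 (htw.trans hwv).ne')]
  · rintro x ⟨hxG, hx⟩
    obtain ⟨hxI, -, -, hxv⟩ := hall x hx
    have hsub := setIntegral_hazard_pow_sub (μ := μ) i hx.1 hxv hv1
      (γ := fun t => g t * (hazard μ v - hazard μ t) ^ j) (by fun_prop)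
    have hE : ∀ u ∈ G, u < v → u ∈ openRange (cdf μ) →
        ∫ t in Ioo u v, g t * (hazard μ v - hazard μ t) ^ j * (hazard μ t - hazard μ u) ^ (i + 1) ∂ν =
          iteratedDeriv j q u * (hazard μ v - hazard μ u) ^ (i + j + 1 + 1) := by
      intro u hu huv huI
      rw [← diffQuotDeriv_eq hf hIo (by omega) hv huv.ne, mul_comm (diffQuotDeriv _ _ _ _ _),
        ← hu huv huI]
      refine setIntegral_congr_fun measurableSet_Ioo fun t _ => ?_
      ring
    rw [hE a haG (haw.trans hwv) haI, hE x hxG hxv hxI, ← integral_const_mul] at hsub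
    rw [neg_one_mul, ← neg_sub, neg_inj, hsub]
    refine setIntegral_congr_ae measurableSet_Ioc ?_
    filter_upwards [hazardMeasure_absolutelyContinuous.ae_le h2] with u hu hua
    obtain ⟨huI, -, -, huv⟩ := hall u ⟨hua.1.le, hua.2.trans hx.2⟩
    -- This turns i+1 times the second regression function into (N+1) p + (u - v) p' with N = i+j+1.
    have h3 := mul_diffQuotDeriv_deriv (K := i + j + 1) hf hIo (i := j) (j := i) (by omega)
      (by omega) huI hv huv.ne
    rw [diffQuotDeriv_eq hf hIo (by omega) hv huv.ne,
      diffQuotDeriv_eq hf hIo (by omega) hv huv.ne] at h3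
    have h4 : ∫ t in Ioo u v, g t * (hazard μ v - hazard μ t) ^ j * (hazard μ t - hazard μ u) ^ i ∂ν =
        (hazard μ v - hazard μ u) ^ (i + j + 1) * diffQuotDeriv (deriv h) j i u v := by
      rw [← hu huv huI]
      refine setIntegral_congr_fun measurableSet_Ioo fun t _ => ?_
      ring
    rw [h4, mul_left_comm, h3]
    push_cast
    ring

/-- If the hazard is affine between almost every point and the left extremity, then the law is
exponential. -/
theorem isExponentialType_of_hazard_sub_eq
    (hG : ∀ᵐ v ∂μ, ∃ c : ℝ, ∀ᶠ t in rightOf (leftExtremity (cdf μ)),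
      hazard μ v - hazard μ t = c * (v - t)) : IsExponentialType (cdf μ) := by
  have hR0 := tendsto_hazard_rightOf (μ := μ)
  obtain ⟨x0, hx0⟩ := exists_cdf_eq (μ := μ) (s := 1 / 2) (by norm_num) (by norm_num)
  have hpos : 0 < cdf μ x0 := by rw [hx0]; norm_num
  obtain ⟨z, -, hzI, c, hc⟩ := exists_lt_mem_of_ae (S := {v | ∃ c : ℝ,
    ∀ᶠ t in rightOf (leftExtremity (cdf μ)), hazard μ v - hazard μ t = c * (v - t)}) hG hpos
  have hz := mem_openRange_iff.1 hzI
  have hRz := hazard_pos hz.1 hz.2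
  induction hl : leftExtremity (cdf μ) with
  | top => exact absurd hl leftExtremity_ne_top
  | bot =>
    exfalso
    have hid := tendsto_id_rightOf_bot (μ := μ) hl
    -- As t tends to -∞, R(z) - R(t) stays bounded while z - t does not, so c = 0; then R(t) = R(z)
    -- > 0 near -∞, against R → 0.
    have hinv : Tendsto (fun t : ℝ => (z - t)⁻¹) (rightOf (leftExtremity (cdf μ))) (𝓝 0) := by
      exact tendsto_inv_atTop_zero.comp (tendsto_atTop_add_const_left _ z
        (tendsto_neg_atBot_atTop.comp hid))
    have h1 := (hR0.const_sub (hazard μ z)).mul hinv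
    rw [mul_zero] at h1
    have h2 : c = 0 := by
      refine tendsto_nhds_unique (tendsto_const_nhds.congr' ?_) h1
      filter_upwards [hc, eventually_rightOf_lt hzI] with t ht htz
      rw [ht, mul_inv_cancel_right₀ (sub_ne_zero.2 htz.1.ne')]
    obtain ⟨t, ht⟩ := (hc.and (hR0.eventually (gt_mem_nhds hRz))).exists
    rw [h2] at ht
    linarith [ht.1, ht.2]
  | coe l =>
    have hlI : ∀ v ∈ openRange (cdf μ), l < v := fun v hv =>
      EReal.coe_lt_coe_iff.1 (hl ▸ hv.1)
    have hid : Tendsto (fun u : ℝ => u) (rightOf (leftExtremity (cdf μ))) (𝓝 l) := by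
      rw [hl]
      exact tendsto_id_rightOf l
    have hlim : ∀ v b, (∀ᶠ t in rightOf (leftExtremity (cdf μ)),
        hazard μ v - hazard μ t = b * (v - t)) → hazard μ v = b * (v - l) := by
      intro v b hb
      have h1 := hR0.const_sub (hazard μ v)
      rw [sub_zero] at h1
      exact tendsto_nhds_unique (h1.congr' hb) ((hid.const_sub v).const_mul b)
    -- At one t near l the relations for v and z give R(t) = b (t - l) = c (t - l), hence b = c.
    have hV : ∀ᵐ v ∂μ, v ∈ {v | hazard μ v = c * (v - l)} := by
      filter_upwards [hG] with v hv
      obtain ⟨b, hb⟩ := hv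
      obtain ⟨t, ⟨h1, h2⟩, h3⟩ := ((hb.and hc).and (eventually_rightOf_lt hzI)).exists
      have htl := sub_pos.2 (hlI t h3.2)
      have h4 := hlim v b hb
      have h5 := hlim z c hc
      have hbc : b = c := mul_right_cancel₀ htl.ne' (by linarith)
      exact hbc ▸ h4
    have hc0 : 0 < c := by
      rw [hlim z c hc] at hRz
      exact pos_of_mul_pos_left hRz (sub_pos.2 (hlI z hzI)).le
    refine isExponentialType_of_hazard hl hc0 fun t ht => ?_
    by_contra hne
    have ht' := mem_openRange_iff.1 ht
    obtain ⟨a, hat, haI, haV⟩ := exists_lt_mem_of_ae hV ht'.1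
    obtain ⟨w, htw, hwI, hwV⟩ := exists_gt_mem_of_ae hV ht'.2
    have hw1 := (mem_openRange_iff.1 hwI).2
    have hRc := continuousOn_hazard (μ := μ) (a := a) hw1
    -- An exceptional t would lie in a gap of the full-measure set: there the hazard measure
    -- vanishes, so R is flat, yet R differs by c (y - s) > 0 at the ends.
    obtain ⟨s, y, has, hsy, hyw, hQs, hQy, hQ⟩ := exists_zero_free_interval
      (Q := fun t => hazard μ t - c * (t - l)) (a := a) (w := w) (x := t) (by fun_prop)
      (sub_eq_zero.2 haV) (sub_eq_zero.2 hwV) ⟨hat.le, htw.le⟩ (sub_ne_zero.2 hne)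
    have hy1 := (monotone_cdf μ hyw).trans_lt hw1
    have hnull : hazardMeasure μ (Ioc s y) = 0 := by
      rw [← measure_congr (Ioo_ae_eq_Ioc (μ := hazardMeasure μ))]
      exact hazardMeasure_absolutelyContinuous (measure_mono_null
        (fun x hx hxV => hQ x hx (sub_eq_zero.2 hxV)) (ae_iff.1 hV))
    rw [hazardMeasure_Ioc hsy.le hy1, ENNReal.ofReal_eq_zero] at hnull
    have := mul_pos hc0 (sub_pos.2 hsy)
    linarith

end TwoSided

/-! ### Assembly of the two characterizations. -/

theorem upperRecord_succ {Ω : Type*} (X : ℕ → Ω → ℝ) (m : ℕ) :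
    upperRecord X (m + 1) = recordValue X m := rfl

section Characterization

open Set

variable {Ω : Type*} [MeasurableSpace Ω] {P : Measure Ω} [IsProbabilityMeasure P] {X : ℕ → Ω → ℝ}
  {μ : Measure ℝ} [IsProbabilityMeasure μ] [NullSingletonClass μ]

theorem isExponentialType_of_regressionEq (hμ : μ = P.map (X 0)) (hX : ∀ i, Measurable (X i))
    (hindep : iIndepFun X P) (hident : ∀ i, IdentDistrib (X i) (X 0) P P) (m κ : ℕ) {h : ℝ → ℝ}
    (hcont : ContinuousOn h (closedRange (cdf μ)))
    (hf : ContDiffOn ℝ (κ + 1 : ℕ) h (openRange (cdf μ)))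
    (hB : ∀ v ∈ openRange (cdf μ), BoundaryDerivNeZero h 0 (κ + 1) (leftExtremity (cdf μ)) v)
    (hE : RegressionEq P (openRange (cdf μ)) (iteratedDeriv (κ + 1) h)
      (recordValue X (m + κ + 1)) (recordValue X m) (recordValue X (m + κ + 1 + 0 + 1))
      fun u v => ((κ + 0 + 1).factorial / (κ.factorial * Nat.factorial 0)) *
        diffQuotDeriv h 0 κ u v) :
    IsExponentialType (cdf μ) := by
  have hE' := ae_of_regressionEq hμ hX hindep hident m κ 0
    (fun v hv => (mem_openRange_iff.1 hv).2) hE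
  refine isExponentialType_of_integral_eq hcont hf hB ?_
  simpa only [pow_zero, mul_one] using hE'

theorem isExponentialType_of_regressionEq_of_regressionEq (hμ : μ = P.map (X 0))
    (hX : ∀ i, Measurable (X i)) (hindep : iIndepFun X P)
    (hident : ∀ i, IdentDistrib (X i) (X 0) P P) (m i j : ℕ) {h : ℝ → ℝ}
    (hf : ContDiffOn ℝ (i + j + 1 + 1 : ℕ) h (openRange (cdf μ)))
    (hB : ∀ v ∈ openRange (cdf μ),
      BoundaryDerivNeZero h (j + 1) (i + 1) (leftExtremity (cdf μ)) v)
    (hE : RegressionEq P (openRange (cdf μ)) (iteratedDeriv (i + 1 + j + 1) h)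
      (recordValue X (m + (i + 1) + 1)) (recordValue X m) (recordValue X (m + (i + 1) + 1 + j + 1))
      fun u v => ((i + 1 + j + 1).factorial / ((i + 1).factorial * j.factorial)) *
        diffQuotDeriv h j (i + 1) u v)
    (hE' : RegressionEq P (openRange (cdf μ)) (iteratedDeriv (i + 1 + j + 1) h)
      (recordValue X (m + 1 + i + 1)) (recordValue X (m + 1))
      (recordValue X (m + 1 + i + 1 + j + 1))
      fun u v => ((i + j + 1).factorial / (i.factorial * j.factorial)) *
        diffQuotDeriv (deriv h) j i u v) :
    IsExponentialType (cdf μ) := by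
  have hI : ∀ v ∈ openRange (cdf μ), cdf μ v < 1 := fun v hv => (mem_openRange_iff.1 hv).2
  -- Fubini in the order that fixes the upper record v and leaves almost every u.
  have h1 := ae_ae_swap_of_ae_prod (ae_of_regressionEq hμ hX hindep hident m (i + 1) j hI hE)
  have h2 := ae_ae_swap_of_ae_prod (ae_of_regressionEq hμ hX hindep hident (m + 1) i j hI hE')
  refine isExponentialType_of_hazard_sub_eq ?_
  filter_upwards [h1, h2, ae_mem_openRange] with v h1 h2 hv
  refine exists_hazard_sub_eq hf hv (hB v hv) (hf.continuousOn_iteratedDeriv_of_isOpen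
    isOpen_openRange (i := i + 1 + j + 1) (by omega)) ?_ ?_
  · filter_upwards [h1] with u hu huv huI
    rw [hu huv huI hv, show i + 1 + j + 1 = i + j + 2 by ring]
  · filter_upwards [h2] with u hu huv huI using hu huv huI hv

theorem regressionEq_of_isExponentialType (hμ : μ = P.map (X 0)) (hX : ∀ i, Measurable (X i))
    (hindep : iIndepFun X P) (hident : ∀ i, IdentDistrib (X i) (X 0) P P) (m i j : ℕ) {h : ℝ → ℝ}
    (hf : ContDiffOn ℝ (i + j + 1 : ℕ) h (openRange (cdf μ))) (hexp : IsExponentialType (cdf μ)) :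
    RegressionEq P (openRange (cdf μ)) (iteratedDeriv (i + j + 1) h)
      (recordValue X (m + i + 1)) (recordValue X m) (recordValue X (m + i + 1 + j + 1))
      fun u v => ((i + j + 1).factorial / (i.factorial * j.factorial)) *
        diffQuotDeriv h j i u v := by
  obtain ⟨l, c, hc, hR⟩ := hazard_of_isExponentialType hexp
  refine regressionEq_of_forall hμ hX hindep hident m i j
    (fun v hv => (mem_openRange_iff.1 hv).2) fun u hu v hv huv => ?_
  rw [add_comm i j] at hf ⊢
  exact add_comm i j ▸ integral_eq_of_affine_hazard hc hR hf le_rfl hu hv huv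

end Characterization

theorem theorem1 {Ω : Type*} [MeasurableSpace Ω] (P : Measure Ω) [IsProbabilityMeasure P]
    (X : ℕ → Ω → ℝ) (hmeas : ∀ i, Measurable (X i)) (hindep : iIndepFun X P)
    (hident : ∀ i, IdentDistrib (X i) (X 0) P P)
    (F : ℝ → ℝ) (hF : ∀ x, F x = cdf (P.map (X 0)) x)
    (hac : P.map (X 0) ≪ volume)
    (n k r : ℕ) (hk : 1 ≤ k) (hkn : k ≤ n - 1) (hr : 1 ≤ r)
    (h : ℝ → ℝ) (hcont : ContinuousOn h (closedRange F))
    (hdiff : ContDiffOn ℝ ((k + r - 1 : ℕ) : ℕ∞) h (openRange F)) :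
    (r = 1 →
      (∀ v ∈ openRange F, BoundaryDerivNeZero h 0 k (leftExtremity F) v) →
      (RegressionEq P (openRange F) (iteratedDeriv (k + r - 1) h)
          (upperRecord X n) (upperRecord X (n - k)) (upperRecord X (n + r))
          (fun u v => ((k + r - 1).factorial : ℝ) /
            (((k - 1).factorial : ℝ) * ((r - 1).factorial : ℝ)) *
              diffQuotDeriv h (r - 1) (k - 1) u v)
        ↔ IsExponentialType F)) ∧
    (2 ≤ r → 2 ≤ k →
      (∀ v ∈ openRange F, BoundaryDerivNeZero h r (k - 1) (leftExtremity F) v) →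
      ((RegressionEq P (openRange F) (iteratedDeriv (k + r - 1) h)
          (upperRecord X n) (upperRecord X (n - k)) (upperRecord X (n + r))
          (fun u v => ((k + r - 1).factorial : ℝ) /
            (((k - 1).factorial : ℝ) * ((r - 1).factorial : ℝ)) *
              diffQuotDeriv h (r - 1) (k - 1) u v) ∧
        RegressionEq P (openRange F) (iteratedDeriv (k + r - 1) h)
          (upperRecord X n) (upperRecord X (n - k + 1)) (upperRecord X (n + r))
          (fun u v => ((k + r - 2).factorial : ℝ) /
            (((k - 2).factorial : ℝ) * ((r - 1).factorial : ℝ)) *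
              diffQuotDeriv (deriv h) (r - 1) (k - 2) u v))
        ↔ IsExponentialType F)) := by
  obtain rfl : F = cdf (P.map (X 0)) := funext hF
  have : IsProbabilityMeasure (P.map (X 0)) :=
    Measure.isProbabilityMeasure_map (hmeas 0).aemeasurable
  have : NullSingletonClass (P.map (X 0)) := ⟨fun x => hac (measure_singleton x)⟩
  obtain ⟨κ, rfl⟩ : ∃ κ, k = κ + 1 := ⟨k - 1, by omega⟩
  obtain ⟨j, rfl⟩ : ∃ j, r = j + 1 := ⟨r - 1, by omega⟩
  -- Records are counted from 0 below, so X(n-k), X(n), X(n+r) have indices m, m+κ+1, m+κ+1+j+1.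
  obtain ⟨m, rfl⟩ : ∃ m, n = m + κ + 1 + 1 := ⟨n - κ - 2, by omega⟩
  rw [show m + κ + 1 + 1 - (κ + 1) = m + 1 by omega,
    show m + κ + 1 + 1 + (j + 1) = m + κ + 1 + j + 1 + 1 by omega,
    show κ + 1 + (j + 1) - 1 = κ + j + 1 by omega, Nat.add_sub_cancel, Nat.add_sub_cancel]
  rw [show κ + 1 + (j + 1) - 1 = κ + j + 1 by omega] at hdiff
  have hf : ContDiffOn ℝ (κ + j + 1 : ℕ) h (openRange (cdf (P.map (X 0)))) := by
    exact_mod_cast hdiff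
  simp only [upperRecord_succ]
  refine ⟨fun hj hB => ?_, fun _ hκ hB => ?_⟩
  · obtain rfl : j = 0 := by omega
    exact ⟨isExponentialType_of_regressionEq rfl hmeas hindep hident m κ hcont hf hB,
      regressionEq_of_isExponentialType rfl hmeas hindep hident m κ 0 hf⟩
  · obtain ⟨i, rfl⟩ : ∃ i, κ = i + 1 := ⟨κ - 1, by omega⟩
    rw [show i + 1 + 1 + (j + 1) - 2 = i + j + 1 by omega, show i + 1 + 1 - 2 = i by omega,
      show m + (i + 1) + 1 = m + 1 + i + 1 by omega]
    have hf' : ContDiffOn ℝ (i + j + 1 + 1 : ℕ) h (openRange (cdf (P.map (X 0)))) := by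
      rwa [show i + 1 + j + 1 = i + j + 1 + 1 by omega] at hf
    constructor
    · rintro ⟨h1, h2⟩
      refine isExponentialType_of_regressionEq_of_regressionEq rfl hmeas hindep hident m i j
        hf' hB ?_ h2
      rwa [show m + (i + 1) + 1 = m + 1 + i + 1 by omega]
    · intro hexp
      constructor
      · have := regressionEq_of_isExponentialType rfl hmeas hindep hident m (i + 1) j hf hexp
        rwa [show m + (i + 1) + 1 = m + 1 + i + 1 by omega] at this
      -- The second identity is the first one for h' with k-1 in place of k, because h^(k+r-1) is
      -- the derivative of h' of order k+r-2.
      · have := regressionEq_of_isExponentialType rfl hmeas hindep hident (m + 1) i j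
          (contDiffOn_deriv_of_isOpen hf' isOpen_openRange) hexp
        rwa [show i + 1 + j + 1 = i + j + 1 + 1 by omega, iteratedDeriv_succ']
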